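/- **Theorem (Reduction from Row Weight Min-Plus Product).** All algorithms are deterministic and run on a word RAM with words of $O(\log n)$ bits. All node weights and all finite matrix entries are integers in $\{-n^c,\dots,n^c\}$ for a constant $c$; a problem is said to be solvable in time $O(T(n))$ if for every constant $c$ it has an algorithm with that running time (the word-size constant and the constant in $O(\cdot)$ may depend on $c$). *Node-Weighted APSP*: given a graph $G=(V,E)$ on $n$ nodes (directed or undirected) with weights $w:V\to\mathbb{Z}$, compute for all $u,v\in V$ the distance $D_G[u,v]\in\mathbb{Z}\cup\{-\infty,\infty\}$, that is, the infimum of $w(v_1)+\dots+w(v_\ell)$ over all paths $u=v_0,v_1,\dots,v_\ell=v$ in $G$ (nodes may repeat; it is $\infty$ if there is no path, and $-\infty$ if some path from $u$ to $v$ meets a cycle of negative weight). *$d$-row-weight $(n,D)$ Min-Plus Product*: given an $n\times D$ matrix $A$ and a $D\times n$ matrix $B$ over $\mathbb{Z}\cup\{\infty\}$ such that every row of $A$ and every column of $B$ has at most $d$ distinct integer entries, compute the $n\times n$ matrix with entries $\min_k (A[i,k]+B[k,j])$. Let $x\in(1/2,1)$. If for some $\varepsilon>0$ Node-Weighted APSP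 in directed graphs, or Node-Weighted APSP in undirected graphs, is solvable in time $O(n^{2+x-\varepsilon})$, then there is $\varepsilon'>0$ such that $n^{1-x}$-row-weight $(n,n^x)$ Min-Plus Product (with $n^{1-x}$ and $n^x$ rounded up to integers) is solvable in time $O(n^{2+x-\varepsilon'})$. -/

import Mathlib

namespace WordRAM

/-- The binary word operations; each costs one step.  Arithmetic is unsigned and modulo `2 ^ w`. -/
inductive Op
  | add | sub | mul | div | mod | and | or | xor | shl | shr | lt | eq

def Op.eval {w : ℕ} : Op → BitVec w → BitVec w → BitVec w
  | .add, a, b => a + b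
  | .sub, a, b => a - b
  | .mul, a, b => a * b
  | .div, a, b => a / b
  | .mod, a, b => a % b
  | .and, a, b => a &&& b
  | .or, a, b => a ||| b
  | .xor, a, b => a ^^^ b
  | .shl, a, b => a <<< b
  | .shr, a, b => a >>> b
  | .lt, a, b => if a < b then 1 else 0
  | .eq, a, b => if a = b then 1 else 0

/-- Word RAM programs, in structured form.  Registers are named by natural numbers; a program is a
finite object and mentions only finitely many of them.  Programs with jumps can be brought into
this form with a constant factor of overhead (keep the program counter in a register). -/
inductive Prog
  | skip
  /-- `r := k` -/
  | const (r k : ℕ)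
  /-- `r := a ∘ b` -/
  | op (o : Op) (r a b : ℕ)
  /-- `r := mem[a]` -/
  | load (r a : ℕ)
  /-- `mem[a] := b` -/
  | store (a b : ℕ)
  /-- first `p`, then `q` -/
  | seq (p q : Prog)
  /-- if register `r` is nonzero then `p` else `q` -/
  | ite (r : ℕ) (p q : Prog)
  /-- while register `r` is nonzero do `p` -/
  | loop (r : ℕ) (p : Prog)

/-- A state of the machine with words of `w` bits: the registers, and a random access memory whose
addresses and contents are words. -/
@[ext]
structure State (w : ℕ) where
  reg : ℕ → BitVec w
  mem : BitVec w → BitVec w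

/-- `Exec p s s' t`: the program `p`, started in the state `s`, halts in the state `s'` after
exactly `t` steps.  Every instruction and every test of a register is one step. -/
inductive Exec {w : ℕ} : Prog → State w → State w → ℕ → Prop
  | skip (s) : Exec .skip s s 1
  | const (r k s) : Exec (.const r k) s ⟨Function.update s.reg r (BitVec.ofNat w k), s.mem⟩ 1
  | op (o r a b s) :
      Exec (.op o r a b) s ⟨Function.update s.reg r (o.eval (s.reg a) (s.reg b)), s.mem⟩ 1
  | load (r a s) : Exec (.load r a) s ⟨Function.update s.reg r (s.mem (s.reg a)), s.mem⟩ 1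
  | store (a b s) : Exec (.store a b) s ⟨s.reg, Function.update s.mem (s.reg a) (s.reg b)⟩ 1
  | seq {p q s₁ s₂ s₃ t₁ t₂} : Exec p s₁ s₂ t₁ → Exec q s₂ s₃ t₂ →
      Exec (.seq p q) s₁ s₃ (t₁ + t₂)
  | ite_true {r p q s s' t} : s.reg r ≠ 0 → Exec p s s' t → Exec (.ite r p q) s s' (t + 1)
  | ite_false {r p q s s' t} : s.reg r = 0 → Exec q s s' t → Exec (.ite r p q) s s' (t + 1)
  | loop_true {r p s₁ s₂ s₃ t₁ t₂} : s₁.reg r ≠ 0 → Exec p s₁ s₂ t₁ →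
      Exec (.loop r p) s₂ s₃ t₂ → Exec (.loop r p) s₁ s₃ (t₁ + t₂ + 1)
  | loop_false {r p s} : s.reg r = 0 → Exec (.loop r p) s s 1

/-- The word that stands for an integer (two's complement) or for `∞` (the largest signed word). -/
def encode (w : ℕ) : WithTop ℤ → BitVec w
  | none => BitVec.intMax w
  | some z => BitVec.ofInt w z

/-- The value that a word stands for: the largest and the smallest signed word stand for `∞` and
`-∞`, every other word for an integer (two's complement). -/
def decode {w : ℕ} (v : BitVec w) : WithBot (WithTop ℤ) :=
  if v = BitVec.intMax w then ⊤
  else if v = BitVec.intMin w then ⊥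
  else ((v.toInt : WithTop ℤ) : WithBot (WithTop ℤ))

/-- The initial state: the input is in the memory from address `0` on, all else is `0`. -/
def init (w : ℕ) (input : List (WithTop ℤ)) : State w where
  reg _ := 0
  mem a := (input.map (encode w)).getD a.toNat 0

/-- The memory holds the list `output` from address `0` on. -/
def Holds {w : ℕ} (s : State w) (output : List (WithBot (WithTop ℤ))) : Prop :=
  ∀ (a : ℕ) (h : a < output.length), decode (s.mem (BitVec.ofNat w a)) = output[a]

end WordRAM

/-- A computational problem: its instances, sorted by their size, and for each instance the list of
values that is given and the list of values that is to be computed. -/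
structure Problem where
  Inst : ℕ → Type
  input : ∀ {n : ℕ}, Inst n → List (WithTop ℤ)
  output : ∀ {n : ℕ}, Inst n → List (WithBot (WithTop ℤ))

/-- `P` is solvable in time `O(T(n))` on a (deterministic) word RAM with words of `O(log n)` bits:
one program solves all instances of every size `n ≥ 1`, on words of `κ (⌊log₂ n⌋ + 1)` bits, in at
most `K * T n` steps.  (A `κ` so small that input or output cannot be represented or addressed
is of no use to the program, as the final state has to hold the true output.) -/
def Problem.SolvableInTime (P : Problem) (T : ℕ → ℝ) : Prop :=
  ∃ (p : WordRAM.Prog) (κ : ℕ) (K : ℝ), ∀ n : ℕ, 1 ≤ n → ∀ I : P.Inst n,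
    ∃ (s : WordRAM.State (κ * (Nat.log 2 n + 1))) (t : ℕ),
      WordRAM.Exec p (WordRAM.init _ (P.input I)) s t ∧
      WordRAM.Holds s (P.output I) ∧ (t : ℝ) ≤ K * T n

/-- The entries of a matrix, row by row. -/
def rowMajor {α : Type} {m n : ℕ} (A : Matrix (Fin m) (Fin n) α) : List α :=
  List.ofFn fun e : Fin (m * n) => A e.divNat e.modNat

section Distances

variable {V : Type}

/-- `PathOfWeight E wt u v z`: there is a path from `u` to `v` along the edges `E`, vertices and
edges may repeat, of weight `z`; the weight is the sum of the node weights without the first. -/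
inductive PathOfWeight (E : V → V → Prop) (wt : V → ℤ) : V → V → ℤ → Prop
  | nil (u : V) : PathOfWeight E wt u u 0
  | cons {u v v' : V} {z : ℤ} : E u v → PathOfWeight E wt v v' z →
      PathOfWeight E wt u v' (wt v + z)

/-- The distance in `ℤ ∪ {-∞, ∞}`: `∞` if there is no path, and `-∞` if the weights of the paths
are unbounded below, that is, if some path meets a cycle of negative weight. -/
noncomputable def nodeDist (E : V → V → Prop) (wt : V → ℤ) (u v : V) : WithBot (WithTop ℤ) :=
  ⨅ (z : ℤ) (_ : PathOfWeight E wt u v z), ((z : WithTop ℤ) : WithBot (WithTop ℤ))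

end Distances

/-- Node weights on `n` nodes in the range `{-n ^ c, …, n ^ c}`. -/
def NodeWeights (c n : ℕ) : Type := {wt : Fin n → ℤ // ∀ v, |wt v| ≤ (n : ℤ) ^ c}

open Classical in
/-- A node-weighted graph as a list: `n`, the node weights, the adjacency matrix. -/
noncomputable def graphInput {n : ℕ} (E : Fin n → Fin n → Prop) (wt : Fin n → ℤ) :
    List (WithTop ℤ) :=
  [(((n : ℤ)) : WithTop ℤ)] ++ List.ofFn (fun v => (wt v : WithTop ℤ)) ++
    rowMajor (Matrix.of fun u v => if E u v then (((1 : ℤ)) : WithTop ℤ) else ((0 : ℤ)))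

/-- Node-Weighted APSP in directed graphs with weights in `{-n ^ c, …, n ^ c}`. -/
noncomputable def directedNodeWeightedAPSP (c : ℕ) : Problem where
  Inst n := Digraph (Fin n) × NodeWeights c n
  input I := graphInput I.1.Adj I.2.1
  output I := rowMajor (Matrix.of (nodeDist I.1.Adj I.2.1))

/-- Node-Weighted APSP in undirected graphs with weights in `{-n ^ c, …, n ^ c}`. -/
noncomputable def undirectedNodeWeightedAPSP (c : ℕ) : Problem where
  Inst n := SimpleGraph (Fin n) × NodeWeights c n
  input I := graphInput I.1.Adj I.2.1
  output I := rowMajor (Matrix.of (nodeDist I.1.Adj I.2.1))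

/-- The min-plus product of matrices over `ℤ ∪ {∞}`. -/
def minPlusProduct {l m n : ℕ} (A : Matrix (Fin l) (Fin m) (WithTop ℤ))
    (B : Matrix (Fin m) (Fin n) (WithTop ℤ)) : Matrix (Fin l) (Fin n) (WithTop ℤ) :=
  Matrix.of fun i j => Finset.univ.inf fun k => A i k + B k j

/-- Instances of `d`-row weight `(n, D)`-Min-Plus Product: an `n × D` matrix and a `D × n` matrix
over `ℤ ∪ {∞}`, with integer entries in `{-n ^ c, …, n ^ c}`, such that each row of the first and
each column of the second have at most `d` distinct integer entries. -/
structure RowWeightMinPlusInstance (c d n D : ℕ) where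
  A : Matrix (Fin n) (Fin D) (WithTop ℤ)
  B : Matrix (Fin D) (Fin n) (WithTop ℤ)
  A_bounded : ∀ i k (z : ℤ), A i k = z → |z| ≤ (n : ℤ) ^ c
  B_bounded : ∀ k j (z : ℤ), B k j = z → |z| ≤ (n : ℤ) ^ c
  A_rows : ∀ i, {z : ℤ | ∃ k, A i k = z}.ncard ≤ d
  B_columns : ∀ j, {z : ℤ | ∃ k, B k j = z}.ncard ≤ d

/-- `d`-row weight `(n, D)`-Min-Plus Product, where `d` and `D` are functions of `n`.  The input is
`n`, `D` and the two matrices; the output is their min-plus product. -/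
def rowWeightMinPlus (c : ℕ) (d D : ℕ → ℕ) : Problem where
  Inst n := RowWeightMinPlusInstance c (d n) n (D n)
  input {n} I := [(((n : ℤ)) : WithTop ℤ), (((D n : ℤ)) : WithTop ℤ)] ++ rowMajor I.A ++ rowMajor I.B
  output I := (rowMajor (minPlusProduct I.A I.B)).map WithBot.some

/-!
The reduction rests on the following observation.  Stack the rows of `A` and the columns of `B` as
`2 n` rows `Y u` of length `D`; the product is then given by the minima `min_k (Y u k + Y v k)`, and
every row has at most `d` values.  Suppose that for every pair of rows a guess `G u v` for the
minimum is at hand.  The indices `k` that matter for `u` and `v` satisfy `Y u k + Y v k = G u v`.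

* *Pivots.*  Say that the row `w` hits the place `(u, k)` if `G u w - Y u k` is a value of the row
  `w`.  Go through the rows `w`: if `w` hits more than `2 n D / g` places that no pivot has hit so
  far, it becomes a pivot.  As there are `2 n D` places, there are at most `g` pivots.  Otherwise the
  few new places `(u, k)` are searched exhaustively, that is, `Y u k + Y w k` is compared with the
  best value known for `u` and `w`; over all rows this takes the time `O(n · n D / g)`
  (`RowWeight.cover_spec`).
* *Pairs of pivots.*  If `Y u k + Y v k = G u v` has not been found by exhaustive search, then
  `(u, k)` is hit by a pivot `w` and `(v, k)` by a pivot `w'`.  So `Y u k` is `G u w` minus a value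
  of the row `w`, `Y v k` is `G v w'` minus a value of the row `w'`.  Join `u` to the nodes `(r, k)`
  such that `Y u k` is `G u w` minus the `r`-th value of `w`, these to all nodes `(r', k)` of a
  second layer with the same `k`, and those to `v` in the same manner.  With the weight `M - value`
  on the nodes of the two layers, and `M` on all other nodes, the minimum over all `k` of this kind
  is a distance, up to a shift that depends on `u` and `v`.  If `M` is large, the distances of weight
  at most `3 M` belong to paths with three edges, so the graph may be undirected
  (`layerGraph_path_iff`).  It has `32 n` nodes, because `(d + 1) D ≤ 8 n`.  One call of Node-Weighted
  APSP for each of the at most `g ^ 2` pairs of pivots settles all these triples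
  (`RowWeight.pivotPair_spec`).
* *Scaling.*  The guesses come from rounding.  If the entries are halved and rounded up, the doubled
  minimum of the coarse entries exceeds the true minimum by `0`, `1` or `2`
  (`RowWeight.exists_pairValue_eq`), so that three rounds for each of `O(log n)` scales suffice
  (`RowWeight.round_spec`, `RowWeight.scales_spec`).  Rounding does not increase the number of values
  in a row.

With `T` for the time of the subroutine, the total time is a logarithmic factor times
`n² d + n² D / g + g² (n² + T)`.  For `d = n ^ (1 - x)`, `D = n ^ x` and `g = n ^ (1 / a)` with a
large integer `a`, this is `n ^ (2 + x - 1 / (2 a))`; the hypothesis `1 / 2 < x` is needed for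
`n² d` only (`RowWeight.exists_productTime_le`).

The program is written in a small imperative language whose states are functions on natural numbers
(`Stmt`).  It is compiled to the word RAM with a constant factor of overhead (`Stmt.code_spec`).  The
subroutine runs on shorter words, on a memory of its own inside that of the main program; masking
every result makes it behave as on a machine of the right word size (`Exec.embed`).  A
Node-Weighted APSP algorithm for directed graphs is applied to undirected graphs unchanged, as an
undirected graph is given by the same adjacency matrix as a symmetric directed one.
-/

set_option linter.constructorNameAsVariable false
set_option linter.unusedSimpArgs false

namespace WordRAM

/-! ### Running a program for short words on a machine with longer words -/

/-- A bound for the registers that a program mentions. -/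
def Prog.regBound : Prog → ℕ
  | .skip => 0
  | .const r _ => r + 1
  | .op _ r a b => max (r + 1) (max (a + 1) (b + 1))
  | .load r a => max (r + 1) (a + 1)
  | .store a b => max (a + 1) (b + 1)
  | .seq p q => max p.regBound q.regBound
  | .ite r p q => max (r + 1) (max p.regBound q.regBound)
  | .loop r p => max (r + 1) p.regBound

/-- The program `p` for words of `w₀` bits, as a program for longer words.  Register `r` becomes
`f r`, every result is cut down to `w₀` bits by the mask `2 ^ w₀ - 1` held in the register `mask`,
and the memory is found at the address held in the register `base`. -/
def Prog.embed (base mask tmp : ℕ) (f : ℕ → ℕ) : Prog → Prog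
  | .skip => .skip
  | .const r k => .seq (.const (f r) k) (.op .and (f r) (f r) mask)
  | .op o r a b => .seq (.op o (f r) (f a) (f b)) (.op .and (f r) (f r) mask)
  | .load r a => .seq (.op .add tmp base (f a)) (.load (f r) tmp)
  | .store a b => .seq (.op .add tmp base (f a)) (.store tmp (f b))
  | .seq p q => .seq (p.embed base mask tmp f) (q.embed base mask tmp f)
  | .ite r p q => .ite (f r) (p.embed base mask tmp f) (q.embed base mask tmp f)
  | .loop r p => .loop (f r) (p.embed base mask tmp f)

/-- The state `S` holds a copy of the state `s` of a machine with shorter words: registers below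
`B` under the names `f r`, the memory from the address `b` on. -/
structure Embeds {w₀ w : ℕ} (base mask : ℕ) (f : ℕ → ℕ) (B b : ℕ) (s : State w₀) (S : State w) :
    Prop where
  reg : ∀ r < B, (S.reg (f r)).toNat = (s.reg r).toNat
  mem : ∀ x : BitVec w₀, (S.mem (BitVec.ofNat w (b + x.toNat))).toNat = (s.mem x).toNat
  base : (S.reg base).toNat = b
  mask : (S.reg mask).toNat = 2 ^ w₀ - 1

/-- For all operations the last `w₀` bits of the result on long words are the result on words of
`w₀` bits, if the arguments fit into `w₀` bits. -/
theorem Op.eval_and_mask {w₀ w : ℕ} (hw : w₀ ≤ w) (o : Op) {a b : BitVec w₀} {A B M : BitVec w}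
    (hA : A.toNat = a.toNat) (hB : B.toNat = b.toNat) (hM : M.toNat = 2 ^ w₀ - 1) :
    (o.eval A B &&& M).toNat = (o.eval a b).toNat := by
  have hd : 2 ^ w₀ ∣ 2 ^ w := pow_dvd_pow 2 hw
  have hle : 2 ^ w₀ ≤ 2 ^ w := Nat.pow_le_pow_right (by norm_num) hw
  have ha := a.isLt
  have hb := b.isLt
  rw [BitVec.toNat_and, hM, Nat.and_two_pow_sub_one_eq_mod]
  cases o
  · simp only [Op.eval, BitVec.toNat_add, hA, hB]
    exact Nat.mod_mod_of_dvd _ hd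
  · simp only [Op.eval, BitVec.toNat_sub, hA, hB]
    rw [Nat.mod_mod_of_dvd _ hd]
    obtain ⟨c, hc⟩ := hd
    have h1 : 1 ≤ c := by
      rcases Nat.eq_zero_or_pos c with h | h
      · subst h; simp at hc
      · exact h
    have : 2 ^ w - b.toNat + a.toNat = (2 ^ w₀ - b.toNat + a.toNat) + 2 ^ w₀ * (c - 1) := by
      rw [hc, Nat.mul_sub, mul_one]
      have : 2 ^ w₀ * 1 ≤ 2 ^ w₀ * c := Nat.mul_le_mul_left _ h1
      omega
    rw [this, Nat.add_mul_mod_self_left]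
  · simp only [Op.eval, BitVec.toNat_mul, hA, hB]
    exact Nat.mod_mod_of_dvd _ hd
  · simp only [Op.eval, BitVec.toNat_udiv, hA, hB]
    exact Nat.mod_eq_of_lt (lt_of_le_of_lt (Nat.div_le_self _ _) ha)
  · simp only [Op.eval, BitVec.toNat_umod, hA, hB]
    exact Nat.mod_eq_of_lt (lt_of_le_of_lt (Nat.mod_le _ _) ha)
  · simp only [Op.eval, BitVec.toNat_and, hA, hB]
    exact Nat.mod_eq_of_lt (lt_of_le_of_lt Nat.and_le_left ha)
  · simp only [Op.eval, BitVec.toNat_or, hA, hB]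
    exact Nat.mod_eq_of_lt (Nat.or_lt_two_pow ha hb)
  · simp only [Op.eval, BitVec.toNat_xor, hA, hB]
    exact Nat.mod_eq_of_lt (Nat.xor_lt_two_pow ha hb)
  · simp only [Op.eval, BitVec.shiftLeft_eq', BitVec.toNat_shiftLeft, hA, hB]
    exact Nat.mod_mod_of_dvd _ hd
  · simp only [Op.eval, BitVec.ushiftRight_eq', BitVec.toNat_ushiftRight, hA, hB]
    exact Nat.mod_eq_of_lt (lt_of_le_of_lt (Nat.shiftRight_le _ _) ha)
  · simp only [Op.eval, BitVec.lt_def, hA, hB]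
    split_ifs <;> simp [Nat.mod_mod_of_dvd _ hd]
  · have : A = B ↔ a = b := by
      rw [← BitVec.toNat_inj, ← BitVec.toNat_inj, hA, hB]
    simp only [Op.eval, this]
    split_ifs <;> simp [Nat.mod_mod_of_dvd _ hd]

/-- The embedded program does what the original does, in at most twice the time, and touches
nothing else. -/
theorem Exec.embed {w₀ w : ℕ} (hw : w₀ ≤ w) {base mask tmp : ℕ} {f : ℕ → ℕ} {B b : ℕ}
    (hb : b + 2 ^ w₀ ≤ 2 ^ w) (hf : Function.Injective f) (hfb : ∀ r, f r ≠ base)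
    (hfm : ∀ r, f r ≠ mask) (hft : ∀ r, f r ≠ tmp) (htb : tmp ≠ base) (htm : tmp ≠ mask)
    {p : Prog} {s s' : State w₀} {t : ℕ} (h : Exec p s s' t) (hp : p.regBound ≤ B)
    {S : State w} (hS : Embeds base mask f B b s S) :
    ∃ S' t', Exec (p.embed base mask tmp f) S S' t' ∧ Embeds base mask f B b s' S' ∧ t' ≤ 2 * t ∧
      (∀ r, (∀ q, r ≠ f q) → r ≠ tmp → S'.reg r = S.reg r) ∧
      ∀ a : BitVec w, a.toNat < b ∨ b + 2 ^ w₀ ≤ a.toNat → S'.mem a = S.mem a := by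
  -- writing a register of the small machine
  have key : ∀ {s : State w₀} {S S' : State w} (r : ℕ) (v : BitVec w₀),
      Embeds base mask f B b s S → S'.mem = S.mem → (S'.reg (f r)).toNat = v.toNat →
      (∀ q, q ≠ f r → q ≠ tmp → S'.reg q = S.reg q) →
      Embeds base mask f B b ⟨Function.update s.reg r v, s.mem⟩ S' := by
    intro s S S' r v h hm hv hq
    refine ⟨fun q hqB => ?_, fun x => by rw [hm]; exact h.mem x, ?_, ?_⟩
    · by_cases hqr : q = r
      · subst hqr; simpa using hv
      · rw [hq _ (fun e => hqr (hf e)) (hft q), h.reg q hqB]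
        simp [Function.update_of_ne hqr]
    · rw [hq _ (hfb r).symm htb.symm, h.base]
    · rw [hq _ (hfm r).symm htm.symm, h.mask]
  have hadr : ∀ {s : State w₀} {S : State w} (a : ℕ), a < B → Embeds base mask f B b s S →
      S.reg base + S.reg (f a) = BitVec.ofNat w (b + (s.reg a).toNat) := by
    intro s S a ha h
    apply BitVec.eq_of_toNat_eq
    rw [BitVec.toNat_add, h.base, h.reg a ha, BitVec.toNat_ofNat]
  induction h generalizing S with
  | skip s => exact ⟨S, 1, .skip _, hS, by omega, fun _ _ _ => rfl, fun _ _ => rfl⟩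
  | const r k s =>
    refine ⟨_, _, .seq (.const _ _ _) (.op _ _ _ _ _), ?_, by omega, ?_, fun _ _ => rfl⟩
    · refine key r _ hS rfl ?_ fun q hq _ => by simp [Function.update_of_ne hq]
      simp only [Function.update_self, Function.update_of_ne (hfm r).symm, Op.eval,
        BitVec.toNat_and, hS.mask, Nat.and_two_pow_sub_one_eq_mod, BitVec.toNat_ofNat]
      exact Nat.mod_mod_of_dvd _ (pow_dvd_pow 2 hw)
    · intro q hq _
      simp [Function.update_of_ne (hq r)]
  | op o r a c s =>
    simp only [Prog.regBound, sup_le_iff] at hp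
    refine ⟨_, _, .seq (.op _ _ _ _ _) (.op _ _ _ _ _), ?_, by omega, ?_, fun _ _ => rfl⟩
    · refine key r _ hS rfl ?_ fun q hq _ => by simp [Function.update_of_ne hq]
      simp only [Function.update_self, Function.update_of_ne (hfm r).symm]
      exact Op.eval_and_mask hw o (hS.reg a (by omega)) (hS.reg c (by omega)) hS.mask
    · intro q hq _
      simp [Function.update_of_ne (hq r)]
  | load r a s =>
    simp only [Prog.regBound, sup_le_iff] at hp
    refine ⟨_, _, .seq (.op _ _ _ _ _) (.load _ _ _), ?_, by omega, ?_, fun _ _ => rfl⟩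
    · refine key r _ hS rfl ?_ fun q hq hqt => by
        simp [Function.update_of_ne hq, Function.update_of_ne hqt]
      simp only [Function.update_self, Op.eval]
      rw [hadr a (by omega) hS, hS.mem]
    · intro q hq hqt
      simp [Function.update_of_ne (hq r), Function.update_of_ne hqt]
  | store a c s =>
    simp only [Prog.regBound, sup_le_iff] at hp
    refine ⟨_, _, .seq (.op _ _ _ _ _) (.store _ _ _), ?_, by omega, ?_, ?_⟩
    · have hne : ∀ r, r ≠ tmp → ∀ v, Function.update S.reg tmp v r = S.reg r :=
        fun r h v => Function.update_of_ne h _ _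
      refine ⟨fun r hr => ?_, fun x => ?_, ?_, ?_⟩
      · simp only [hne _ (hft r)]; exact hS.reg r hr
      · simp only [hne _ (hft c), Function.update_self, Op.eval]
        rw [hadr a (by omega) hS]
        by_cases hx : x = s.reg a
        · subst hx; simp [hS.reg c (by omega)]
        · rw [Function.update_of_ne hx, Function.update_of_ne, hS.mem]
          intro e
          have e := congrArg BitVec.toNat e
          have h1 := x.isLt
          have h2 := (s.reg a).isLt
          rw [BitVec.toNat_ofNat, BitVec.toNat_ofNat, Nat.mod_eq_of_lt (by omega),
            Nat.mod_eq_of_lt (by omega)] at e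
          exact hx (BitVec.eq_of_toNat_eq (by omega))
      · simp only [hne _ htb.symm]; exact hS.base
      · simp only [hne _ htm.symm]; exact hS.mask
    · intro q hq hqt
      simp [Function.update_of_ne hqt]
    · intro x hx
      have h2 := (s.reg a).isLt
      simp only [Function.update_self, Op.eval]
      rw [hadr a (by omega) hS, Function.update_of_ne]
      rintro rfl
      rw [BitVec.toNat_ofNat, Nat.mod_eq_of_lt (by omega)] at hx
      omega
  | seq _ _ ih₁ ih₂ =>
    simp only [Prog.regBound, sup_le_iff] at hp
    obtain ⟨S₁, t₁, e₁, h₁, c₁, r₁, m₁⟩ := ih₁ hp.1 hS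
    obtain ⟨S₂, t₂, e₂, h₂, c₂, r₂, m₂⟩ := ih₂ hp.2 h₁
    exact ⟨S₂, _, .seq e₁ e₂, h₂, by omega, fun q hq hqt => by rw [r₂ q hq hqt, r₁ q hq hqt],
      fun a ha => by rw [m₂ a ha, m₁ a ha]⟩
  | @ite_true r p q s s' t hr _ ih =>
    simp only [Prog.regBound, sup_le_iff] at hp
    obtain ⟨S₁, t₁, e₁, h₁, c₁, r₁, m₁⟩ := ih hp.2.1 hS
    refine ⟨S₁, _, .ite_true (fun h0 => hr ?_) e₁, h₁, by omega, r₁, m₁⟩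
    have := hS.reg r (by omega)
    rw [h0] at this
    exact BitVec.eq_of_toNat_eq (by simpa using this.symm)
  | @ite_false r p q s s' t hr _ ih =>
    simp only [Prog.regBound, sup_le_iff] at hp
    obtain ⟨S₁, t₁, e₁, h₁, c₁, r₁, m₁⟩ := ih hp.2.2 hS
    refine ⟨S₁, _, .ite_false ?_ e₁, h₁, by omega, r₁, m₁⟩
    have := hS.reg r (by omega)
    rw [hr] at this
    exact BitVec.eq_of_toNat_eq (by simpa using this)
  | @loop_true r p s₁ s₂ s₃ t₁ t₂ hr _ _ ih₁ ih₂ =>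
    have hp' := hp
    simp only [Prog.regBound, sup_le_iff] at hp
    obtain ⟨S₁, t₁, e₁, h₁, c₁, r₁, m₁⟩ := ih₁ hp.2 hS
    obtain ⟨S₂, t₂, e₂, h₂, c₂, r₂, m₂⟩ := ih₂ hp' h₁
    refine ⟨S₂, _, .loop_true (fun h0 => hr ?_) e₁ e₂, h₂, by omega,
      fun q hq hqt => by rw [r₂ q hq hqt, r₁ q hq hqt], fun a ha => by rw [m₂ a ha, m₁ a ha]⟩
    have := hS.reg r (by omega)
    rw [h0] at this
    exact BitVec.eq_of_toNat_eq (by simpa using this.symm)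
  | @loop_false r p s hr =>
    simp only [Prog.regBound, sup_le_iff] at hp
    refine ⟨S, _, .loop_false ?_, hS, by omega, fun _ _ _ => rfl, fun _ _ => rfl⟩
    have := hS.reg r (by omega)
    rw [hr] at this
    exact BitVec.eq_of_toNat_eq (by simpa using this)

end WordRAM

namespace WordRAM

/-! ### A small imperative language and its compilation -/

/-- The variables of the language; `radix` and `mask` are used by the compiler for the addresses of
array entries and for the words of the subroutine.  Of the others, `n` to `inf` are fixed after the
input has been read: `D` is the inner dimension, `L` the number of binary digits of `n`, `g` the
bound for the number of pivots, `nc` the bound for the entries, `m = 2 n`, `Q = 8 n`, `N = 32 n`,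
`M = 16 nc`, `Sc` the number of scales, and `inf` the word for infinity.  The variable `s` is the
scale, `rho` the number of the round, and `R` the number of pivots. -/
inductive Var
  | radix | mask | n | D | L | g | nc | m | Q | N | M | Sc | inf
  | i | j | s | e | rho | u | v | k | r | x | y | h | b | acc | R | t | t' | p | p' | z | q | stage
  deriving DecidableEq

/-- The arrays of the language, with four indices each, the last ones being `0` where they are not
mentioned here.  The scale is called `s`, the round `ρ`.
* `io 0 0 0 x` is the word `x` of the input and of the output.
* `Y s u k` is the entry `k` of the row `u`, as a positive number, or `0` for infinity.
* `tab s u y` is the rank of the value `y` among the values of the row `u`, or `0` if `y` is no value;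
  `val s u r` is the value of rank `r`, `cnt s u r` the number of its places, `lst s u r i` the `i`-th
  of them, and `nd s u` the number of values.
* `best s u v` is `16 nc` minus the least sum found for the rows `u` and `v`, or `0` if there is none.
* `H ρ u v` is the guess for the rows `u` and `v`, increased by `2`.
* `cov ρ u r` is `1` if the places in the row `u` with the value of rank `r` are hit by a pivot, and
  `piv ρ i` is the `i`-th pivot.
* `ora ρ t t' x` is the memory of the subroutine for the pivots `t` and `t'`.  Every call has a memory
  of its own, so that it starts with the zeros that the subroutine expects around its input. -/
inductive Arr
  | io | Y | tab | val | cnt | lst | nd | best | H | cov | piv | ora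
  deriving DecidableEq

/-- The number of a variable; its value is kept in the register `3 * x.idx`. -/
def Var.idx (x : Var) : ℕ := x.ctorIdx

/-- The number of an array, the leading digit of the addresses of its entries.  It is `0` for `io`. -/
def Arr.idx (A : Arr) : ℕ := A.ctorIdx

theorem Var.idx_injective : Function.Injective Var.idx := by
  intro a b h
  have := congrArg Var.ofNat h
  simpa [Var.idx, Var.ofNat_ctorIdx] using this

theorem Arr.idx_injective : Function.Injective Arr.idx := by
  intro a b h
  have := congrArg Arr.ofNat h
  simpa [Arr.idx, Arr.ofNat_ctorIdx] using this

theorem Arr.idx_lt (A : Arr) : A.idx < 16 := by cases A <;> decide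

/-- The states of the language: values of the variables and of the array entries. -/
structure St where
  v : Var → ℕ
  m : Arr → ℕ → ℕ → ℕ → ℕ → ℕ

/-- The state after an assignment to a variable. -/
def St.set (σ : St) (x : Var) (z : ℕ) : St := ⟨Function.update σ.v x z, σ.m⟩

/-- The state after an assignment to an array entry. -/
def St.put (σ : St) (A : Arr) (a b c d z : ℕ) : St :=
  ⟨σ.v, fun A' a' b' c' d' =>
    if A' = A ∧ a' = a ∧ b' = b ∧ c' = c ∧ d' = d then z else σ.m A' a' b' c' d'⟩

/-- The parameters of the machine: words of `w` bits, array indices below `2 ^ l`, and a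
subroutine `prog` that runs on words of `w₀` bits. -/
structure Cfg where
  w : ℕ
  l : ℕ
  w₀ : ℕ
  prog : Prog
  l_ge : 4 ≤ l
  w₀_le : w₀ ≤ l
  l_le : 5 * l ≤ w

/-- Binary operations with their values in `ℕ`.  Only `wadd` and `wsub` wrap around. -/
inductive BinOp
  | add | sub | mul | div | mod | shl | shr | lt | eq | wadd | wsub

def BinOp.eval (w : ℕ) : BinOp → ℕ → ℕ → ℕ
  | .add, a, b => a + b
  | .sub, a, b => a - b
  | .mul, a, b => a * b
  | .div, a, b => a / b
  | .mod, a, b => a % b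
  | .shl, a, b => a * 2 ^ b
  | .shr, a, b => a / 2 ^ b
  | .lt, a, b => if a < b then 1 else 0
  | .eq, a, b => if a = b then 1 else 0
  | .wadd, a, b => (a + b) % 2 ^ w
  | .wsub, a, b => (2 ^ w - b + a) % 2 ^ w

/-- The condition under which the machine computes the value in `ℕ`. -/
def BinOp.Safe (w : ℕ) : BinOp → ℕ → ℕ → Prop
  | .add, a, b => a + b < 2 ^ w
  | .sub, a, b => b ≤ a
  | .mul, a, b => a * b < 2 ^ w
  | .shl, a, b => a * 2 ^ b < 2 ^ w
  | _, _, _ => True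

/-- The machine operation for a binary operation. -/
def BinOp.op : BinOp → Op
  | .add => .add
  | .sub => .sub
  | .mul => .mul
  | .div => .div
  | .mod => .mod
  | .shl => .shl
  | .shr => .shr
  | .lt => .lt
  | .eq => .eq
  | .wadd => .add
  | .wsub => .sub

/-- Expressions: literals, variables, binary operations and array entries. -/
inductive Expr
  | lit (k : ℕ)
  | var (x : Var)
  | bin (o : BinOp) (a b : Expr)
  | get (A : Arr) (a b c d : Expr)
  /-- the input word with the given address -/
  | inp (a : Expr)

/-- The value of an expression in a state. -/
def Expr.eval (w : ℕ) (σ : St) : Expr → ℕ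
  | .lit k => k
  | .var x => σ.v x
  | .bin o a b => o.eval w (a.eval w σ) (b.eval w σ)
  | .get A a b c d => σ.m A (a.eval w σ) (b.eval w σ) (c.eval w σ) (d.eval w σ)
  | .inp a => σ.m .io 0 0 0 (a.eval w σ)

/-- The condition under which the machine computes the value of an expression: no operation leaves
the range of the words, and all array indices are less than `2 ^ l`. -/
def Expr.Safe (K : Cfg) (σ : St) : Expr → Prop
  | .lit k => k < 2 ^ K.w
  | .var _ => True
  | .bin o a b => a.Safe K σ ∧ b.Safe K σ ∧ o.Safe K.w (a.eval K.w σ) (b.eval K.w σ)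
  | .get _ a b c d => σ.v .radix = 2 ^ K.l ∧
      (a.Safe K σ ∧ a.eval K.w σ < 2 ^ K.l) ∧ (b.Safe K σ ∧ b.eval K.w σ < 2 ^ K.l) ∧
      (c.Safe K σ ∧ c.eval K.w σ < 2 ^ K.l) ∧ d.Safe K σ ∧ d.eval K.w σ < 2 ^ K.l
  | .inp a => a.Safe K σ ∧ a.eval K.w σ < 2 ^ K.l

/-- Statements.  The only loops are bounded ones, so that a running time can be read off, and `call`
runs the subroutine in place on an array. -/
inductive Stmt
  | skip
  | assign (x : Var) (e : Expr)
  | put (A : Arr) (a b c d e : Expr)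
  /-- write an output word -/
  | out (a e : Expr)
  | seq (p q : Stmt)
  | ite (e : Expr) (p q : Stmt)
  /-- `p` for `x` from `0` to `e - 1`; the bound is evaluated once -/
  | for (x : Var) (e : Expr) (p : Stmt)
  /-- run the subroutine on the memory `A a b c _` -/
  | call (A : Arr) (a b c : Expr)

/-- `Big K c σ σ' t`: the statement `c` takes the state `σ` to `σ'`, all operations are safe, and
`t` elementary statements and tests are executed, the steps of the subroutine included.  The rule
for loops has the sequence of the states between the iterations as an argument. -/
inductive Big (K : Cfg) : Stmt → St → St → ℕ → Prop
  | skip (σ) : Big K .skip σ σ 1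
  | assign {x e σ} : e.Safe K σ → Big K (.assign x e) σ (σ.set x (e.eval K.w σ)) 1
  | put {A a b c d e σ} : (Expr.get A a b c d).Safe K σ → e.Safe K σ →
      Big K (.put A a b c d e) σ
        (σ.put A (a.eval K.w σ) (b.eval K.w σ) (c.eval K.w σ) (d.eval K.w σ) (e.eval K.w σ)) 1
  | out {a e σ} : a.Safe K σ → a.eval K.w σ < 2 ^ K.l → e.Safe K σ →
      Big K (.out a e) σ (σ.put .io 0 0 0 (a.eval K.w σ) (e.eval K.w σ)) 1
  | seq {p q σ₁ σ₂ σ₃ t₁ t₂} : Big K p σ₁ σ₂ t₁ → Big K q σ₂ σ₃ t₂ →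
      Big K (.seq p q) σ₁ σ₃ (t₁ + t₂)
  | ite_true {e p q σ σ' t} : e.Safe K σ → e.eval K.w σ ≠ 0 → Big K p σ σ' t →
      Big K (.ite e p q) σ σ' (t + 1)
  | ite_false {e p q σ σ' t} : e.Safe K σ → e.eval K.w σ = 0 → Big K q σ σ' t →
      Big K (.ite e p q) σ σ' (t + 1)
  | iterate {x e p} {σ : ℕ → St} {τ : ℕ → ℕ} : e.Safe K (σ 0) →
      (∀ i < e.eval K.w (σ 0), Big K p ((σ i).set x i) (σ (i + 1)) (τ i)) →
      Big K (.for x e p) (σ 0) (σ (e.eval K.w (σ 0)))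
        (1 + ∑ i ∈ Finset.range (e.eval K.w (σ 0)), (τ i + 1))
  | call {A a b c σ} {s s' : State K.w₀} {t} : (Expr.get A a b c (.lit 0)).Safe K σ →
      σ.v .mask = 2 ^ K.w₀ - 1 → s.reg = (fun _ => 0) →
      (∀ x : BitVec K.w₀, (s.mem x).toNat =
        σ.m A (a.eval K.w σ) (b.eval K.w σ) (c.eval K.w σ) x.toNat) →
      Exec K.prog s s' t →
      Big K (.call A a b c) σ ⟨σ.v, fun A' a' b' c' d' =>
        if A' = A ∧ a' = a.eval K.w σ ∧ b' = b.eval K.w σ ∧ c' = c.eval K.w σ ∧ d' < 2 ^ K.w₀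
        then (s'.mem (BitVec.ofNat K.w₀ d')).toNat else σ.m A' a' b' c' d'⟩ (t + 1)

/-! The compiler.  Variables live in the registers `3 i`, intermediate results in the registers
`3 i + 1`, and the registers of the subroutine are the registers `3 i + 2`. -/

/-- The register of the `d`-th intermediate result. -/
def tmp (d : ℕ) : ℕ := 3 * d + 1

/-- Computes the address of an array entry from the indices in `tmp d, …, tmp (d + 3)` into
`tmp (d + 4)`. -/
def addrCode (A : Arr) (d : ℕ) : Prog :=
  let T := tmp (d + 4)
  let P := 3 * Var.radix.idx
  .seq (.const T A.idx) <| .seq (.op .mul T T P) <| .seq (.op .add T T (tmp d)) <|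
  .seq (.op .mul T T P) <| .seq (.op .add T T (tmp (d + 1))) <|
  .seq (.op .mul T T P) <| .seq (.op .add T T (tmp (d + 2))) <|
  .seq (.op .mul T T P) (.op .add T T (tmp (d + 3)))

/-- Computes the value of an expression into `tmp d`. -/
def Expr.code : Expr → ℕ → Prog
  | .lit k, d => .const (tmp d) k
  | .var x, d => .op .or (tmp d) (3 * x.idx) (3 * x.idx)
  | .bin o a b, d => .seq (a.code d) (.seq (b.code (d + 1))
      (.op o.op (tmp d) (tmp d) (tmp (d + 1))))
  | .get A a b c i, d => .seq (a.code d) (.seq (b.code (d + 1)) (.seq (c.code (d + 2))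
      (.seq (i.code (d + 3)) (.seq (addrCode A d) (.load (tmp d) (tmp (d + 4)))))))
  | .inp a, d => .seq (a.code d) (.load (tmp d) (tmp d))

/-- A bound for the number of instructions that the code of an expression executes. -/
def Expr.size : Expr → ℕ
  | .lit _ => 1
  | .var _ => 1
  | .bin _ a b => a.size + b.size + 1
  | .get _ a b c d => a.size + b.size + c.size + d.size + 10
  | .inp a => a.size + 1

/-- Sets the registers of the subroutine to zero. -/
def clearCode : ℕ → Prog
  | 0 => .skip
  | k + 1 => .seq (clearCode k) (.const (3 * k + 2) 0)

/-- The code of a statement, with `o` for the subroutine, that uses the intermediate results from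
`tmp d` on.  A loop keeps its bound in `tmp d`, its counter in `tmp (d + 1)`, and the result of the
test in `tmp (d + 2)`. -/
def Stmt.code (o : Prog) : Stmt → ℕ → Prog
  | .skip, _ => .skip
  | .assign x e, d => .seq (e.code d) (.op .or (3 * x.idx) (tmp d) (tmp d))
  | .put A a b c i e, d => .seq (a.code d) (.seq (b.code (d + 1)) (.seq (c.code (d + 2))
      (.seq (i.code (d + 3)) (.seq (addrCode A d)
      (.seq (e.code (d + 5)) (.store (tmp (d + 4)) (tmp (d + 5))))))))
  | .out a e, d => .seq (a.code d) (.seq (e.code (d + 1)) (.store (tmp d) (tmp (d + 1))))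
  | .seq p q, d => .seq (p.code o d) (q.code o d)
  | .ite e p q, d => .seq (e.code d) (.ite (tmp d) (p.code o d) (q.code o d))
  | .for x e p, d => .seq (e.code d) (.seq (.const (tmp (d + 1)) 0)
      (.seq (.op .lt (tmp (d + 2)) (tmp (d + 1)) (tmp d))
      (.loop (tmp (d + 2)) (.seq (.op .or (3 * x.idx) (tmp (d + 1)) (tmp (d + 1)))
        (.seq (.const (tmp (d + 2)) 1) (.seq (.op .add (tmp (d + 1)) (tmp (d + 1)) (tmp (d + 2)))
        (.seq (p.code o (d + 2)) (.op .lt (tmp (d + 2)) (tmp (d + 1)) (tmp d)))))))))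
  | .call A a b c, d => .seq (a.code d) (.seq (b.code (d + 1)) (.seq (c.code (d + 2))
      (.seq (.const (tmp (d + 3)) 0) (.seq (addrCode A d) (.seq (clearCode o.regBound)
      (o.embed (tmp (d + 4)) (3 * Var.mask.idx) (tmp (d + 5)) (fun r => 3 * r + 2)))))))

/-- A bound for the number of instructions that the code of a statement executes for each of the
elementary statements and tests that `Big` counts. -/
def Stmt.size (o : Prog) : Stmt → ℕ
  | .skip => 1
  | .assign _ e => e.size + 1
  | .put _ a b c d e => a.size + b.size + c.size + d.size + e.size + 10
  | .out a e => a.size + e.size + 1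
  | .seq p q => p.size o + q.size o
  | .ite e p q => e.size + 1 + p.size o + q.size o
  | .for _ e p => e.size + 5 + p.size o
  | .call _ a b c => a.size + b.size + c.size + o.regBound + 13

/-- The address of an array entry: the number of the array and the four indices are the digits to
the base `2 ^ l`, and five such digits fit into a word. -/
def adr (K : Cfg) (A : Arr) (a b c d : ℕ) : ℕ :=
  (((A.idx * 2 ^ K.l + a) * 2 ^ K.l + b) * 2 ^ K.l + c) * 2 ^ K.l + d

theorem adr_io (K : Cfg) (d : ℕ) : adr K .io 0 0 0 d = d := by
  simp [adr, Arr.idx, Arr.ctorIdx]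

/-- The machine state `S` represents the state `σ` of the language. -/
structure Rep (K : Cfg) (σ : St) (S : State K.w) : Prop where
  v : ∀ x : Var, (S.reg (3 * x.idx)).toNat = σ.v x
  m : ∀ A a b c d, a < 2 ^ K.l → b < 2 ^ K.l → c < 2 ^ K.l → d < 2 ^ K.l →
    (S.mem (BitVec.ofNat K.w (adr K A a b c d))).toNat = σ.m A a b c d

theorem mul_add_inj {P x y a b : ℕ} (ha : a < P) (hb : b < P) (h : x * P + a = y * P + b) :
    x = y ∧ a = b := by
  have h1 := congrArg (· / P) h
  have h2 := congrArg (· % P) h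
  have hP : 0 < P := by omega
  simp only [mul_comm _ P, Nat.mul_add_div hP, Nat.mul_add_mod, Nat.div_eq_of_lt ha,
    Nat.div_eq_of_lt hb, Nat.mod_eq_of_lt ha, Nat.mod_eq_of_lt hb, add_zero] at h1 h2
  exact ⟨h1, h2⟩

theorem mul_add_lt {P x a k : ℕ} (ha : a < P) (hx : x < k) : x * P + a < k * P := by
  have : (x + 1) * P ≤ k * P := Nat.mul_le_mul_right _ hx
  rw [add_mul] at this
  omega

theorem Cfg.pow_le (K : Cfg) (k : ℕ) (hk : k ≤ 5) : (2 ^ K.l) ^ k ≤ 2 ^ K.w := by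
  rw [← pow_mul]
  exact Nat.pow_le_pow_right (by norm_num) (le_trans (by nlinarith [K.l_ge]) K.l_le)

theorem Cfg.sixteen_le (K : Cfg) : 16 ≤ 2 ^ K.l :=
  le_trans (by norm_num) (Nat.pow_le_pow_right (show 0 < 2 by norm_num) K.l_ge)

theorem Cfg.one_lt (K : Cfg) : 1 < 2 ^ K.w := by
  have := pow_one (2 ^ K.l) ▸ K.pow_le 1 (by norm_num)
  have := K.sixteen_le
  omega

section adr

variable (K : Cfg) (A : Arr) {a b c d : ℕ}

theorem adr1_lt (ha : a < 2 ^ K.l) : A.idx * 2 ^ K.l + a < (2 ^ K.l) ^ 2 := by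
  rw [pow_succ, pow_one]
  exact mul_add_lt ha (lt_of_lt_of_le A.idx_lt K.sixteen_le)

theorem adr2_lt (ha : a < 2 ^ K.l) (hb : b < 2 ^ K.l) :
    (A.idx * 2 ^ K.l + a) * 2 ^ K.l + b < (2 ^ K.l) ^ 3 := by
  rw [pow_succ]
  exact mul_add_lt hb (adr1_lt K A ha)

theorem adr3_lt (ha : a < 2 ^ K.l) (hb : b < 2 ^ K.l) (hc : c < 2 ^ K.l) :
    ((A.idx * 2 ^ K.l + a) * 2 ^ K.l + b) * 2 ^ K.l + c < (2 ^ K.l) ^ 4 := by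
  rw [pow_succ]
  exact mul_add_lt hc (adr2_lt K A ha hb)

theorem adr_lt (ha : a < 2 ^ K.l) (hb : b < 2 ^ K.l) (hc : c < 2 ^ K.l) (hd : d < 2 ^ K.l) :
    adr K A a b c d < 2 ^ K.w := by
  refine lt_of_lt_of_le ?_ (K.pow_le 5 le_rfl)
  rw [adr, pow_succ]
  exact mul_add_lt hd (adr3_lt K A ha hb hc)

end adr

theorem adr_inj (K : Cfg) {A A' : Arr} {a b c d a' b' c' d' : ℕ}
    (ha : a < 2 ^ K.l) (hb : b < 2 ^ K.l) (hc : c < 2 ^ K.l) (hd : d < 2 ^ K.l)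
    (ha' : a' < 2 ^ K.l) (hb' : b' < 2 ^ K.l) (hc' : c' < 2 ^ K.l) (hd' : d' < 2 ^ K.l)
    (h : adr K A a b c d = adr K A' a' b' c' d') :
    A = A' ∧ a = a' ∧ b = b' ∧ c = c' ∧ d = d' := by
  obtain ⟨h, e1⟩ := mul_add_inj hd hd' h
  obtain ⟨h, e2⟩ := mul_add_inj hc hc' h
  obtain ⟨h, e3⟩ := mul_add_inj hb hb' h
  obtain ⟨h, e4⟩ := mul_add_inj ha ha' h
  exact ⟨Arr.idx_injective h, e4, e3, e2, e1⟩

/-- The correctness of the code of a binary operation. -/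
theorem BinOp.op_eval {w : ℕ} (hw : 1 < 2 ^ w) (o : BinOp) (A B : BitVec w)
    (h : o.Safe w A.toNat B.toNat) : (o.op.eval A B).toNat = o.eval w A.toNat B.toNat := by
  have hA := A.isLt
  have hB := B.isLt
  cases o <;> simp only [BinOp.Safe] at h
  · simp only [BinOp.op, Op.eval, BitVec.toNat_add, BinOp.eval]
    exact Nat.mod_eq_of_lt h
  · simp only [BinOp.op, Op.eval, BitVec.toNat_sub, BinOp.eval]
    rw [show 2 ^ w - B.toNat + A.toNat = A.toNat - B.toNat + 2 ^ w by omega, Nat.add_mod_right]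
    exact Nat.mod_eq_of_lt (by omega)
  · simp only [BinOp.op, Op.eval, BitVec.toNat_mul, BinOp.eval]
    exact Nat.mod_eq_of_lt h
  · rfl
  · rfl
  · simp only [BinOp.op, Op.eval, BitVec.shiftLeft_eq', BitVec.toNat_shiftLeft, BinOp.eval,
      Nat.shiftLeft_eq]
    exact Nat.mod_eq_of_lt h
  · simp only [BinOp.op, Op.eval, BitVec.ushiftRight_eq', BitVec.toNat_ushiftRight, BinOp.eval,
      Nat.shiftRight_eq_div_pow]
  · simp only [BinOp.op, Op.eval, BitVec.lt_def, BinOp.eval]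
    split_ifs <;> simp [Nat.mod_eq_of_lt hw]
  · simp only [BinOp.op, Op.eval, ← BitVec.toNat_inj, BinOp.eval]
    split_ifs <;> simp [Nat.mod_eq_of_lt hw]
  · simp only [BinOp.op, Op.eval, BitVec.toNat_add, BinOp.eval]
  · simp only [BinOp.op, Op.eval, BitVec.toNat_sub, BinOp.eval]

/-- `S'` differs from `S` at most in the intermediate results from `tmp d` on. -/
def SameBelow {w : ℕ} (d : ℕ) (S S' : State w) : Prop :=
  S'.mem = S.mem ∧ ∀ r, (∀ i, d ≤ i → r ≠ tmp i) → S'.reg r = S.reg r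

theorem SameBelow.trans {w : ℕ} {d d' : ℕ} {S S' S'' : State w} (h : SameBelow d S S')
    (h' : SameBelow d' S' S'') (hd : d ≤ d') : SameBelow d S S'' :=
  ⟨h'.1.trans h.1, fun _ hr => (h'.2 _ fun i hi => hr i (hd.trans hi)).trans (h.2 _ hr)⟩

theorem SameBelow.update {w : ℕ} {d i : ℕ} (S : State w) (v : BitVec w) (hi : d ≤ i) :
    SameBelow d S ⟨Function.update S.reg (tmp i) v, S.mem⟩ :=
  ⟨rfl, fun _ hr => Function.update_of_ne (hr i hi) _ _⟩

theorem SameBelow.tmp {w : ℕ} {d i : ℕ} {S S' : State w} (h : SameBelow d S S') (hi : i < d) :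
    S'.reg (tmp i) = S.reg (tmp i) :=
  h.2 _ fun j hj e => by simp only [WordRAM.tmp] at e; omega

theorem SameBelow.var {w : ℕ} {d : ℕ} {S S' : State w} (h : SameBelow d S S') (x : ℕ) :
    S'.reg (3 * x) = S.reg (3 * x) :=
  h.2 _ fun j hj e => by simp only [WordRAM.tmp] at e; omega

theorem SameBelow.rep {K : Cfg} {d : ℕ} {S S' : State K.w} (h : SameBelow d S S') {σ : St}
    (hS : Rep K σ S) : Rep K σ S' :=
  ⟨fun x => by rw [h.var]; exact hS.v x, by rw [h.1]; exact hS.m⟩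

theorem tmp_ne {i j : ℕ} (h : i ≠ j) : tmp i ≠ tmp j := by
  simp only [tmp]; omega

theorem addrCode_spec (K : Cfg) (A : Arr) {a b c i d : ℕ} {S : State K.w}
    (hP : (S.reg (3 * Var.radix.idx)).toNat = 2 ^ K.l)
    (h0 : (S.reg (tmp d)).toNat = a) (h1 : (S.reg (tmp (d + 1))).toNat = b)
    (h2 : (S.reg (tmp (d + 2))).toNat = c) (h3 : (S.reg (tmp (d + 3))).toNat = i) :
    ∃ S', Exec (addrCode A d) S S' 9 ∧ SameBelow (d + 4) S S' ∧
      S'.reg (tmp (d + 4)) = BitVec.ofNat K.w (adr K A a b c i) := by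
  have hP' : S.reg (3 * Var.radix.idx) = BitVec.ofNat K.w (2 ^ K.l) := by
    rw [← hP, BitVec.ofNat_toNat, BitVec.setWidth_eq]
  have e0 : S.reg (tmp d) = BitVec.ofNat K.w a := by
    rw [← h0, BitVec.ofNat_toNat, BitVec.setWidth_eq]
  have e1 : S.reg (tmp (d + 1)) = BitVec.ofNat K.w b := by
    rw [← h1, BitVec.ofNat_toNat, BitVec.setWidth_eq]
  have e2 : S.reg (tmp (d + 2)) = BitVec.ofNat K.w c := by
    rw [← h2, BitVec.ofNat_toNat, BitVec.setWidth_eq]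
  have e3 : S.reg (tmp (d + 3)) = BitVec.ofNat K.w i := by
    rw [← h3, BitVec.ofNat_toNat, BitVec.setWidth_eq]
  refine ⟨⟨Function.update S.reg (tmp (d + 4)) (BitVec.ofNat K.w (adr K A a b c i)), S.mem⟩, ?_,
    SameBelow.update _ _ le_rfl, by simp⟩
  have n0 : 3 * Var.radix.idx ≠ tmp (d + 4) := by simp only [tmp]; omega
  have n1 := tmp_ne (show d ≠ d + 4 by omega)
  have n2 := tmp_ne (show d + 1 ≠ d + 4 by omega)
  have n3 := tmp_ne (show d + 2 ≠ d + 4 by omega)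
  have n4 := tmp_ne (show d + 3 ≠ d + 4 by omega)
  have := show Exec (addrCode A d) S _ _ from Exec.seq (.const _ _ _) <| .seq (.op _ _ _ _ _) <|
    .seq (.op _ _ _ _ _) <| .seq (.op _ _ _ _ _) <| .seq (.op _ _ _ _ _) <|
    .seq (.op _ _ _ _ _) <| .seq (.op _ _ _ _ _) <| .seq (.op _ _ _ _ _) <| .op _ _ _ _ _
  simp only [Function.update_self, Function.update_idem, Function.update_of_ne n0,
    Function.update_of_ne n1, Function.update_of_ne n2, Function.update_of_ne n3,
    Function.update_of_ne n4, hP', e0, e1, e2, e3, Op.eval, ← BitVec.ofNat_mul,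
    ← BitVec.ofNat_add] at this
  exact this

theorem Expr.code_spec (K : Cfg) {σ : St} (e : Expr) (he : e.Safe K σ) (d : ℕ) {S : State K.w}
    (hS : Rep K σ S) : ∃ S' t, Exec (e.code d) S S' t ∧ t ≤ e.size ∧ SameBelow d S S' ∧
      (S'.reg (tmp d)).toNat = e.eval K.w σ := by
  induction e generalizing d S with
  | lit k =>
    refine ⟨_, _, .const _ _ _, le_rfl, SameBelow.update _ _ le_rfl, ?_⟩
    simp only [Function.update_self, BitVec.toNat_ofNat, Expr.eval]
    exact Nat.mod_eq_of_lt he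
  | var x =>
    refine ⟨_, _, .op _ _ _ _ _, le_rfl, SameBelow.update _ _ le_rfl, ?_⟩
    simp [Op.eval, hS.v, Expr.eval]
  | bin o a b iha ihb =>
    obtain ⟨ha, hb, ho⟩ := he
    obtain ⟨S₁, t₁, e₁, c₁, f₁, v₁⟩ := iha ha d hS
    obtain ⟨S₂, t₂, e₂, c₂, f₂, v₂⟩ := ihb hb (d + 1) (f₁.rep hS)
    refine ⟨_, _, .seq e₁ (.seq e₂ (.op _ _ _ _ _)), by simp only [Expr.size]; omega,
      (f₁.trans f₂ (by omega)).trans (SameBelow.update _ _ le_rfl) le_rfl, ?_⟩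
    rw [← v₁, ← v₂, ← f₂.tmp (Nat.lt_succ_self d)] at ho
    simp only [Function.update_self, Expr.eval]
    rw [BinOp.op_eval K.one_lt o _ _ ho, v₂, f₂.tmp (Nat.lt_succ_self d), v₁]
  | get A a b c i iha ihb ihc ihi =>
    obtain ⟨hP, ⟨ha, la⟩, ⟨hb, lb⟩, ⟨hc, lc⟩, hi, li⟩ := he
    obtain ⟨S₁, t₁, e₁, c₁, f₁, v₁⟩ := iha ha d hS
    have r₁ := f₁.rep hS
    obtain ⟨S₂, t₂, e₂, c₂, f₂, v₂⟩ := ihb hb (d + 1) r₁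
    have r₂ := f₂.rep r₁
    obtain ⟨S₃, t₃, e₃, c₃, f₃, v₃⟩ := ihc hc (d + 2) r₂
    have r₃ := f₃.rep r₂
    obtain ⟨S₄, t₄, e₄, c₄, f₄, v₄⟩ := ihi hi (d + 3) r₃
    have r₄ := f₄.rep r₃
    obtain ⟨S₅, e₅, f₅, v₅⟩ := addrCode_spec K A (d := d) ((r₄.v _).trans hP)
      (by rw [f₄.tmp (by omega), f₃.tmp (by omega), f₂.tmp (by omega), v₁])
      (by rw [f₄.tmp (by omega), f₃.tmp (by omega), v₂])
      (by rw [f₄.tmp (by omega), v₃]) v₄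
    refine ⟨_, _, .seq e₁ (.seq e₂ (.seq e₃ (.seq e₄ (.seq e₅ (.load _ _ _))))),
      by simp only [Expr.size]; omega,
      ((((f₁.trans f₂ (by omega)).trans f₃ (by omega)).trans f₄ (by omega)).trans f₅
        (by omega)).trans (SameBelow.update _ _ le_rfl) le_rfl, ?_⟩
    simp only [Function.update_self, Expr.eval]
    rw [v₅, f₅.1]
    exact r₄.m _ _ _ _ _ la lb lc li
  | inp a iha =>
    obtain ⟨S₁, t₁, e₁, c₁, f₁, v₁⟩ := iha he.1 d hS
    refine ⟨_, _, .seq e₁ (.load _ _ _), by simp only [Expr.size]; omega,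
      f₁.trans (SameBelow.update _ _ le_rfl) le_rfl, ?_⟩
    simp only [Function.update_self, Expr.eval]
    have := (f₁.rep hS).m .io 0 0 0 (a.eval K.w σ) (by positivity) (by positivity)
      (by positivity) he.2
    rw [adr_io, ← v₁, BitVec.ofNat_toNat, BitVec.setWidth_eq] at this
    rw [this, v₁]

theorem Rep.set {K : Cfg} {σ : St} {S : State K.w} (hS : Rep K σ S) (x : Var) (z : BitVec K.w) :
    Rep K (σ.set x z.toNat) ⟨Function.update S.reg (3 * x.idx) z, S.mem⟩ := by
  refine ⟨fun y => ?_, hS.m⟩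
  by_cases h : y = x
  · subst h; simp [St.set]
  · have : 3 * y.idx ≠ 3 * x.idx := fun e => h (Var.idx_injective (by omega))
    simp only [St.set, Function.update_of_ne h, Function.update_of_ne this]
    exact hS.v y

theorem Rep.put {K : Cfg} {σ : St} {S : State K.w} (hS : Rep K σ S) (A : Arr) {a b c d : ℕ}
    (ha : a < 2 ^ K.l) (hb : b < 2 ^ K.l) (hc : c < 2 ^ K.l) (hd : d < 2 ^ K.l)
    (z : BitVec K.w) : Rep K (σ.put A a b c d z.toNat)
      ⟨S.reg, Function.update S.mem (BitVec.ofNat K.w (adr K A a b c d)) z⟩ := by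
  refine ⟨hS.v, fun A' a' b' c' d' ha' hb' hc' hd' => ?_⟩
  by_cases h : A' = A ∧ a' = a ∧ b' = b ∧ c' = c ∧ d' = d
  · obtain ⟨rfl, rfl, rfl, rfl, rfl⟩ := h
    simp [St.put]
  · simp only [St.put, if_neg h]
    rw [Function.update_of_ne, hS.m _ _ _ _ _ ha' hb' hc' hd']
    intro e
    have e := congrArg BitVec.toNat e
    rw [BitVec.toNat_ofNat, BitVec.toNat_ofNat,
      Nat.mod_eq_of_lt (adr_lt K A' ha' hb' hc' hd'),
      Nat.mod_eq_of_lt (adr_lt K A ha hb hc hd)] at e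
    exact h (adr_inj K ha' hb' hc' hd' ha hb hc hd e)

theorem clearCode_spec {w : ℕ} (k : ℕ) (S : State w) :
    ∃ S' t, Exec (clearCode k) S S' t ∧ t ≤ k + 1 ∧ S'.mem = S.mem ∧
      (∀ i < k, S'.reg (3 * i + 2) = 0) ∧ ∀ r, r % 3 ≠ 2 → S'.reg r = S.reg r := by
  induction k with
  | zero => exact ⟨S, 1, .skip _, le_rfl, rfl, by simp, fun _ _ => rfl⟩
  | succ k ih =>
    obtain ⟨S', t, e, c, hm, hr, hq⟩ := ih
    refine ⟨_, _, .seq e (.const _ _ _), by omega, hm, fun i hi => ?_, fun r h => ?_⟩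
    · by_cases h : i = k
      · subst h; simp
      · have : 3 * i + 2 ≠ 3 * k + 2 := by omega
        simp only [Function.update_of_ne this]
        exact hr i (by omega)
    · have : r ≠ 3 * k + 2 := by omega
      simp only [Function.update_of_ne this]
      exact hq r h

/-- The intermediate results below `tmp d` are kept. -/
def Keeps {w : ℕ} (d : ℕ) (S S' : State w) : Prop := ∀ i < d, S'.reg (tmp i) = S.reg (tmp i)

theorem SameBelow.keeps {w : ℕ} {d : ℕ} {S S' : State w} (h : SameBelow d S S') : Keeps d S S' :=
  fun _ hi => h.tmp hi

theorem Keeps.trans {w : ℕ} {d d' : ℕ} {S S' S'' : State w} (h : Keeps d S S')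
    (h' : Keeps d' S' S'') (hd : d ≤ d') : Keeps d S S'' :=
  fun i hi => (h' i (lt_of_lt_of_le hi hd)).trans (h i hi)

theorem tmp_ne_var (i x : ℕ) : tmp i ≠ 3 * x := by simp only [tmp]; omega

/-- The computation of an address from expressions for the indices. -/
theorem address_spec (K : Cfg) {σ : St} {A : Arr} {a b c i : Expr}
    (h : (Expr.get A a b c i).Safe K σ) (d : ℕ) {S : State K.w} (hS : Rep K σ S) :
    ∃ S₁ S₂ S₃ S₄ S₅ t₁ t₂ t₃ t₄, Exec (a.code d) S S₁ t₁ ∧ Exec (b.code (d + 1)) S₁ S₂ t₂ ∧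
      Exec (c.code (d + 2)) S₂ S₃ t₃ ∧ Exec (i.code (d + 3)) S₃ S₄ t₄ ∧
      Exec (addrCode A d) S₄ S₅ 9 ∧ t₁ ≤ a.size ∧ t₂ ≤ b.size ∧ t₃ ≤ c.size ∧ t₄ ≤ i.size ∧
      SameBelow d S S₅ ∧ S₅.reg (tmp (d + 4)) = BitVec.ofNat K.w
        (adr K A (a.eval K.w σ) (b.eval K.w σ) (c.eval K.w σ) (i.eval K.w σ)) := by
  obtain ⟨hP, ⟨ha, _⟩, ⟨hb, _⟩, ⟨hc, _⟩, hi, _⟩ := h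
  obtain ⟨S₁, t₁, e₁, c₁, f₁, v₁⟩ := a.code_spec K ha d hS
  have r₁ := f₁.rep hS
  obtain ⟨S₂, t₂, e₂, c₂, f₂, v₂⟩ := b.code_spec K hb (d + 1) r₁
  have r₂ := f₂.rep r₁
  obtain ⟨S₃, t₃, e₃, c₃, f₃, v₃⟩ := c.code_spec K hc (d + 2) r₂
  have r₃ := f₃.rep r₂
  obtain ⟨S₄, t₄, e₄, c₄, f₄, v₄⟩ := i.code_spec K hi (d + 3) r₃
  have r₄ := f₄.rep r₃
  obtain ⟨S₅, e₅, f₅, v₅⟩ := addrCode_spec K A (d := d) ((r₄.v _).trans hP)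
    (by rw [f₄.tmp (by omega), f₃.tmp (by omega), f₂.tmp (by omega), v₁])
    (by rw [f₄.tmp (by omega), f₃.tmp (by omega), v₂])
    (by rw [f₄.tmp (by omega), v₃]) v₄
  exact ⟨S₁, S₂, S₃, S₄, S₅, t₁, t₂, t₃, t₄, e₁, e₂, e₃, e₄, e₅, c₁, c₂, c₃, c₄,
    (((f₁.trans f₂ (by omega)).trans f₃ (by omega)).trans f₄ (by omega)).trans f₅ (by omega), v₅⟩

theorem toNat_ne_zero_iff {w : ℕ} {a : BitVec w} : a ≠ 0 ↔ a.toNat ≠ 0 := by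
  rw [Ne, ← BitVec.toNat_inj]
  simp

/-- The code of a statement does what the statement says, with a constant number of machine
instructions for each elementary statement. -/
theorem Stmt.code_spec (K : Cfg) {c : Stmt} {σ σ' : St} {t : ℕ} (h : Big K c σ σ' t) (d : ℕ)
    {S : State K.w} (hS : Rep K σ S) :
    ∃ S' t', Exec (c.code K.prog d) S S' t' ∧ t' ≤ c.size K.prog * t ∧ Keeps d S S' ∧
      Rep K σ' S' := by
  induction h generalizing d S with
  | skip σ => exact ⟨S, 1, .skip _, by simp [Stmt.size], fun _ _ => rfl, hS⟩
  | @assign x e σ he =>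
    obtain ⟨S₁, t₁, e₁, c₁, f₁, v₁⟩ := e.code_spec K he d hS
    refine ⟨_, _, .seq e₁ (.op _ _ _ _ _), by simp only [Stmt.size]; omega,
      fun i hi => ?_, ?_⟩
    · simp only [Function.update_of_ne (tmp_ne_var _ _)]
      exact f₁.tmp hi
    · rw [← v₁]
      convert (f₁.rep hS).set x _ using 3
      simp [Op.eval]
  | @put A a b c i e σ ha he =>
    obtain ⟨S₁, S₂, S₃, S₄, S₅, t₁, t₂, t₃, t₄, e₁, e₂, e₃, e₄, e₅, c₁, c₂, c₃, c₄, f, v⟩ :=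
      address_spec K ha d hS
    obtain ⟨S₆, t₆, e₆, c₆, f₆, v₆⟩ := e.code_spec K he (d + 5) (f.rep hS)
    have f' := f.trans f₆ (by omega)
    refine ⟨_, _, .seq e₁ (.seq e₂ (.seq e₃ (.seq e₄ (.seq e₅ (.seq e₆ (.store _ _ _)))))),
      by simp only [Stmt.size]; omega, fun i hi => f'.tmp hi, ?_⟩
    rw [← v₆, f₆.tmp (show d + 4 < d + 5 by omega), v]
    obtain ⟨_, ⟨_, la⟩, ⟨_, lb⟩, ⟨_, lc⟩, _, li⟩ := ha
    exact (f'.rep hS).put A la lb lc li _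
  | @out a e σ ha la he =>
    obtain ⟨S₁, t₁, e₁, c₁, f₁, v₁⟩ := a.code_spec K ha d hS
    obtain ⟨S₂, t₂, e₂, c₂, f₂, v₂⟩ := e.code_spec K he (d + 1) (f₁.rep hS)
    have f := f₁.trans f₂ (by omega)
    refine ⟨_, _, .seq e₁ (.seq e₂ (.store _ _ _)), by simp only [Stmt.size]; omega,
      fun i hi => f.tmp hi, ?_⟩
    have := (f.rep hS).put .io (a := 0) (b := 0) (c := 0) (by positivity) (by positivity)
      (by positivity) la (S₂.reg (tmp (d + 1)))
    rwa [adr_io, v₂, ← v₁, BitVec.ofNat_toNat, BitVec.setWidth_eq,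
      ← f₂.tmp (Nat.lt_succ_self d), f₂.tmp (Nat.lt_succ_self d), v₁,
      ← f₂.tmp (Nat.lt_succ_self d)] at this
  | seq _ _ ih₁ ih₂ =>
    obtain ⟨S₁, t₁, e₁, c₁, k₁, r₁⟩ := ih₁ d hS
    obtain ⟨S₂, t₂, e₂, c₂, k₂, r₂⟩ := ih₂ d r₁
    refine ⟨S₂, _, .seq e₁ e₂, ?_, k₁.trans k₂ le_rfl, r₂⟩
    simp only [Stmt.size]
    nlinarith
  | @ite_true e p q σ σ' t he hne _ ih =>
    obtain ⟨S₁, t₁, e₁, c₁, f₁, v₁⟩ := e.code_spec K he d hS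
    obtain ⟨S₂, t₂, e₂, c₂, k₂, r₂⟩ := ih d (f₁.rep hS)
    refine ⟨S₂, _, .seq e₁ (.ite_true ?_ e₂), ?_, f₁.keeps.trans k₂ le_rfl, r₂⟩
    · rwa [toNat_ne_zero_iff, v₁]
    · simp only [Stmt.size]
      nlinarith
  | @ite_false e p q σ σ' t he heq _ ih =>
    obtain ⟨S₁, t₁, e₁, c₁, f₁, v₁⟩ := e.code_spec K he d hS
    obtain ⟨S₂, t₂, e₂, c₂, k₂, r₂⟩ := ih d (f₁.rep hS)
    refine ⟨S₂, _, .seq e₁ (.ite_false ?_ e₂), ?_, f₁.keeps.trans k₂ le_rfl, r₂⟩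
    · by_contra h
      rw [← Ne, toNat_ne_zero_iff, v₁] at h
      exact h heq
    · simp only [Stmt.size]
      nlinarith
  | @iterate x e p σ τ he _ ih =>
    obtain ⟨S₁, t₁, e₁, c₁, f₁, v₁⟩ := e.code_spec K he d hS
    set N := e.eval K.w (σ 0)
    have hN : N < 2 ^ K.w := v₁ ▸ (S₁.reg (tmp d)).isLt
    -- the iterations from the `k`-th on
    have loop : ∀ k ≤ N, ∀ S : State K.w, Rep K (σ (N - k)) S → (S.reg (tmp d)).toNat = N →
        (S.reg (tmp (d + 1))).toNat = N - k →
        (S.reg (tmp (d + 2))).toNat = (if N - k < N then 1 else 0) →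
        ∃ S' t', Exec (.loop (tmp (d + 2)) (.seq (.op .or (3 * x.idx) (tmp (d + 1)) (tmp (d + 1)))
          (.seq (.const (tmp (d + 2)) 1) (.seq (.op .add (tmp (d + 1)) (tmp (d + 1)) (tmp (d + 2)))
          (.seq (p.code K.prog (d + 2)) (.op .lt (tmp (d + 2)) (tmp (d + 1)) (tmp d)))))))
          S S' t' ∧ t' ≤ ∑ i ∈ Finset.Ico (N - k) N, (p.size K.prog * τ i + 5) + 1 ∧
          Keeps d S S' ∧ Rep K (σ N) S' := by
      intro k
      induction k with
      | zero =>
        intro _ S hr _ _ h2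
        refine ⟨S, 1, .loop_false ?_, by simp, fun _ _ => rfl, by simpa using hr⟩
        by_contra h
        rw [← Ne, toNat_ne_zero_iff, h2] at h
        simp at h
      | succ k ihk =>
        intro hk S hr h0 h1 h2
        have hlt : N - (k + 1) < N := by omega
        have n1 := tmp_ne (show d ≠ d + 1 by omega)
        have n2 := tmp_ne (show d ≠ d + 2 by omega)
        have n3 := tmp_ne (show d + 1 ≠ d + 2 by omega)
        have ra : Rep K ((σ (N - (k + 1))).set x (N - (k + 1)))
            ⟨Function.update S.reg (3 * x.idx) (S.reg (tmp (d + 1))), S.mem⟩ := by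
          have := hr.set x (S.reg (tmp (d + 1)))
          rwa [h1] at this
        have fb : SameBelow (d + 1)
            ⟨Function.update S.reg (3 * x.idx) (S.reg (tmp (d + 1))), S.mem⟩
            ⟨Function.update (Function.update (Function.update S.reg (3 * x.idx)
              (S.reg (tmp (d + 1)))) (tmp (d + 2)) (BitVec.ofNat K.w 1)) (tmp (d + 1))
              (S.reg (tmp (d + 1)) + BitVec.ofNat K.w 1), S.mem⟩ :=
          (SameBelow.update ⟨_, S.mem⟩ _ (by omega)).trans
            (SameBelow.update ⟨_, S.mem⟩ _ (by omega)) le_rfl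
        obtain ⟨S₂, t₂, e₂, c₂, k₂, r₂⟩ := ih (N - (k + 1)) hlt (d + 2) (fb.rep ra)
        rw [show N - (k + 1) + 1 = N - k by omega] at r₂
        have v0 : (S₂.reg (tmp d)).toNat = N := by
          rw [k₂ d (by omega)]
          simp [Function.update_of_ne n1, Function.update_of_ne n2,
            Function.update_of_ne (tmp_ne_var _ _), h0]
        have v1 : (S₂.reg (tmp (d + 1))).toNat = N - k := by
          rw [k₂ (d + 1) (by omega)]
          simp only [Function.update_self, BitVec.toNat_add, h1, BitVec.toNat_ofNat,
            Nat.mod_eq_of_lt K.one_lt]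
          rw [Nat.mod_eq_of_lt (by omega)]
          omega
        set S₃ : State K.w := ⟨Function.update S₂.reg (tmp (d + 2))
          (Op.lt.eval (S₂.reg (tmp (d + 1))) (S₂.reg (tmp d))), S₂.mem⟩ with hS₃
        have f₃ : SameBelow (d + 2) S₂ S₃ := SameBelow.update _ _ le_rfl
        obtain ⟨S₄, t₄, e₄, c₄, k₄, r₄⟩ := ihk (by omega) S₃ (f₃.rep r₂)
          (by rw [f₃.tmp (by omega), v0]) (by rw [f₃.tmp (by omega), v1])
          (by
            have := BinOp.op_eval K.one_lt .lt (S₂.reg (tmp (d + 1))) (S₂.reg (tmp d)) trivial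
            simp only [hS₃, Function.update_self]
            rw [v0, v1] at this
            exact this)
        have e₂' : Exec (p.code K.prog (d + 2)) ⟨Function.update (Function.update (Function.update
            S.reg (3 * x.idx) (Op.or.eval (S.reg (tmp (d + 1))) (S.reg (tmp (d + 1)))))
            (tmp (d + 2)) (BitVec.ofNat K.w 1)) (tmp (d + 1)) (Op.add.eval
            (Function.update (Function.update S.reg (3 * x.idx)
              (Op.or.eval (S.reg (tmp (d + 1))) (S.reg (tmp (d + 1))))) (tmp (d + 2))
              (BitVec.ofNat K.w 1) (tmp (d + 1)))
            (Function.update (Function.update S.reg (3 * x.idx)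
              (Op.or.eval (S.reg (tmp (d + 1))) (S.reg (tmp (d + 1))))) (tmp (d + 2))
              (BitVec.ofNat K.w 1) (tmp (d + 2)))), S.mem⟩ S₂ t₂ := by
          simpa [Op.eval, Function.update_of_ne n3, Function.update_of_ne n3.symm,
            Function.update_of_ne (tmp_ne_var _ _)] using e₂
        refine ⟨S₄, _, .loop_true ?_ (.seq (.op _ _ _ _ _) (.seq (.const _ _ _)
          (.seq (.op _ _ _ _ _) (.seq e₂' (.op _ _ _ _ _))))) e₄, ?_, ?_, r₄⟩
        · rw [toNat_ne_zero_iff, h2, if_pos hlt]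
          exact one_ne_zero
        · rw [Finset.sum_eq_sum_Ico_succ_bot hlt, show N - (k + 1) + 1 = N - k by omega]
          omega
        · intro i hi
          rw [k₄ i hi, f₃.tmp (by omega), k₂ i (by omega)]
          simp [Function.update_of_ne (tmp_ne (show i ≠ d + 1 by omega)),
            Function.update_of_ne (tmp_ne (show i ≠ d + 2 by omega)),
            Function.update_of_ne (tmp_ne_var _ _)]
    have n1 := tmp_ne (show d ≠ d + 1 by omega)
    have n2 := tmp_ne (show d ≠ d + 2 by omega)
    have n3 := tmp_ne (show d + 1 ≠ d + 2 by omega)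
    have f₂ : SameBelow (d + 1) S₁ ⟨Function.update (Function.update S₁.reg (tmp (d + 1))
        (BitVec.ofNat K.w 0)) (tmp (d + 2)) (Op.lt.eval
          (Function.update S₁.reg (tmp (d + 1)) (BitVec.ofNat K.w 0) (tmp (d + 1)))
          (Function.update S₁.reg (tmp (d + 1)) (BitVec.ofNat K.w 0) (tmp d))), S₁.mem⟩ :=
      (SameBelow.update S₁ _ le_rfl).trans (SameBelow.update ⟨_, S₁.mem⟩ _ (by omega)) le_rfl
    obtain ⟨S₂, t₂, e₂, c₂, k₂, r₂⟩ := loop N le_rfl _ (f₂.rep (f₁.rep (by simpa using hS)))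
      (by simp [Function.update_of_ne n1, Function.update_of_ne n2, v₁])
      (by simp [Function.update_of_ne n3])
      (by
        have := BinOp.op_eval K.one_lt .lt (BitVec.ofNat K.w 0) (S₁.reg (tmp d)) trivial
        rw [v₁] at this
        simpa [Function.update_of_ne n1, BinOp.op, BinOp.eval] using this)
    refine ⟨S₂, _, .seq e₁ (.seq (.const _ _ _) (.seq (.op _ _ _ _ _) e₂)), ?_,
      (f₁.trans f₂ (by omega)).keeps.trans k₂ le_rfl, r₂⟩
    rw [Nat.sub_self, Nat.Ico_zero_eq_range, Finset.sum_add_distrib, ← Finset.mul_sum,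
      Finset.sum_const, Finset.card_range, smul_eq_mul] at c₂
    rw [Finset.sum_add_distrib, Finset.sum_const, Finset.card_range, smul_eq_mul, mul_one]
    simp only [Stmt.size]
    nlinarith [Nat.zero_le (∑ i ∈ Finset.range N, τ i)]
  | @call A a b c σ s s' t ha hm hs hmem he =>
    obtain ⟨S₁, S₂, S₃, S₄, S₅, t₁, t₂, t₃, t₄, e₁, e₂, e₃, e₄, e₅, c₁, c₂, c₃, c₄, f, v⟩ :=
      address_spec K ha d hS
    obtain ⟨_, ⟨_, la⟩, ⟨_, lb⟩, ⟨_, lc⟩, _, _⟩ := ha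
    simp only [Expr.eval] at v
    have r₅ := f.rep hS
    obtain ⟨S₆, t₆, e₆, c₆, m₆, z₆, k₆⟩ := clearCode_spec K.prog.regBound S₅
    set base := adr K A (a.eval K.w σ) (b.eval K.w σ) (c.eval K.w σ) 0 with hbase
    have hadr : ∀ x, adr K A (a.eval K.w σ) (b.eval K.w σ) (c.eval K.w σ) x = base + x := by
      intro x; simp [hbase, adr]
    have hP := K.sixteen_le
    have hw₀ : 2 ^ K.w₀ ≤ 2 ^ K.l := Nat.pow_le_pow_right (by norm_num) K.w₀_le
    have hbound : base + 2 ^ K.w₀ ≤ 2 ^ K.w := by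
      have := adr_lt K A la lb lc (show 2 ^ K.l - 1 < 2 ^ K.l by omega)
      rw [hadr] at this
      omega
    have hlt := Nat.one_le_two_pow (n := K.w₀)
    have emb : Embeds (tmp (d + 4)) (3 * Var.mask.idx) (fun r => 3 * r + 2) K.prog.regBound base
        s S₆ := by
      refine ⟨fun r hr => ?_, fun x => ?_, ?_, ?_⟩
      · rw [z₆ r hr, hs]; rfl
      · rw [m₆, hmem, ← hadr]
        exact r₅.m _ _ _ _ _ la lb lc (lt_of_lt_of_le x.isLt hw₀)
      · rw [k₆ _ (by simp only [tmp]; omega), v, BitVec.toNat_ofNat, Nat.mod_eq_of_lt (by omega)]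
      · rw [k₆ _ (by omega), r₅.v, hm]
    obtain ⟨S₇, t₇, e₇, emb₇, c₇, f₇, m₇⟩ := he.embed (tmp := tmp (d + 5))
      (le_trans K.w₀_le (le_trans (by omega) K.l_le)) hbound
      (fun _ _ h => by simpa using h) (fun r => by simp only [tmp]; omega)
      (fun r => by omega) (fun r => by simp only [tmp]; omega) (tmp_ne (by omega))
      (tmp_ne_var _ _) le_rfl emb
    have hv : ∀ i, 3 * i ≠ tmp (d + 5) := fun i => (tmp_ne_var _ _).symm
    refine ⟨S₇, _, .seq e₁ (.seq e₂ (.seq e₃ (.seq e₄ (.seq e₅ (.seq e₆ e₇))))), ?_, ?_, ?_, ?_⟩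
    · simp only [Stmt.size]
      simp only [Expr.size] at c₄
      nlinarith
    · intro i hi
      rw [f₇ _ (fun q => by simp only [tmp]; omega) (tmp_ne (by omega)),
        k₆ _ (by simp only [tmp]; omega), f.tmp hi]
    · intro x
      rw [f₇ _ (fun q => by omega) (hv _), k₆ _ (by omega), r₅.v]
    · intro A' a' b' c' d' la' lb' lc' ld'
      have hlt' := adr_lt K A' la' lb' lc' ld'
      by_cases hd : A' = A ∧ a' = a.eval K.w σ ∧ b' = b.eval K.w σ ∧ c' = c.eval K.w σ ∧
          d' < 2 ^ K.w₀
      · obtain ⟨rfl, rfl, rfl, rfl, hd⟩ := hd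
        have := emb₇.mem (BitVec.ofNat K.w₀ d')
        rw [BitVec.toNat_ofNat, Nat.mod_eq_of_lt hd, ← hadr] at this
        simp [hd, this]
      · simp only [if_neg hd]
        rw [m₇, m₆]
        · exact r₅.m _ _ _ _ _ la' lb' lc' ld'
        · rw [BitVec.toNat_ofNat, Nat.mod_eq_of_lt hlt']
          by_contra! h
          have e : adr K A' a' b' c' d' = adr K A (a.eval K.w σ) (b.eval K.w σ) (c.eval K.w σ)
              (adr K A' a' b' c' d' - base) := by
            rw [hadr]; omega
          obtain ⟨rfl, rfl, rfl, rfl, h'⟩ := adr_inj K la' lb' lc' ld' la lb lc (by omega) e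
          exact hd ⟨rfl, rfl, rfl, rfl, by omega⟩

end WordRAM

namespace WordRAM

/-! ### Reasoning about statements -/

@[simp] theorem St.set_v (σ : St) (x y : Var) (z : ℕ) :
    (σ.set x z).v y = if y = x then z else σ.v y := by
  simp [St.set, Function.update_apply]

@[simp] theorem St.set_m (σ : St) (x : Var) (z : ℕ) : (σ.set x z).m = σ.m := rfl

@[simp] theorem St.put_v (σ : St) (A : Arr) (a b c d z : ℕ) : (σ.put A a b c d z).v = σ.v := rfl

theorem St.put_m (σ : St) (A A' : Arr) (a b c d z a' b' c' d' : ℕ) :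
    (σ.put A a b c d z).m A' a' b' c' d' =
      if A' = A ∧ a' = a ∧ b' = b ∧ c' = c ∧ d' = d then z else σ.m A' a' b' c' d' := rfl

@[simp] theorem St.put_m_self (σ : St) (A : Arr) (a b c d z a' b' c' d' : ℕ) :
    (σ.put A a b c d z).m A a' b' c' d' =
      if a' = a ∧ b' = b ∧ c' = c ∧ d' = d then z else σ.m A a' b' c' d' := by
  simp [St.put_m]

@[simp] theorem St.put_m_ne (σ : St) {A A' : Arr} (a b c d z : ℕ) (h : A' ≠ A) :
    (σ.put A a b c d z).m A' = σ.m A' := by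
  funext a' b' c' d'
  simp [St.put_m, h]

/-- Whether a statement can write to a variable. -/
def Stmt.writesVar : Stmt → Var → Bool
  | .assign x _, y => x = y
  | .seq p q, y => p.writesVar y || q.writesVar y
  | .ite _ p q, y => p.writesVar y || q.writesVar y
  | .for x _ p, y => x = y || p.writesVar y
  | _, _ => false

/-- Whether a statement can write to an array. -/
def Stmt.writesArr : Stmt → Arr → Bool
  | .put A _ _ _ _ _, B => A = B
  | .out _ _, B => Arr.io = B
  | .seq p q, B => p.writesArr B || q.writesArr B
  | .ite _ p q, B => p.writesArr B || q.writesArr B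
  | .for _ _ p, B => p.writesArr B
  | .call A _ _ _, B => A = B
  | _, _ => false

/-- The states `σ` and `σ'` agree on all that the statement `c` cannot write to. -/
structure Frame (c : Stmt) (σ σ' : St) : Prop where
  v : ∀ x, c.writesVar x = false → σ'.v x = σ.v x
  m : ∀ A, c.writesArr A = false → σ'.m A = σ.m A

theorem Frame.refl (c : Stmt) (σ : St) : Frame c σ σ := ⟨fun _ _ => rfl, fun _ _ => rfl⟩

theorem Frame.trans {c : Stmt} {σ σ' σ'' : St} (h : Frame c σ σ') (h' : Frame c σ' σ'') :
    Frame c σ σ'' :=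
  ⟨fun x hx => (h'.v x hx).trans (h.v x hx), fun A hA => (h'.m A hA).trans (h.m A hA)⟩

/-- A statement changes at most what it can write to, which spares explicit invariants for all else. -/
theorem Big.frame {K : Cfg} {c : Stmt} {σ σ' : St} {t : ℕ} (h : Big K c σ σ' t) :
    Frame c σ σ' := by
  induction h with
  | skip σ => exact .refl _ _
  | assign =>
    refine ⟨fun y hy => ?_, fun _ _ => rfl⟩
    simp only [Stmt.writesVar, decide_eq_false_iff_not] at hy
    simp [Ne.symm hy]
  | put =>
    refine ⟨fun _ _ => rfl, fun B hB => ?_⟩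
    simp only [Stmt.writesArr, decide_eq_false_iff_not] at hB
    simp [Ne.symm hB]
  | out =>
    refine ⟨fun _ _ => rfl, fun B hB => ?_⟩
    simp only [Stmt.writesArr, decide_eq_false_iff_not] at hB
    simp [Ne.symm hB]
  | seq _ _ ih₁ ih₂ =>
    refine ⟨fun y hy => ?_, fun B hB => ?_⟩
    · simp only [Stmt.writesVar, Bool.or_eq_false_iff] at hy
      rw [ih₂.v y hy.2, ih₁.v y hy.1]
    · simp only [Stmt.writesArr, Bool.or_eq_false_iff] at hB
      rw [ih₂.m B hB.2, ih₁.m B hB.1]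
  | ite_true _ _ _ ih =>
    refine ⟨fun y hy => ?_, fun B hB => ?_⟩
    · simp only [Stmt.writesVar, Bool.or_eq_false_iff] at hy
      exact ih.v y hy.1
    · simp only [Stmt.writesArr, Bool.or_eq_false_iff] at hB
      exact ih.m B hB.1
  | ite_false _ _ _ ih =>
    refine ⟨fun y hy => ?_, fun B hB => ?_⟩
    · simp only [Stmt.writesVar, Bool.or_eq_false_iff] at hy
      exact ih.v y hy.2
    · simp only [Stmt.writesArr, Bool.or_eq_false_iff] at hB
      exact ih.m B hB.2
  | @iterate x e p σ τ _ _ ih =>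
    have : ∀ k ≤ e.eval K.w (σ 0), Frame (.for x e p) (σ 0) (σ k) := by
      intro k
      induction k with
      | zero => exact fun _ => .refl _ _
      | succ k ihk =>
        intro hk
        refine (ihk (by omega)).trans ⟨fun y hy => ?_, fun B hB => ?_⟩
        · simp only [Stmt.writesVar, Bool.or_eq_false_iff, decide_eq_false_iff_not] at hy
          rw [(ih k (by omega)).v y hy.2]
          simp [Ne.symm hy.1]
        · exact (ih k (by omega)).m B hB
    exact this _ le_rfl
  | call =>
    refine ⟨fun _ _ => rfl, fun B hB => ?_⟩
    simp only [Stmt.writesArr, decide_eq_false_iff_not] at hB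
    funext a b c d
    simp [Ne.symm hB]

/-- From the state `σ` the statement `c` runs safely to a state `σ'`, within a time `t`, that
satisfy `Q σ' t`. -/
def WP (K : Cfg) (c : Stmt) (Q : St → ℕ → Prop) (σ : St) : Prop :=
  ∃ σ' t, Big K c σ σ' t ∧ Q σ' t

variable {K : Cfg} {σ : St} {Q : St → ℕ → Prop}

theorem WP.mono {c : Stmt} {Q' : St → ℕ → Prop} (h : WP K c Q σ)
    (hQ : ∀ σ' t, Frame c σ σ' → Q σ' t → Q' σ' t) : WP K c Q' σ :=
  let ⟨σ', t, hb, hq⟩ := h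
  ⟨σ', t, hb, hQ σ' t hb.frame hq⟩

theorem wp_skip : WP K .skip Q σ ↔ Q σ 1 :=
  ⟨fun ⟨_, _, hb, hq⟩ => by cases hb; exact hq, fun h => ⟨_, _, .skip _, h⟩⟩

theorem wp_assign {x : Var} {e : Expr} :
    WP K (.assign x e) Q σ ↔ e.Safe K σ ∧ Q (σ.set x (e.eval K.w σ)) 1 :=
  ⟨fun ⟨_, _, hb, hq⟩ => by cases hb with | assign h => exact ⟨h, hq⟩,
    fun h => ⟨_, _, .assign h.1, h.2⟩⟩

theorem wp_put {A : Arr} {a b c d e : Expr} :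
    WP K (.put A a b c d e) Q σ ↔ (Expr.get A a b c d).Safe K σ ∧ e.Safe K σ ∧
      Q (σ.put A (a.eval K.w σ) (b.eval K.w σ) (c.eval K.w σ) (d.eval K.w σ) (e.eval K.w σ)) 1 :=
  ⟨fun ⟨_, _, hb, hq⟩ => by cases hb with | put h h' => exact ⟨h, h', hq⟩,
    fun h => ⟨_, _, .put h.1 h.2.1, h.2.2⟩⟩

theorem wp_out {a e : Expr} :
    WP K (.out a e) Q σ ↔ (a.Safe K σ ∧ a.eval K.w σ < 2 ^ K.l) ∧ e.Safe K σ ∧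
      Q (σ.put .io 0 0 0 (a.eval K.w σ) (e.eval K.w σ)) 1 :=
  ⟨fun ⟨_, _, hb, hq⟩ => by cases hb with | out h h' h'' => exact ⟨⟨h, h'⟩, h'', hq⟩,
    fun h => ⟨_, _, .out h.1.1 h.1.2 h.2.1, h.2.2⟩⟩

theorem wp_seq {p q : Stmt} : WP K (.seq p q) Q σ ↔
    WP K p (fun σ' t => WP K q (fun σ'' t' => Q σ'' (t + t')) σ') σ :=
  ⟨fun ⟨_, _, hb, hq⟩ => by cases hb with | seq h h' => exact ⟨_, _, h, _, _, h', hq⟩,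
    fun ⟨_, _, h, _, _, h', hq⟩ => ⟨_, _, .seq h h', hq⟩⟩

theorem wp_ite {e : Expr} {p q : Stmt} : WP K (.ite e p q) Q σ ↔ e.Safe K σ ∧
    (e.eval K.w σ ≠ 0 → WP K p (fun σ' t => Q σ' (t + 1)) σ) ∧
    (e.eval K.w σ = 0 → WP K q (fun σ' t => Q σ' (t + 1)) σ) := by
  constructor
  · rintro ⟨_, _, hb, hq⟩
    cases hb with
    | ite_true h h' h'' => exact ⟨h, fun _ => ⟨_, _, h'', hq⟩, fun h => absurd h h'⟩
    | ite_false h h' h'' => exact ⟨h, fun h => absurd h' h, fun _ => ⟨_, _, h'', hq⟩⟩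
  · rintro ⟨h, h₁, h₂⟩
    by_cases he : e.eval K.w σ = 0
    · obtain ⟨_, _, hb, hq⟩ := h₂ he
      exact ⟨_, _, .ite_false h he hb, hq⟩
    · obtain ⟨_, _, hb, hq⟩ := h₁ he
      exact ⟨_, _, .ite_true h he hb, hq⟩

/-- The rule for loops, with an invariant `I i σ t` for the state `σ` and the time `t` after `i`
iterations. -/
theorem WP.for {x : Var} {e : Expr} {p : Stmt} {k : ℕ} (I : ℕ → St → ℕ → Prop)
    (he : e.Safe K σ) (hk : e.eval K.w σ = k) (h₀ : I 0 σ 0)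
    (step : ∀ i < k, ∀ σ' t, Frame (.for x e p) σ σ' → I i σ' t →
      WP K p (fun σ'' t' => I (i + 1) σ'' (t + t' + 1)) (σ'.set x i))
    (hQ : ∀ σ' t, Frame (.for x e p) σ σ' → I k σ' t → Q σ' (t + 1)) :
    WP K (.for x e p) Q σ := by
  have key : ∀ j ≤ k, ∃ (f : ℕ → St) (τ : ℕ → ℕ), f 0 = σ ∧
      (∀ i < j, Big K p ((f i).set x i) (f (i + 1)) (τ i)) ∧ Frame (.for x e p) σ (f j) ∧
      I j (f j) (∑ i ∈ Finset.range j, (τ i + 1)) := by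
    intro j
    induction j with
    | zero => exact fun _ => ⟨fun _ => σ, fun _ => 0, rfl, by simp, .refl _ _, by simpa using h₀⟩
    | succ j ih =>
      intro hj
      obtain ⟨f, τ, f0, hf, fr, hI⟩ := ih (by omega)
      obtain ⟨σ', t, hb, hq⟩ := step j hj _ _ fr hI
      have hτ : ∑ i ∈ Finset.range j, (Function.update τ j t i + 1) =
          ∑ i ∈ Finset.range j, (τ i + 1) := by
        refine Finset.sum_congr rfl fun i hi => ?_
        rw [Function.update_of_ne (by have := Finset.mem_range.1 hi; omega)]
      refine ⟨Function.update f (j + 1) σ', Function.update τ j t, ?_, fun i hi => ?_, ?_, ?_⟩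
      · rw [Function.update_of_ne (by omega), f0]
      · rw [Function.update_of_ne (show i ≠ j + 1 by omega)]
        by_cases hij : i = j
        · subst hij; simpa using hb
        · rw [Function.update_of_ne (show i + 1 ≠ j + 1 by omega), Function.update_of_ne hij]
          exact hf i (by omega)
      · rw [Function.update_self]
        refine fr.trans ⟨fun y hy => ?_, fun B hB => hb.frame.m B hB⟩
        simp only [Stmt.writesVar, Bool.or_eq_false_iff, decide_eq_false_iff_not] at hy
        rw [hb.frame.v y hy.2]
        simp [Ne.symm hy.1]
      · rw [Function.update_self, Finset.sum_range_succ, hτ, Function.update_self, ← add_assoc]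
        exact hq
  obtain ⟨f, τ, f0, hf, fr, hI⟩ := key k le_rfl
  subst f0
  have hb := Big.iterate (x := x) (e := e) (p := p) (σ := f) (τ := τ) he (by rwa [hk])
  rw [hk] at hb
  refine ⟨_, _, hb, ?_⟩
  rw [add_comm]
  exact hQ _ _ fr hI

/-- The rule for loops whose iterations all take at most the time `T`. -/
theorem WP.for_le {x : Var} {e : Expr} {p : Stmt} {k : ℕ} (I : ℕ → St → Prop) (T : ℕ)
    (he : e.Safe K σ) (hk : e.eval K.w σ = k) (h₀ : I 0 σ)
    (step : ∀ i < k, ∀ σ', Frame (.for x e p) σ σ' → I i σ' →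
      WP K p (fun σ'' t' => I (i + 1) σ'' ∧ t' ≤ T) (σ'.set x i))
    (hQ : ∀ σ' t, Frame (.for x e p) σ σ' → I k σ' → t ≤ k * (T + 1) + 1 → Q σ' t) :
    WP K (.for x e p) Q σ := by
  refine WP.for (fun i σ' t => I i σ' ∧ t ≤ i * (T + 1)) he hk ⟨h₀, by simp⟩ ?_ ?_
  · rintro i hi σ' t hf ⟨hI, ht⟩
    refine (step i hi σ' hf hI).mono fun σ'' t' _ h => ⟨h.1, ?_⟩
    have := h.2
    rw [add_mul]
    omega
  · rintro σ' t hf ⟨hI, ht⟩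
    exact hQ _ _ hf hI (by omega)

infixr:30 " ;; " => Stmt.seq
infix:40 " ≔ " => Stmt.assign
infixl:65 " +ₑ " => Expr.bin BinOp.add
infixl:65 " -ₑ " => Expr.bin BinOp.sub
infixl:70 " *ₑ " => Expr.bin BinOp.mul
infixl:70 " /ₑ " => Expr.bin BinOp.div
infixl:70 " %ₑ " => Expr.bin BinOp.mod
infixl:72 " <<ₑ " => Expr.bin BinOp.shl
infixl:72 " >>ₑ " => Expr.bin BinOp.shr
infix:50 " <ₑ " => Expr.bin BinOp.lt
infix:50 " =ₑ " => Expr.bin BinOp.eq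

instance : Coe Var Expr := ⟨.var⟩

end WordRAM

namespace WordRAM

/-! ### Distances in layered graphs with large node weights -/

section Paths

variable {V : Type} {E : V → V → Prop} {wt : V → ℤ}

theorem _root_.PathOfWeight.nonneg (hw : ∀ v, 0 ≤ wt v) {u v : V} {z : ℤ}
    (h : PathOfWeight E wt u v z) : 0 ≤ z := by
  induction h with
  | nil => exact le_rfl
  | cons _ _ ih => exact add_nonneg (hw _) ih

theorem nodeDist_le {u v : V} {z : ℤ} (h : PathOfWeight E wt u v z) :
    nodeDist E wt u v ≤ ((z : WithTop ℤ) : WithBot (WithTop ℤ)) :=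
  iInf₂_le z h

/-- With nonnegative weights the distance is infinite or attained by a path. -/
theorem nodeDist_cases (hw : ∀ v, 0 ≤ wt v) (u v : V) :
    (nodeDist E wt u v = ⊤ ∧ ∀ z, ¬ PathOfWeight E wt u v z) ∨
      ∃ d : ℕ, nodeDist E wt u v = (((d : ℤ) : WithTop ℤ) : WithBot (WithTop ℤ)) ∧
        PathOfWeight E wt u v d ∧ ∀ z, PathOfWeight E wt u v z → (d : ℤ) ≤ z := by
  by_cases h : ∃ d : ℕ, PathOfWeight E wt u v d
  · right
    classical
    refine ⟨Nat.find h, ?_, Nat.find_spec h, ?_⟩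
    · refine le_antisymm (nodeDist_le (Nat.find_spec h)) (le_iInf₂ fun z hz => ?_)
      have h0 := hz.nonneg hw
      lift z to ℕ using h0
      exact_mod_cast Nat.find_min' h hz
    · intro z hz
      have h0 := hz.nonneg hw
      lift z to ℕ using h0
      exact_mod_cast Nat.find_min' h hz
  · left
    have h' : ∀ z, ¬ PathOfWeight E wt u v z := by
      intro z hz
      have h0 := hz.nonneg hw
      lift z to ℕ using h0
      exact h ⟨z, hz⟩
    exact ⟨by simp [nodeDist, h'], h'⟩

theorem _root_.PathOfWeight.eq_of_lt {lo : ℤ} (h0 : 0 ≤ lo) (hw : ∀ v, lo ≤ wt v) {u v : V} {z : ℤ}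
    (h : PathOfWeight E wt u v z) (hz : z < lo) : u = v ∧ z = 0 := by
  cases h with
  | nil => exact ⟨rfl, rfl⟩
  | @cons _ x _ z _ h =>
    have := h.nonneg fun v => h0.trans (hw v)
    have := hw x
    omega

/-- In a graph whose edges join consecutive layers, a path from layer `0` to layer `3` that is
lighter than four nodes has just three edges. -/
theorem _root_.PathOfWeight.three_edges {lo : ℤ} (h0 : 0 ≤ lo) (hw : ∀ v, lo ≤ wt v) (lay : V → ℕ)
    (hE : ∀ a b, E a b → lay a + 1 = lay b ∨ lay b + 1 = lay a) {u v : V} (hu : lay u = 0)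
    (hv : lay v = 3) {z : ℤ} (h : PathOfWeight E wt u v z) (hz : z < 4 * lo) :
    ∃ a b, lay a = 1 ∧ lay b = 2 ∧ E u a ∧ E a b ∧ E b v ∧ z = wt a + wt b + wt v := by
  cases h with
  | nil => omega
  | @cons _ a _ z₁ ha h =>
    have la := hE _ _ ha
    cases h with
    | nil => omega
    | @cons _ b _ z₂ hb h =>
      have lb := hE _ _ hb
      cases h with
      | nil => omega
      | @cons _ c _ z₃ hc h =>
        have lc := hE _ _ hc
        obtain ⟨rfl, rfl⟩ := h.eq_of_lt h0 hw (by have := hw a; have := hw b; have := hw c; omega)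
        exact ⟨a, b, by omega, by omega, ha, hb, hc, by ring⟩

end Paths

/-- The edges of the layered graph, from one layer to the next.  The node `i` is the node `i % Q` of
the layer `i / Q`.  The nodes of the two layers in the middle stand for pairs of an inner index and
a rank, and are joined if they have the same inner index. -/
def LayerEdge (D Q : ℕ) (inc inc' : ℕ → ℕ → Prop) (i j : ℕ) : Prop :=
  (i / Q = 0 ∧ j / Q = 1 ∧ inc (i % Q) (j % Q)) ∨
  (i / Q = 1 ∧ j / Q = 2 ∧ i % Q % D = j % Q % D) ∨
  (i / Q = 2 ∧ j / Q = 3 ∧ inc' (j % Q) (i % Q))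

theorem LayerEdge.layer {D Q : ℕ} {inc inc' : ℕ → ℕ → Prop} {i j : ℕ}
    (h : LayerEdge D Q inc inc' i j) : i / Q + 1 = j / Q := by
  rcases h with h | h | h <;> omega

/-- The layered graph on `N` nodes. -/
def layerGraph (N D Q : ℕ) (inc inc' : ℕ → ℕ → Prop) : SimpleGraph (Fin N) where
  Adj i j := LayerEdge D Q inc inc' i j ∨ LayerEdge D Q inc inc' j i
  symm := ⟨fun _ _ h => h.symm⟩
  loopless := ⟨fun i h => by rcases h with h | h <;> exact absurd h.layer (by omega)⟩

/-- The node weights of the layered graph: `M`, reduced by a value on the layers in the middle. -/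
def layerWeight (D Q M : ℕ) (val val' : ℕ → ℕ) (i : ℕ) : ℕ :=
  M - if i / Q = 1 then val (i % Q / D) else if i / Q = 2 then val' (i % Q / D) else 0

section LayerGraph

variable {D Q M W : ℕ} {inc inc' : ℕ → ℕ → Prop} {val val' : ℕ → ℕ}

theorem layer_div (hQ : 0 < Q) (k : ℕ) {a : ℕ} (ha : a < Q) : (k * Q + a) / Q = k := by
  rw [mul_comm, Nat.mul_add_div hQ, Nat.div_eq_of_lt ha, add_zero]

theorem layer_mod (k : ℕ) {a : ℕ} (ha : a < Q) : (k * Q + a) % Q = a := by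
  rw [mul_comm, Nat.mul_add_mod, Nat.mod_eq_of_lt ha]

/-- The paths of weight at most `3 M` from the first layer to the last.  As `4 W < M`, four nodes weigh
more than `3 M`, hence such a path goes straight through the layers. -/
theorem layerGraph_path_iff (hQ : 0 < Q) (hval : ∀ r, val r ≤ W) (hval' : ∀ r, val' r ≤ W)
    (hM : 4 * W < M) {u v : ℕ} (hu : u < Q) (hv : v < Q) {d : ℕ} (hd : d ≤ 3 * M)
    {i j : Fin (4 * Q)} (hi : (i : ℕ) = u) (hj : (j : ℕ) = 3 * Q + v) :
    PathOfWeight (layerGraph (4 * Q) D Q inc inc').Adj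
        (fun x => (layerWeight D Q M val val' x : ℤ)) i j d ↔
      ∃ a < Q, ∃ b < Q, inc u a ∧ a % D = b % D ∧ inc' v b ∧
        d + (val (a / D) + val' (b / D)) = 3 * M := by
  have hu0 : u / Q = 0 := Nat.div_eq_of_lt hu
  have hum : u % Q = u := Nat.mod_eq_of_lt hu
  have w1 : ∀ a < Q, layerWeight D Q M val val' (1 * Q + a) = M - val (a / D) := by
    intro a ha
    simp only [layerWeight, layer_div hQ _ ha, layer_mod _ ha, if_true]
  have w2 : ∀ a < Q, layerWeight D Q M val val' (2 * Q + a) = M - val' (a / D) := by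
    intro a ha
    simp only [layerWeight, layer_div hQ _ ha, layer_mod _ ha]
    simp
  have w3 : layerWeight D Q M val val' (3 * Q + v) = M := by
    simp only [layerWeight, layer_div hQ _ hv]
    simp
  constructor
  · intro h
    obtain ⟨a, b, la, lb, ea, eb, ec, hz⟩ := h.three_edges (lo := (M : ℤ) - W) (by omega)
      (fun x => by
        simp only [layerWeight]
        split_ifs
        · have := hval (x % Q / D); omega
        · have := hval' (x % Q / D); omega
        · omega)
      (fun x : Fin (4 * Q) => (x : ℕ) / Q)
      (fun a b h => by
        rcases h with h | h
        · exact Or.inl h.layer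
        · exact Or.inr h.layer)
      (by simp only [hi, hu0]) (by simp only [hj, layer_div hQ _ hv])
      (by omega)
    have ha : (a : ℕ) = 1 * Q + a % Q := by
      have := Nat.div_add_mod (a : ℕ) Q; rw [la] at this; omega
    have hb : (b : ℕ) = 2 * Q + b % Q := by
      have := Nat.div_add_mod (b : ℕ) Q; rw [lb] at this; omega
    have hma := Nat.mod_lt (a : ℕ) hQ
    have hmb := Nat.mod_lt (b : ℕ) hQ
    have lj : (j : ℕ) / Q = 3 := by rw [hj, layer_div hQ _ hv]
    refine ⟨a % Q, hma, b % Q, hmb, ?_, ?_, ?_, ?_⟩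
    · rcases ea with e | e
      · rcases e with e | e | e
        · rw [hi, hum] at e; exact e.2.2
        · rw [hi, hu0] at e; exact absurd e.1 (by norm_num)
        · rw [hi, hu0] at e; exact absurd e.1 (by norm_num)
      · have := e.layer; rw [hi, hu0] at this; omega
    · rcases eb with e | e
      · rcases e with e | e | e
        · have := e.1; omega
        · exact e.2.2
        · have := e.1; omega
      · have := e.layer; omega
    · rcases ec with e | e
      · rcases e with e | e | e
        · have := e.1; omega
        · have := e.1; omega
        · rw [hj, layer_mod _ hv] at e; exact e.2.2
      · have := e.layer; omega
    · rw [hj, w3, ha, hb, w1 _ hma, w2 _ hmb] at hz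
      have := hval (a % Q / D)
      have := hval' (b % Q / D)
      omega
  · rintro ⟨a, ha, b, hb, h1, h2, h3, hz⟩
    have hva := hval (a / D)
    have hvb := hval' (b / D)
    let a' : Fin (4 * Q) := ⟨1 * Q + a, by omega⟩
    let b' : Fin (4 * Q) := ⟨2 * Q + b, by omega⟩
    have ea : (layerGraph (4 * Q) D Q inc inc').Adj i a' := by
      refine Or.inl (Or.inl ⟨?_, ?_, ?_⟩)
      · rw [hi, hu0]
      · exact layer_div hQ _ ha
      · rw [hi, hum]; simp only [a', layer_mod _ ha]; exact h1
    have eb : (layerGraph (4 * Q) D Q inc inc').Adj a' b' := by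
      refine Or.inl (Or.inr (Or.inl ⟨layer_div hQ _ ha, layer_div hQ _ hb, ?_⟩))
      simp only [a', b', layer_mod _ ha, layer_mod _ hb]
      exact h2
    have ec : (layerGraph (4 * Q) D Q inc inc').Adj b' j := by
      refine Or.inl (Or.inr (Or.inr ⟨layer_div hQ _ hb, ?_, ?_⟩))
      · rw [hj, layer_div hQ _ hv]
      · simp only [b', hj, layer_mod _ hb, layer_mod _ hv]; exact h3
    have := PathOfWeight.cons (wt := fun x : Fin (4 * Q) => (layerWeight D Q M val val' x : ℤ)) ea
      (.cons eb (.cons ec (.nil _)))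
    convert this using 1
    simp only [a', b', hj, w1 _ ha, w2 _ hb, w3]
    omega

theorem layerWeight_le (i : ℕ) : layerWeight D Q M val val' i ≤ M := Nat.sub_le _ _

end LayerGraph

/-! ### Reading the words of the subroutine -/

theorem encode_natCast (w d : ℕ) : (encode w (((d : ℤ)) : WithTop ℤ)).toNat = d % 2 ^ w := by
  change (BitVec.ofInt w (d : ℤ)).toNat = _
  simp

theorem toNat_of_decode_eq_top {w : ℕ} {v : BitVec w} (h : decode v = ⊤) :
    v.toNat = (2 ^ w - 1) / 2 := by
  unfold decode at h
  split_ifs at h with h1 h2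
  · rw [h1, BitVec.toNat_intMax]
    cases w with
    | zero => rfl
    | succ w => rw [Nat.add_sub_cancel, pow_succ]; omega
  · cases h
  · cases h

theorem toNat_of_decode_eq_natCast {w d : ℕ} {v : BitVec w}
    (h : decode v = (((d : ℤ) : WithTop ℤ) : WithBot (WithTop ℤ))) :
    v.toNat = d ∧ v.toNat ≠ (2 ^ w - 1) / 2 := by
  unfold decode at h
  split_ifs at h with h1 h2
  · cases h
  · cases h
  · have e : v.toInt = d := by
      have h := WithBot.coe_injective h
      exact_mod_cast h
    have e' : v.toNat = d := by
      rw [BitVec.toInt_eq_toNat_cond] at e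
      have := v.isLt
      split_ifs at e
      · omega
      · push_cast at e
        have : (v.toNat : ℤ) < (2 ^ w : ℕ) := by exact_mod_cast this
        push_cast at this
        omega
    refine ⟨e', fun h => h1 (BitVec.eq_of_toNat_eq ?_)⟩
    rw [h, BitVec.toNat_intMax]
    cases w with
    | zero => rfl
    | succ w => rw [Nat.add_sub_cancel, pow_succ]; omega

end WordRAM

namespace WordRAM

/-! ### The program -/

namespace RowWeight

section Programs

open Var

/-- Increase `best s a b` to `z`. -/
def update (a b : Var) : Stmt :=
  .ite (.get .best s a b (.lit 0) <ₑ z) (.put .best s a b (.lit 0) z) .skip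

/-- Take account of the inner index `k` for the pair `u`, `v`. -/
def tryIndex : Stmt :=
  x ≔ .get .Y s u k (.lit 0) ;; y ≔ .get .Y s v k (.lit 0) ;;
  .ite x (.ite y (z ≔ M -ₑ (x +ₑ y) ;; update u v ;; update v u) .skip) .skip

/-- Sets `b` to `1` if the value of rank `r` in row `u` is not yet covered and is completed by a
value of row `v` to the guess for `u`, `v`. -/
def hit : Stmt :=
  b ≔ .lit 0 ;; x ≔ .get .val s u r (.lit 0) ;; h ≔ .get .H rho u v (.lit 0) ;;
  .ite (x +ₑ .lit 1 <ₑ h) (.ite (.get .tab s v (h -ₑ .lit 2 -ₑ x) (.lit 0))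
    (b ≔ (.get .cov rho u r (.lit 0) =ₑ .lit 0)) .skip) .skip

/-- Runs `c` for all rows `u` and ranks `r` that the row `v` hits newly. -/
def forHits (c : Stmt) : Stmt :=
  .for u m (.for r (.get .nd s u (.lit 0) (.lit 0) +ₑ .lit 1) (hit ;; .ite b c .skip))

/-- Computes the number `acc` of places that the row `v` hits newly. -/
def accumulate : Stmt := acc ≔ .lit 0 ;; forHits (acc ≔ acc +ₑ .get .cnt s u r (.lit 0))

/-- Marks all that the row `v` hits as covered. -/
def markCovered : Stmt := forHits (.put .cov rho u r (.lit 0) (.lit 1))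

/-- Takes account of all places that the row `v` hits newly, one by one. -/
def bruteForce : Stmt :=
  forHits (.for i (.get .cnt s u r (.lit 0)) (k ≔ .get .lst s u r i ;; tryIndex))

/-- The choice of the pivots, with exhaustive search for the rows that do not become pivots. -/
def cover : Stmt :=
  R ≔ .lit 0 ;; .for v m (accumulate ;; .ite (m *ₑ D <ₑ acc *ₑ g)
    (.put .piv rho R (.lit 0) (.lit 0) v ;; R ≔ R +ₑ .lit 1 ;; markCovered) bruteForce)

/-- Sets `b` to `1` if the row `a` is joined to the node `a'` for the pivot `w`. -/
def incidence (w : Var) (a a' : Expr) : Stmt :=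
  y ≔ .get .Y s a (a' %ₑ D) (.lit 0) ;;
  .ite y (.ite (y +ₑ .get .val s w (a' /ₑ D) (.lit 0) +ₑ .lit 2 =ₑ .get .H rho a w (.lit 0))
    (b ≔ .lit 1) .skip) .skip

/-- Sets `b` to `1` if the graph has an edge from the node `i` to the node `j` of the next layer; see
`LayerEdge`. -/
def edge (i j : Var) : Stmt :=
  .ite (i /ₑ Q =ₑ .lit 0) (.ite (j /ₑ Q =ₑ .lit 1) (incidence p (i %ₑ Q) (j %ₑ Q)) .skip)
  (.ite (i /ₑ Q =ₑ .lit 1)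
    (.ite (j /ₑ Q =ₑ .lit 2) (.ite (i %ₑ Q %ₑ D =ₑ j %ₑ Q %ₑ D) (b ≔ .lit 1) .skip) .skip)
  (.ite (i /ₑ Q =ₑ .lit 2) (.ite (j /ₑ Q =ₑ .lit 3) (incidence p' (j %ₑ Q) (i %ₑ Q)) .skip) .skip))

/-- Writes the node weights for the subroutine.  Its words are shorter than those of the program,
hence the remainders modulo `mask + 1`. -/
def writeWeights : Stmt :=
  .for i N (x ≔ .lit 0 ;;
    .ite (i /ₑ Q =ₑ .lit 1) (x ≔ .get .val s p (i %ₑ Q /ₑ D) (.lit 0))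
      (.ite (i /ₑ Q =ₑ .lit 2) (x ≔ .get .val s p' (i %ₑ Q /ₑ D) (.lit 0)) .skip) ;;
    .put .ora rho t t' (i +ₑ .lit 1) ((M -ₑ x) %ₑ (mask +ₑ .lit 1)))

/-- Writes the adjacency matrix for the subroutine. -/
def writeEdges : Stmt :=
  .for q (N *ₑ N) (i ≔ q /ₑ N ;; j ≔ q %ₑ N ;; b ≔ .lit 0 ;; edge i j ;; edge j i ;;
    .put .ora rho t t' (q +ₑ N +ₑ .lit 1) (b %ₑ (mask +ₑ .lit 1)))

/-- Updates `best` from the distances that the subroutine has computed.  The test against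
`mask >>ₑ .lit 1` recognizes infinity.  A distance `x ≤ 3 M` belongs to a sum
`H u p + H v p' - 4 - (3 M - x)`, where `4` undoes the shift of the guesses by `2`. -/
def collect : Stmt :=
  .for u m (.for v m
    (x ≔ .get .ora rho t t' ((u *ₑ N +ₑ .lit 3 *ₑ Q +ₑ v) %ₑ (mask +ₑ .lit 1)) ;;
    .ite (x =ₑ mask >>ₑ .lit 1) .skip (.ite (.lit 3 *ₑ M <ₑ x) .skip
      (z ≔ .lit 4 *ₑ M +ₑ .lit 4 -ₑ
          (.get .H rho u p (.lit 0) +ₑ .get .H rho v p' (.lit 0) +ₑ x) ;; update u v))))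

/-- Takes account of the distances in the layered graph of the `t`-th and the `t'`-th pivot. -/
def pivotPair : Stmt :=
  p ≔ .get .piv rho t (.lit 0) (.lit 0) ;; p' ≔ .get .piv rho t' (.lit 0) (.lit 0) ;;
  .put .ora rho t t' (.lit 0) (N %ₑ (mask +ₑ .lit 1)) ;; writeWeights ;; writeEdges ;;
  .call .ora rho t t' ;; collect

/-- All pairs of pivots. -/
def pivotPairs : Stmt := .for t R (.for t' R pivotPair)

/-- The guess number `e` for all pairs of rows: twice the minimum at the coarser scale, minus `2`,
plus `e`.  What is stored is the guess increased by `2`. -/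
def guess : Stmt :=
  .for u m (.for v m
    (.put .H rho u v (.lit 0) (.lit 2 *ₑ (M -ₑ .get .best (s +ₑ .lit 1) u v (.lit 0)) +ₑ e)))

/-- One round, for one scale and one of the three guesses. -/
def round : Stmt := guess ;; cover ;; pivotPairs

/-- All rounds, from the coarsest scale to the scale `0` of the given entries.  Every round has a
number `rho` of its own, so that it finds its arrays filled with zeros. -/
def scales : Stmt :=
  .for stage Sc (s ≔ Sc -ₑ .lit 1 -ₑ stage ;;
    .for e (.lit 3) (rho ≔ .lit 3 *ₑ stage +ₑ e ;; round))

/-- At the scale `Sc` all finite entries are `1`, so the minimum is `2` or infinite.  The value stored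
is wrong in the second case, which does no harm, as then there is nothing to be found. -/
def startScale : Stmt :=
  .for u m (.for v m (.put .best Sc u v (.lit 0) (M -ₑ .lit 2)))

/-- Enters the place `k` of the row `u` into the index of the row. -/
def insert : Stmt :=
  y ≔ .get .Y s u k (.lit 0) ;;
  .ite y (r ≔ .get .tab s u y (.lit 0) ;;
    .ite r .skip (r ≔ .get .nd s u (.lit 0) (.lit 0) +ₑ .lit 1 ;; .put .tab s u y (.lit 0) r ;;
      .put .val s u r (.lit 0) y ;; .put .nd s u (.lit 0) (.lit 0) r) ;;
    x ≔ .get .cnt s u r (.lit 0) ;; .put .lst s u r x k ;;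
    .put .cnt s u r (.lit 0) (x +ₑ .lit 1)) .skip

/-- Computes the index of all rows at all scales. -/
def index : Stmt := .for s Sc (.for u m (.for k D insert))

/-- Computes the entries at the coarser scales, each time halved and rounded up. -/
def halve : Stmt :=
  .for s Sc (.for u m (.for k D
    (.put .Y (s +ₑ .lit 1) u k (.lit 0) ((.get .Y s u k (.lit 0) +ₑ .lit 1) >>ₑ .lit 1))))

/-- Computes the number `L` of binary digits of `n`. -/
def bitLength : Stmt :=
  x ≔ n ;; L ≔ .lit 0 ;; .for i n (.ite x (L ≔ L +ₑ .lit 1 ;; x ≔ x >>ₑ .lit 1) .skip)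

/-- Computes `nc = n ^ c`. -/
def power (c : ℕ) : Stmt := nc ≔ .lit 1 ;; .for i (.lit c) (nc ≔ nc *ₑ n)

/-- Computes the numbers that stay fixed.  The word sizes are `κ₀ * (L + 5)` for the subroutine and
`5 * κ₁ * L` for the program. -/
def constants (c κ₀ κ₁ a : ℕ) : Stmt :=
  radix ≔ .lit 1 <<ₑ (.lit κ₁ *ₑ L) ;; mask ≔ (.lit 1 <<ₑ (.lit κ₀ *ₑ (L +ₑ .lit 5))) -ₑ .lit 1 ;;
  inf ≔ (.lit 1 <<ₑ (.lit (5 * κ₁) *ₑ L -ₑ .lit 1)) -ₑ .lit 1 ;;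
  g ≔ .lit 1 <<ₑ (L /ₑ .lit a) ;; Sc ≔ .lit (c + 2) *ₑ L ;; m ≔ .lit 2 *ₑ n ;;
  Q ≔ .lit 8 *ₑ n ;; N ≔ .lit 32 *ₑ n ;; M ≔ .lit 16 *ₑ nc

/-- Stores the entry `k` of the row `u`, read from the address `a`, as a positive number. -/
def readEntry (a : Expr) : Stmt :=
  x ≔ .inp a ;; .ite (x =ₑ inf) .skip
    (.put .Y (.lit 0) u k (.lit 0) (.bin .wadd x (nc +ₑ .lit 1)))

/-- Reads the first matrix; its rows are the rows `0, …, n - 1`. -/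
def readRows : Stmt := .for i n (.for k D (u ≔ i ;; readEntry (.lit 2 +ₑ (i *ₑ D +ₑ k))))

/-- Reads the second matrix; its columns are the rows `n, …, 2 n - 1`. -/
def readColumns : Stmt :=
  .for j n (.for k D (u ≔ n +ₑ j ;; readEntry (.lit 2 +ₑ (n *ₑ D +ₑ (k *ₑ n +ₑ j)))))

/-- Writes the product.  The entries of the two rows were shifted by `nc + 1` each, which is undone
here. -/
def writeProduct : Stmt :=
  .for i n (.for j n (x ≔ .get .best (.lit 0) i (n +ₑ j) (.lit 0) ;;
    .ite x (.out (i *ₑ n +ₑ j) (.bin .wsub (M -ₑ x) (.lit 2 *ₑ nc +ₑ .lit 2)))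
      (.out (i *ₑ n +ₑ j) inf)))

/-- The program for the min-plus product. -/
def product (c κ₀ κ₁ a : ℕ) : Stmt :=
  n ≔ .inp (.lit 0) ;; D ≔ .inp (.lit 1) ;; bitLength ;; power c ;; constants c κ₀ κ₁ a ;;
  readRows ;; readColumns ;; halve ;; index ;; startScale ;; scales ;; writeProduct

end Programs

end RowWeight

end WordRAM

namespace WordRAM

namespace RowWeight

/-! ### Parameters, and the values of pairs of rows -/

/-- The numbers that stay fixed during a run: the size `n`, the inner dimension `D`, the bound `nc`
for the entries, the parameter `g` of the choice of the pivots and the number `Sc` of scales. -/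
structure Pars where
  (n D nc g Sc : ℕ)

/-- The fixed numbers satisfy the inequalities that the program depends on; `dd` bounds the number
of ranks, the rank `0` included.  By `dd_le` there is room for all pairs of a rank and an inner index
in a layer of `8 n` nodes, and by `radix` all numbers that occur as indices are less than `2 ^ l`. -/
structure Pars.Fits (π : Pars) (K : Cfg) (dd : ℕ) : Prop where
  n_pos : 0 < π.n
  D_pos : 0 < π.D
  D_le : π.D ≤ π.n
  nc_pos : 0 < π.nc
  g_pos : 0 < π.g
  g_le : π.g ≤ 2 * π.n
  dd_le : dd * π.D ≤ 8 * π.n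
  radix : 4096 * (π.n * π.n) + 4096 * π.nc + 16 * π.Sc + 4096 ≤ 2 ^ K.l

/-- The variables that stay fixed have the values that the program depends on. -/
structure Consts (K : Cfg) (π : Pars) (σ : St) : Prop where
  radix : σ.v .radix = 2 ^ K.l
  mask : σ.v .mask = 2 ^ K.w₀ - 1
  D : σ.v .D = π.D
  g : σ.v .g = π.g
  m : σ.v .m = 2 * π.n
  Q : σ.v .Q = 8 * π.n
  N : σ.v .N = 32 * π.n
  M : σ.v .M = 16 * π.nc
  Sc : σ.v .Sc = π.Sc

/-- The variables of `Consts`. -/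
def fixedVars : List Var := [.radix, .mask, .D, .g, .m, .Q, .N, .M, .Sc]

theorem Consts.of_eq {K : Cfg} {π : Pars} {σ σ' : St} (h : Consts K π σ)
    (he : ∀ x ∈ fixedVars, σ'.v x = σ.v x) : Consts K π σ' := by
  simp only [fixedVars, List.mem_cons, List.not_mem_nil, or_false, forall_eq_or_imp,
    forall_eq] at he
  obtain ⟨h1, h2, h3, h4, h5, h6, h7, h8, h9⟩ := he
  exact ⟨h1.trans h.1, h2.trans h.2, h3.trans h.3, h4.trans h.4, h5.trans h.5, h6.trans h.6,
    h7.trans h.7, h8.trans h.8, h9.trans h.9⟩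

theorem Consts.frame {K : Cfg} {π : Pars} {σ σ' : St} {c : Stmt} (h : Consts K π σ)
    (hF : Frame c σ σ') (hc : (fixedVars.all fun x => !c.writesVar x) = true) :
    Consts K π σ' :=
  h.of_eq fun x hx => hF.v x (by simpa using List.all_eq_true.1 hc x hx)

theorem Consts.set {K : Cfg} {π : Pars} {σ : St} (h : Consts K π σ) (x : Var) (z : ℕ)
    (hx : (fixedVars.all fun y => !decide (y = x)) = true) : Consts K π (σ.set x z) :=
  h.of_eq fun y hy => by
    have : y ≠ x := by simpa using List.all_eq_true.1 hx y hy
    simp [this]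

/-- Words are long enough for the products of two indices. -/
theorem Cfg.radix_sq_le (K : Cfg) : 2 ^ K.l * 2 ^ K.l ≤ 2 ^ K.w := by
  have := K.pow_le 2 (by norm_num)
  rwa [pow_two] at this

theorem Cfg.radix_le (K : Cfg) : 16 * 2 ^ K.l ≤ 2 ^ K.w :=
  le_trans (Nat.mul_le_mul_right _ K.sixteen_le) (Cfg.radix_sq_le K)

/-- The values of the pairs of rows: `M - min_k (Y u k + Y v k)`, and `0` if the minimum is
infinite.  The entry `0` stands for infinity. -/
def pairValue (D M : ℕ) (Y : ℕ → ℕ → ℕ) (u v : ℕ) : ℕ :=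
  (Finset.range D).sup fun k => if Y u k = 0 ∨ Y v k = 0 then 0 else M - (Y u k + Y v k)

theorem pairValue_comm (D M : ℕ) (Y : ℕ → ℕ → ℕ) (u v : ℕ) :
    pairValue D M Y u v = pairValue D M Y v u := by
  unfold pairValue
  congr 1
  funext k
  exact if_congr or_comm rfl (by rw [add_comm])

theorem le_pairValue {D M : ℕ} {Y : ℕ → ℕ → ℕ} {u v k : ℕ} (hk : k < D) (hu : Y u k ≠ 0)
    (hv : Y v k ≠ 0) : M - (Y u k + Y v k) ≤ pairValue D M Y u v := by
  have := Finset.le_sup (f := fun k => if Y u k = 0 ∨ Y v k = 0 then 0 else M - (Y u k + Y v k))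
    (Finset.mem_range.2 hk)
  rwa [if_neg (by simp [hu, hv])] at this

/-- The array `best` at the scale `s` improves from `σ` to `σ'`, and remains below `F`. -/
structure Improves (m s : ℕ) (F : ℕ → ℕ → ℕ) (σ σ' : St) : Prop where
  mono : ∀ u v, σ.m .best s u v 0 ≤ σ'.m .best s u v 0
  le : (∀ u < m, ∀ v < m, σ.m .best s u v 0 ≤ F u v) →
    ∀ u < m, ∀ v < m, σ'.m .best s u v 0 ≤ F u v
  other : ∀ s' ≠ s, σ'.m .best s' = σ.m .best s'

theorem Improves.refl (m s : ℕ) (F : ℕ → ℕ → ℕ) (σ : St) : Improves m s F σ σ :=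
  ⟨fun _ _ => le_rfl, fun h => h, fun _ _ => rfl⟩

theorem Improves.trans {m s : ℕ} {F : ℕ → ℕ → ℕ} {σ σ' σ'' : St} (h : Improves m s F σ σ')
    (h' : Improves m s F σ' σ'') : Improves m s F σ σ'' :=
  ⟨fun u v => (h.mono u v).trans (h'.mono u v), fun hF => h'.le (h.le hF),
    fun s' hs => (h'.other s' hs).trans (h.other s' hs)⟩

theorem Improves.of_eq {m s : ℕ} {F : ℕ → ℕ → ℕ} {σ σ' : St} (h : σ'.m .best = σ.m .best) :
    Improves m s F σ σ' :=
  ⟨fun _ _ => by rw [h], fun hF => by rwa [h], fun _ _ => by rw [h]⟩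

variable {K : Cfg} {π : Pars} {dd : ℕ} {σ : St}

theorem update_spec (hP : π.Fits K dd) (hC : Consts K π σ) {a b : Var} {F : ℕ → ℕ → ℕ}
    (hs : σ.v .s ≤ π.Sc) (ha : σ.v a < 2 * π.n) (hb : σ.v b < 2 * π.n)
    (hz : σ.v .z ≤ F (σ.v a) (σ.v b)) :
    WP K (update a b) (fun σ' t => Improves (2 * π.n) (σ.v .s) F σ σ' ∧ t ≤ 2 ∧
      σ.v .z ≤ σ'.m .best (σ.v .s) (σ.v a) (σ.v b) 0) σ := by
  have hr := hP.radix
  have := Nat.le_mul_self π.n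
  have hw := Cfg.radix_le K
  simp only [update, wp_ite, wp_put, wp_skip, Expr.Safe, Expr.eval, BinOp.eval, BinOp.Safe,
    hC.radix, and_true, true_and]
  refine ⟨by omega, fun h => ⟨by omega, ?_⟩, fun h => ⟨.refl .., by norm_num, ?_⟩⟩
  · have h' : σ.m .best (σ.v .s) (σ.v a) (σ.v b) 0 < σ.v .z := by
      by_contra h''; simp [h''] at h
    refine ⟨⟨fun u v => ?_, fun hF u hu v hv => ?_, fun s' hs' => ?_⟩, by norm_num, by simp⟩
    · simp only [St.put_m_self, true_and, and_true]
      split_ifs with h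
      · rw [h.1, h.2]; exact h'.le
      · exact le_rfl
    · simp only [St.put_m_self, true_and, and_true]
      split_ifs with h
      · rw [h.1, h.2]; exact hz
      · exact hF u hu v hv
    · funext u v x
      simp [hs']
  · by_contra h'
    simp [Nat.lt_of_not_le h'] at h

theorem tryIndex_spec (hP : π.Fits K dd) (hC : Consts K π σ) (hs : σ.v .s ≤ π.Sc)
    (hu : σ.v .u < 2 * π.n) (hv : σ.v .v < 2 * π.n) (hk : σ.v .k < π.D)
    (hY : ∀ u k, σ.m .Y (σ.v .s) u k 0 ≤ 2 * π.nc + 1) :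
    WP K tryIndex (fun σ' t =>
      let Y := fun u k => σ.m .Y (σ.v .s) u k 0
      Improves (2 * π.n) (σ.v .s) (pairValue π.D (16 * π.nc) Y) σ σ' ∧ t ≤ 9 ∧
      (Y (σ.v .u) (σ.v .k) ≠ 0 → Y (σ.v .v) (σ.v .k) ≠ 0 →
        16 * π.nc - (Y (σ.v .u) (σ.v .k) + Y (σ.v .v) (σ.v .k)) ≤
          σ'.m .best (σ.v .s) (σ.v .u) (σ.v .v) 0 ∧
        16 * π.nc - (Y (σ.v .u) (σ.v .k) + Y (σ.v .v) (σ.v .k)) ≤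
          σ'.m .best (σ.v .s) (σ.v .v) (σ.v .u) 0)) σ := by
  have hr := hP.radix
  have hD := hP.D_le
  have := Nat.le_mul_self π.n
  have hw := Cfg.radix_le K
  have h1 := hY (σ.v .u) (σ.v .k)
  have h2 := hY (σ.v .v) (σ.v .k)
  have hnc := hP.nc_pos
  simp only [tryIndex, wp_seq, wp_assign, Expr.Safe, Expr.eval, BinOp.eval, BinOp.Safe, hC.radix,
    and_true, true_and, St.set_v, reduceCtorEq, if_false, St.set_m]
  refine ⟨by omega, by omega, ?_⟩
  simp only [wp_ite, wp_seq, wp_assign, wp_skip, Expr.Safe, Expr.eval, BinOp.eval, BinOp.Safe,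
    St.set_v, reduceCtorEq, if_false, St.set_m, if_true, true_and]
  refine ⟨fun hx => ⟨fun hy => ⟨?_, ?_⟩, fun hy => ⟨.of_eq rfl, by norm_num, ?_⟩⟩,
    fun hx => ⟨.of_eq rfl, by norm_num, ?_⟩⟩
  · rw [hC.M]; omega
  · set Y := fun u k => σ.m .Y (σ.v .s) u k 0
    refine (update_spec (F := pairValue π.D (16 * π.nc) Y) hP (((hC.set .x _ rfl).set .y _ rfl).set
      .z _ rfl) (by simpa using hs) (by simpa using hu) (by simpa using hv) ?_).mono ?_
    · simpa [hC.M] using le_pairValue (Y := Y) hk hx hy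
    rintro σ₁ t₁ f₁ ⟨i₁, c₁, b₁⟩
    refine (update_spec (F := pairValue π.D (16 * π.nc) Y) hP
      ((((hC.set .x _ rfl).set .y _ rfl).set .z _ rfl).frame f₁ rfl)
      (by simpa [f₁.v .s rfl] using hs) (by simpa [f₁.v .v rfl] using hv)
      (by simpa [f₁.v .u rfl] using hu) ?_).mono ?_
    · rw [pairValue_comm]
      simpa [hC.M, f₁.v .z rfl, f₁.v .u rfl, f₁.v .v rfl] using le_pairValue (Y := Y) hk hx hy
    rintro σ₂ t₂ f₂ ⟨i₂, c₂, b₂⟩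
    simp only [f₁.v .s rfl, f₁.v .z rfl, f₁.v .u rfl, f₁.v .v rfl, St.set_v, reduceCtorEq,
      if_false, if_true, hC.M] at i₁ i₂ b₁ b₂
    have i := i₁.trans i₂
    refine ⟨⟨i.mono, i.le, i.other⟩, by omega, fun _ _ => ⟨?_, b₂⟩⟩
    exact b₁.trans (i₂.mono _ _)
  · exact fun _ h => absurd hy h
  · exact fun h => absurd hx h

/-- Whether rank `r` of row `u` is hit by row `v` for the current guess, that is, whether the guess
minus the value of rank `r` is a value of row `v`. -/
def Hit (σ : St) (u v r : ℕ) : Prop :=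
  σ.m .val (σ.v .s) u r 0 + 2 ≤ σ.m .H (σ.v .rho) u v 0 ∧
    σ.m .tab (σ.v .s) v (σ.m .H (σ.v .rho) u v 0 - 2 - σ.m .val (σ.v .s) u r 0) 0 ≠ 0

open Classical in
theorem hit_spec (hP : π.Fits K dd) (hC : Consts K π σ) (hs : σ.v .s ≤ π.Sc)
    (hrho : σ.v .rho ≤ 3 * π.Sc)
    (hu : σ.v .u < 2 * π.n) (hv : σ.v .v < 2 * π.n) (hr : σ.v .r ≤ π.D)
    (hval : σ.m .val (σ.v .s) (σ.v .u) (σ.v .r) 0 ≤ 2 * π.nc + 1)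
    (hH : σ.m .H (σ.v .rho) (σ.v .u) (σ.v .v) 0 ≤ 32 * π.nc + 2) :
    WP K hit (fun σ' t => σ'.v .b = (if Hit σ (σ.v .u) (σ.v .v) (σ.v .r) ∧
      σ.m .cov (σ.v .rho) (σ.v .u) (σ.v .r) 0 = 0 then 1 else 0) ∧ t ≤ 6) σ := by
  have h0 := hP.radix
  have hD := hP.D_le
  have := Nat.le_mul_self π.n
  have hw := Cfg.radix_le K
  simp only [hit, wp_seq, wp_assign, wp_ite, wp_skip, Expr.Safe, Expr.eval, BinOp.eval, BinOp.Safe,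
    hC.radix, and_true, true_and, St.set_v, reduceCtorEq, if_false, St.set_m, if_true, Hit]
  refine ⟨by omega, by omega, by omega, by omega, fun h => ⟨?_, fun ht => ⟨?_, ?_⟩, fun ht => ?_⟩,
    fun h => ?_⟩
  · have : σ.m .val (σ.v .s) (σ.v .u) (σ.v .r) 0 + 1 <
        σ.m .H (σ.v .rho) (σ.v .u) (σ.v .v) 0 := by
      by_contra h'; simp [h'] at h
    omega
  · omega
  · have : σ.m .val (σ.v .s) (σ.v .u) (σ.v .r) 0 + 1 <
        σ.m .H (σ.v .rho) (σ.v .u) (σ.v .v) 0 := by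
      by_contra h'; simp [h'] at h
    simp [ht, show σ.m .val (σ.v .s) (σ.v .u) (σ.v .r) 0 + 2 ≤
        σ.m .H (σ.v .rho) (σ.v .u) (σ.v .v) 0 by omega]
  · simp [ht]
  · have : ¬ σ.m .val (σ.v .s) (σ.v .u) (σ.v .r) 0 + 1 <
        σ.m .H (σ.v .rho) (σ.v .u) (σ.v .v) 0 := by
      intro h'; simp [h'] at h
    simp [show ¬ σ.m .val (σ.v .s) (σ.v .u) (σ.v .r) 0 + 2 ≤
        σ.m .H (σ.v .rho) (σ.v .u) (σ.v .v) 0 by omega]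

end RowWeight

end WordRAM

namespace WordRAM

namespace RowWeight

/-! ### The index of the rows, and loops over hits -/

/-- The index of a row `y` of length `D`: the nonzero values have the ranks `1, …, nd`, `tab` gives
the rank of a value, `val` the value of a rank, and `lst r` lists the `cnt r` places where the value
of rank `r` stands. -/
structure RowIndex (D : ℕ) (y tab val cnt : ℕ → ℕ) (lst : ℕ → ℕ → ℕ) (nd : ℕ) : Prop where
  tab_le : ∀ x, tab x ≤ nd
  tab_zero : tab 0 = 0
  val_tab : ∀ x, tab x ≠ 0 → val (tab x) = x
  tab_val : ∀ r, r ≠ 0 → r ≤ nd → tab (val r) = r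
  val_mem : ∀ r, val r = 0 ∨ ∃ k < D, y k = val r
  mem_lst : ∀ k < D, y k ≠ 0 → tab (y k) ≠ 0 ∧ ∃ i < cnt (tab (y k)), lst (tab (y k)) i = k
  lst_lt : ∀ r i, i < cnt r → lst r i < D
  cnt_eq_zero : ∀ r, nd < r → cnt r = 0
  sum_cnt : ∑ r ∈ Finset.range (nd + 1), cnt r ≤ D
  nd_le : nd ≤ D

/-- What the program relies on in round `rho` at the scale `s`.  The fact that the guesses are close
to the minima plays no role in the course of a round. -/
structure Env (K : Cfg) (π : Pars) (dd s rho : ℕ) (σ : St) : Prop where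
  consts : Consts K π σ
  s_eq : σ.v .s = s
  s_lt : s < π.Sc
  rho_eq : σ.v .rho = rho
  rho_lt : rho < 3 * π.Sc
  Y_le : ∀ u k, σ.m .Y s u k 0 ≤ 2 * π.nc + 1
  row : ∀ u < 2 * π.n, RowIndex π.D (fun k => σ.m .Y s u k 0) (fun x => σ.m .tab s u x 0)
    (fun r => σ.m .val s u r 0) (fun r => σ.m .cnt s u r 0) (fun r i => σ.m .lst s u r i)
    (σ.m .nd s u 0 0)
  nd_lt : ∀ u < 2 * π.n, σ.m .nd s u 0 0 < dd
  H_le : ∀ u < 2 * π.n, ∀ v < 2 * π.n, σ.m .H rho u v 0 ≤ 32 * π.nc + 2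

/-- The variables of `Env`. -/
def envVars : List Var := .s :: .rho :: fixedVars

/-- The arrays of `Env`. -/
def envArrs : List Arr := [.Y, .tab, .val, .cnt, .lst, .nd, .H]

/-- Whether a statement can write to the variables or arrays of `Env`. -/
def writesEnv (c : Stmt) : Bool := envVars.any c.writesVar || envArrs.any c.writesArr

variable {K : Cfg} {π : Pars} {dd s rho : ℕ} {σ : St}

theorem Env.of_eq {σ' : St} (h : Env K π dd s rho σ) (hv : ∀ x ∈ envVars, σ'.v x = σ.v x)
    (hm : ∀ A ∈ envArrs, σ'.m A = σ.m A) : Env K π dd s rho σ' := by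
  have hc := h.consts.of_eq (σ' := σ') fun x hx => hv x (by simp [envVars, hx])
  simp only [envArrs, List.mem_cons, List.not_mem_nil, or_false, forall_eq_or_imp,
    forall_eq] at hm
  obtain ⟨h1, h2, h3, h4, h5, h6, h7⟩ := hm
  refine ⟨hc, (hv _ (by simp [envVars])).trans h.s_eq, h.s_lt,
    (hv _ (by simp [envVars])).trans h.rho_eq, h.rho_lt, ?_, ?_, ?_, ?_⟩
  · rw [h1]; exact h.Y_le
  · rw [h1, h2, h3, h4, h5, h6]; exact h.row
  · rw [h6]; exact h.nd_lt
  · rw [h7]; exact h.H_le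

theorem Env.frame {σ' : St} {c : Stmt} (h : Env K π dd s rho σ) (hF : Frame c σ σ')
    (hc : writesEnv c = false) : Env K π dd s rho σ' := by
  simp only [writesEnv, Bool.or_eq_false_iff, List.any_eq_false, Bool.not_eq_true] at hc
  exact h.of_eq (fun x hx => hF.v x (hc.1 x hx)) fun A hA => hF.m A (hc.2 A hA)

theorem Env.set (h : Env K π dd s rho σ) (x : Var) (z : ℕ)
    (hx : (envVars.all fun y => !decide (y = x)) = true) : Env K π dd s rho (σ.set x z) :=
  h.of_eq (fun y hy => by
    have : y ≠ x := by simpa using List.all_eq_true.1 hx y hy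
    simp [this]) fun _ _ => rfl

theorem Env.val_le (h : Env K π dd s rho σ) {u : ℕ} (hu : u < 2 * π.n) (r : ℕ) :
    σ.m .val s u r 0 ≤ 2 * π.nc + 1 := by
  rcases (h.row u hu).val_mem r with e | ⟨k, _, e⟩
  · rw [e]; omega
  · rw [← e]; exact h.Y_le u k

/-- A sum over the entries of rows of lengths `nd u + 1`, up to the entry `j` of row `i`. -/
def partialSum (nd : ℕ → ℕ) (f : ℕ → ℕ → ℕ) (i j : ℕ) : ℕ :=
  ∑ u ∈ Finset.range i, ∑ r ∈ Finset.range (nd u + 1), f u r + ∑ r ∈ Finset.range j, f i r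

theorem partialSum_succ (nd : ℕ → ℕ) (f : ℕ → ℕ → ℕ) (i j : ℕ) :
    partialSum nd f i (j + 1) = partialSum nd f i j + f i j := by
  simp only [partialSum, Finset.sum_range_succ]; ring

theorem partialSum_row (nd : ℕ → ℕ) (f : ℕ → ℕ → ℕ) (i : ℕ) :
    partialSum nd f (i + 1) 0 = partialSum nd f i (nd i + 1) := by
  simp only [partialSum, Finset.sum_range_succ, Finset.sum_range_zero]
  ring

theorem partialSum_zero (nd : ℕ → ℕ) (f : ℕ → ℕ → ℕ) : partialSum nd f 0 0 = 0 := by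
  simp [partialSum]

/-- Whether rank `r` of row `u` is hit by row `v` and not covered. -/
def NewHit (σ : St) (u v r : ℕ) : Prop := Hit σ u v r ∧ σ.m .cov (σ.v .rho) u r 0 = 0

/-- The rule for loops over the hits by the row `v`.  The invariant `J i j` holds before the entry
`j` of row `i`, and `T i j` bounds the time until then. -/
theorem forHits_spec {c : Stmt} {v : ℕ} (hE : Env K π dd s rho σ) (hP : π.Fits K dd)
    (hv : σ.v .v = v) (hv' : v < 2 * π.n) (hc : writesEnv c = false)
    (hcv : ([Var.u, .v, .r].any c.writesVar) = false)
    (J : ℕ → ℕ → St → Prop) (T : ℕ → ℕ → ℕ)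
    (hJ : ∀ i j σ₁ σ₂, σ₂.m = σ₁.m → σ₂.v .acc = σ₁.v .acc → J i j σ₁ → J i j σ₂)
    (h₀ : J 0 0 σ) (hT₀ : T 0 0 = 0)
    (step : ∀ i < 2 * π.n, ∀ j ≤ σ.m .nd s i 0 0, ∀ σ', Frame (forHits c) σ σ' →
      Env K π dd s rho σ' → σ'.v .u = i → σ'.v .r = j → σ'.v .v = v → J i j σ' →
      (NewHit σ' i v j →
        WP K c (fun σ'' t => J i (j + 1) σ'' ∧ T i j + t + 9 ≤ T i (j + 1)) σ') ∧
      (¬ NewHit σ' i v j → J i (j + 1) σ' ∧ T i j + 9 ≤ T i (j + 1)))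
    (row : ∀ i < 2 * π.n, ∀ σ', J i (σ.m .nd s i 0 0 + 1) σ' → J (i + 1) 0 σ')
    (hT : ∀ i < 2 * π.n, T i (σ.m .nd s i 0 0 + 1) + 2 ≤ T (i + 1) 0) :
    WP K (forHits c) (fun σ' t => J (2 * π.n) 0 σ' ∧ t ≤ T (2 * π.n) 0 + 1) σ := by
  have hr := hP.radix
  have hD := hP.D_le
  have := Nat.le_mul_self π.n
  have hw := Cfg.radix_le K
  have hcv' : c.writesVar .u = false ∧ c.writesVar .v = false ∧ c.writesVar .r = false := by
    simpa using hcv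
  have hwE : writesEnv (forHits c) = false := by
    simp only [writesEnv, Bool.or_eq_false_iff, List.any_eq_false, Bool.not_eq_true] at hc ⊢
    refine ⟨fun x hx => ?_, fun A hA => ?_⟩
    · have := hc.1 x hx
      revert hx
      simp only [forHits, hit, Stmt.writesVar, this, Bool.or_false, envVars, fixedVars]
      clear this
      revert x; decide
    · have := hc.2 A hA
      simp only [forHits, hit, Stmt.writesArr, this, Bool.or_false]
  have hwv : (forHits c).writesVar .v = false := by
    simp [forHits, hit, Stmt.writesVar, hcv'.2.1]
  refine WP.for (k := 2 * π.n) (fun i σ' t => J i 0 σ' ∧ t ≤ T i 0) trivial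
    hE.consts.m ⟨h₀, by omega⟩ ?_ ?_
  · rintro i hi σ₁ t₁ f₁ ⟨j₁, c₁⟩
    have E₁ := hE.frame f₁ hwE
    have hv₁ : σ₁.v .v = v := by rw [f₁.v .v hwv, hv]
    have hnd : σ₁.m .nd s i 0 0 = σ.m .nd s i 0 0 := by
      have : (forHits c).writesArr .nd = false := by
        simp only [writesEnv, Bool.or_eq_false_iff, List.any_eq_false, Bool.not_eq_true] at hwE
        exact hwE.2 .nd (by decide)
      rw [f₁.m .nd this]
    have hndD := (hE.row i hi).nd_le
    refine WP.for (k := σ.m .nd s i 0 0 + 1) (fun j σ' t => J i j σ' ∧ t₁ + t ≤ T i j) ?_ ?_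
      ⟨hJ _ _ σ₁ _ rfl (by simp) j₁, by omega⟩ ?_ ?_
    · simp only [Expr.Safe, Expr.eval, BinOp.Safe, St.set_v, reduceCtorEq, if_false, if_true,
        St.set_m, E₁.s_eq, hnd, E₁.consts.radix, true_and, and_true]
      have := E₁.s_lt
      omega
    · simp only [Expr.eval, BinOp.eval, St.set_v, reduceCtorEq, if_false, if_true, St.set_m,
        E₁.s_eq, hnd]
    · rintro j hj σ₂ t₂ f₂ ⟨j₂, c₂⟩
      have hu₂ : σ₂.v .u = i := by
        rw [f₂.v .u (by simp [hit, Stmt.writesVar, hcv'.1])]; simp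
      have hv₂ : σ₂.v .v = v := by
        rw [f₂.v .v (by simp [hit, Stmt.writesVar, hcv'.2.1])]; simpa using hv₁
      have F₂ : Frame (forHits c) σ₁ σ₂ := by
        refine ⟨fun x hx => ?_, fun A hA => ?_⟩
        · have hx' := hx
          simp only [forHits, Stmt.writesVar, Bool.or_eq_false_iff, decide_eq_false_iff_not] at hx'
          rw [f₂.v x (by simp only [Stmt.writesVar, Bool.or_eq_false_iff,
            decide_eq_false_iff_not]; exact hx'.2)]
          simp [Ne.symm hx'.1]
        · exact f₂.m A hA
      have E₂ := E₁.frame F₂ hwE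
      rw [wp_seq]
      have E₃ := E₂.set .r j rfl
      refine (hit_spec hP E₃.consts (by rw [E₃.s_eq]; exact E₃.s_lt.le)
        (by rw [E₃.rho_eq]; exact E₃.rho_lt.le) (by simpa [hu₂]) (by simpa [hv₂])
        (by simp; omega) ?_ ?_).mono ?_
      · simp only [St.set_v, St.set_m, reduceCtorEq, if_false, E₂.s_eq, hu₂]
        exact E₂.val_le hi _
      · simp only [St.set_v, St.set_m, reduceCtorEq, if_false, E₂.rho_eq, hu₂, hv₂]
        exact E₂.H_le i hi v hv'
      rintro σ₃ t₃ f₃ ⟨b₃, c₃⟩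
      have m₃ : σ₃.m = σ₂.m := funext fun A => f₃.m A rfl
      have v₃ : ∀ x, hit.writesVar x = false → x ≠ .r → σ₃.v x = σ₂.v x := fun x hx hxr => by
        rw [f₃.v x hx]; simp [hxr]
      have F₃ : Frame (forHits c) σ σ₃ := by
        refine (f₁.trans F₂).trans ⟨fun x hx => ?_, fun A _ => by rw [m₃]⟩
        simp only [forHits, Stmt.writesVar, Bool.or_eq_false_iff, decide_eq_false_iff_not] at hx
        exact v₃ x hx.2.2.1 (Ne.symm hx.2.1)
      have hstep := step i hi j (by omega) σ₃ F₃ (hE.frame F₃ hwE)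
        (by rw [v₃ _ rfl (by decide), hu₂]) (by rw [f₃.v .r rfl]; simp)
        (by rw [v₃ _ rfl (by decide), hv₂])
        (hJ _ _ _ _ m₃ (v₃ _ rfl (by decide)) j₂)
      have hnew : NewHit σ₃ i v j ↔ σ₃.v .b ≠ 0 := by
        have hρ : σ₃.v .rho = σ₂.v .rho := v₃ _ rfl (by decide)
        have hs : σ₃.v .s = σ₂.v .s := v₃ _ rfl (by decide)
        simp only [b₃, NewHit, Hit, m₃, hρ, hs, St.set_v, St.set_m, reduceCtorEq, if_false, if_true,
          hu₂, hv₂]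
        split_ifs with h <;> simpa using h
      rw [wp_ite]
      refine ⟨trivial, fun hb => ?_, fun hb => ?_⟩
      · refine (hstep.1 (hnew.2 hb)).mono ?_
        rintro σ₄ t₄ _ ⟨j₄, c₄⟩
        exact ⟨j₄, by omega⟩
      · rw [wp_skip]
        obtain ⟨j₄, c₄⟩ := hstep.2 fun h => hnew.1 h hb
        exact ⟨j₄, by omega⟩
    · rintro σ₂ t₂ f₂ ⟨j₂, c₂⟩
      have := hT i hi
      exact ⟨row i hi _ j₂, by omega⟩
  · rintro σ₁ t₁ _ ⟨j₁, c₁⟩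
    exact ⟨j₁, by omega⟩

/-- The number of places with a new hit by row `v` in row `u`, rank `r`. -/
noncomputable def hitCount (σ : St) (s v u r : ℕ) : ℕ :=
  open Classical in if NewHit σ u v r then σ.m .cnt s u r 0 else 0

/-- The number of places with a new hit by row `v`. -/
noncomputable def hitTotal (σ : St) (s m v : ℕ) : ℕ :=
  partialSum (fun u => σ.m .nd s u 0 0) (hitCount σ s v) m 0

theorem partialSum_hitCount_le (hE : Env K π dd s rho σ) (v : ℕ) {i j : ℕ} (hi : i < 2 * π.n)
    (hj : j ≤ σ.m .nd s i 0 0 + 1) :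
    partialSum (fun u => σ.m .nd s u 0 0) (hitCount σ s v) i j ≤ (i + 1) * π.D := by
  have h1 : ∀ u r, hitCount σ s v u r ≤ σ.m .cnt s u r 0 := by
    intro u r
    unfold hitCount
    split_ifs
    · exact le_rfl
    · exact Nat.zero_le _
  rw [partialSum, add_mul, one_mul]
  refine add_le_add ?_ ?_
  · refine (Finset.sum_le_card_nsmul _ _ π.D fun u hu => ?_).trans (by simp)
    have hu := Finset.mem_range.1 hu
    exact (Finset.sum_le_sum fun r _ => h1 u r).trans (hE.row u (by omega)).sum_cnt
  · refine ((Finset.sum_le_sum fun r _ => h1 i r).trans ?_).trans (hE.row i hi).sum_cnt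
    exact Finset.sum_le_sum_of_subset (Finset.range_mono hj)

theorem NewHit.congr {σ σ' : St} (hm : ∀ A ∈ [Arr.val, .H, .tab, .cov], σ'.m A = σ.m A)
    (hs : σ'.v .s = σ.v .s) (hr : σ'.v .rho = σ.v .rho) (u v r : ℕ) :
    NewHit σ' u v r ↔ NewHit σ u v r := by
  unfold NewHit Hit
  rw [hm .val (by simp), hm .H (by simp), hm .tab (by simp), hm .cov (by simp), hs, hr]

theorem accumulate_spec (hE : Env K π dd s rho σ) (hP : π.Fits K dd) {v : ℕ}
    (hv : σ.v .v = v) (hv' : v < 2 * π.n) :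
    WP K accumulate (fun σ' t => σ'.v .acc = hitTotal σ s (2 * π.n) v ∧
      t ≤ 2 * π.n * (10 * dd + 2) + 2) σ := by
  have hr := hP.radix
  have hD := hP.D_le
  have := Nat.le_mul_self π.n
  have hw := Cfg.radix_le K
  rw [accumulate, wp_seq, wp_assign]
  refine ⟨by simp only [Expr.Safe]; omega, ?_⟩
  simp only [Expr.eval]
  refine (forHits_spec (v := v) (hE.set .acc 0 rfl) hP (by simpa) hv' rfl rfl
    (fun i j σ' => σ'.v .acc = partialSum (fun u => σ.m .nd s u 0 0) (hitCount σ s v) i j)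
    (fun i j => i * (10 * dd + 2) + 10 * j) (fun i j σ₁ σ₂ _ h h' => by rw [h, h'])
    (by simp [partialSum_zero]) (by simp) ?_ ?_ ?_).mono ?_
  · intro i hi j hj σ' f' E' hu' hr' hv'' J'
    simp only [St.set_m] at hj
    have hnew : NewHit σ' i v j ↔ NewHit σ i v j := by
      refine NewHit.congr (fun A hA => ?_) ?_ ?_ _ _ _
      · simp only [List.mem_cons, List.not_mem_nil, or_false] at hA
        rcases hA with rfl | rfl | rfl | rfl <;> exact f'.m _ rfl
      · exact f'.v .s rfl
      · exact f'.v .rho rfl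
    refine ⟨fun h => ?_, fun h => ⟨?_, by omega⟩⟩
    · have hle := partialSum_hitCount_le hE v hi (show j ≤ σ.m .nd s i 0 0 + 1 by omega)
      have hcnt : σ'.m .cnt s i j 0 ≤ π.D := by
        refine le_trans ?_ (hE.row i hi).sum_cnt
        rw [f'.m .cnt rfl]
        exact Finset.single_le_sum (f := fun r => σ.m .cnt s i r 0) (fun _ _ => Nat.zero_le _)
          (Finset.mem_range.2 (by omega))
      have hmul : (i + 1) * π.D ≤ 2 * π.n * π.n := Nat.mul_le_mul (by omega) hD
      have hnd := (hE.row i hi).nd_le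
      have := hE.s_lt
      simp only [wp_assign, Expr.Safe, Expr.eval, BinOp.eval, BinOp.Safe, E'.consts.radix, E'.s_eq,
        hu', hr', St.set_v, if_true, true_and]
      refine ⟨⟨by omega, ?_⟩, ?_, by omega⟩
      · rw [J']
        have : 2 * π.n * π.n = 2 * (π.n * π.n) := by ring
        omega
      · rw [partialSum_succ, J', hitCount, if_pos (hnew.1 h), f'.m .cnt rfl, St.set_m]
    · rw [partialSum_succ, J', hitCount, if_neg (fun h' => h (hnew.2 h')), add_zero]
  · intro i hi σ' J'
    rw [J', St.set_m, partialSum_row]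
  · intro i hi
    have := hE.nd_lt i hi
    simp only [St.set_m]
    rw [add_mul]
    omega
  · rintro σ' t _ ⟨J', c'⟩
    exact ⟨J', by omega⟩

end RowWeight

end WordRAM

namespace WordRAM

namespace RowWeight

/-! ### The choice of the pivots -/

variable {K : Cfg} {π : Pars} {dd s rho : ℕ} {σ : St}

theorem Hit.congr {σ σ' : St} (hm : ∀ A ∈ [Arr.val, .H, .tab], σ'.m A = σ.m A)
    (hs : σ'.v .s = σ.v .s) (hr : σ'.v .rho = σ.v .rho) (u v r : ℕ) :
    Hit σ' u v r ↔ Hit σ u v r := by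
  unfold Hit
  rw [hm .val (by simp), hm .H (by simp), hm .tab (by simp), hs, hr]

open Classical in
theorem markCovered_spec (hE : Env K π dd s rho σ) (hP : π.Fits K dd) {v : ℕ}
    (hv : σ.v .v = v) (hv' : v < 2 * π.n) :
    WP K markCovered (fun σ' t => (∀ ρ ≠ rho, σ'.m .cov ρ = σ.m .cov ρ) ∧
      (∀ u r, σ'.m .cov rho u r 0 = if (u < 2 * π.n ∧ r ≤ σ.m .nd s u 0 0) ∧ NewHit σ u v r then 1
        else σ.m .cov rho u r 0) ∧ t ≤ 2 * π.n * (10 * dd + 2) + 1) σ := by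
  have hr := hP.radix
  have hD := hP.D_le
  have := Nat.le_mul_self π.n
  have hw := Cfg.radix_le K
  refine (forHits_spec (v := v) hE hP hv hv' rfl rfl
    (fun i j σ' => (∀ ρ ≠ rho, σ'.m .cov ρ = σ.m .cov ρ) ∧
      ∀ u r, σ'.m .cov rho u r 0 = if ((u < i ∧ r ≤ σ.m .nd s u 0 0) ∨ u = i ∧ r < j) ∧
        NewHit σ u v r then 1 else σ.m .cov rho u r 0)
    (fun i j => i * (10 * dd + 2) + 10 * j) (fun i j σ₁ σ₂ h _ h' => by rw [h]; exact h')
    (by simp) (by simp) ?_ ?_ ?_).mono ?_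
  · rintro i hi j hj σ' f' E' hu' hr' hv'' ⟨J₁, J₂⟩
    have hnew : NewHit σ' i v j ↔ NewHit σ i v j := by
      unfold NewHit
      rw [E'.rho_eq, hE.rho_eq, J₂ i j, if_neg (by omega)]
      refine and_congr_left fun _ => Hit.congr (fun A hA => ?_) ?_ ?_ _ _ _
      · simp only [List.mem_cons, List.not_mem_nil, or_false] at hA
        rcases hA with rfl | rfl | rfl <;> exact f'.m _ rfl
      · exact f'.v .s rfl
      · exact f'.v .rho rfl
    have hnd := (hE.row i hi).nd_le
    have := hE.rho_lt
    refine ⟨fun h => ?_, fun h => ⟨⟨J₁, fun u r => ?_⟩, by omega⟩⟩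
    · simp only [wp_put, Expr.Safe, Expr.eval, E'.consts.radix, E'.rho_eq, hu', hr', true_and]
      refine ⟨by omega, by omega, ⟨fun ρ hρ => ?_, fun u r => ?_⟩, by omega⟩
      · funext a b c
        simp [hρ, J₁ ρ hρ]
      · simp only [St.put_m_self, true_and, and_true]
        by_cases e : u = i ∧ r = j
        · obtain ⟨rfl, rfl⟩ := e
          rw [if_pos ⟨rfl, rfl⟩, if_pos ⟨by omega, hnew.1 h⟩]
        · rw [if_neg e, J₂ u r]
          refine if_congr (and_congr_left fun _ => ?_) rfl rfl
          omega
    · rw [J₂ u r]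
      by_cases e : u = i ∧ r = j
      · obtain ⟨rfl, rfl⟩ := e
        have h' : ¬ NewHit σ u v r := fun h' => h (hnew.2 h')
        simp [h']
      · refine if_congr (and_congr_left fun _ => ?_) rfl rfl
        omega
  · rintro i hi σ' ⟨J₁, J₂⟩
    refine ⟨J₁, fun u r => ?_⟩
    rw [J₂ u r]
    refine if_congr (and_congr_left fun _ => ?_) rfl rfl
    constructor
    · rintro (h | ⟨rfl, h⟩) <;> omega
    · rintro (⟨h, h'⟩ | h)
      · by_cases e : u = i
        · subst e; omega
        · omega
      · omega
  · intro i hi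
    have := hE.nd_lt i hi
    rw [add_mul]
    omega
  · rintro σ' t _ ⟨⟨J₁, J₂⟩, c'⟩
    refine ⟨J₁, fun u r => ?_, by omega⟩
    rw [J₂ u r]
    refine if_congr (and_congr_left fun _ => ?_) rfl rfl
    omega

/-- The inner index `k` is accounted for in the entries of `best` for `u`, `v` and for `v`, `u`. -/
def Done (π : Pars) (Y : ℕ → ℕ → ℕ) (s : ℕ) (σ : St) (u v k : ℕ) : Prop :=
  Y u k ≠ 0 → Y v k ≠ 0 → 16 * π.nc - (Y u k + Y v k) ≤ σ.m .best s u v 0 ∧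
    16 * π.nc - (Y u k + Y v k) ≤ σ.m .best s v u 0

theorem Done.mono {Y : ℕ → ℕ → ℕ} {σ' : St} {m : ℕ} {F : ℕ → ℕ → ℕ} {u v k : ℕ}
    (h : Done π Y s σ u v k) (hi : Improves m s F σ σ') : Done π Y s σ' u v k :=
  fun hu hv => ⟨(h hu hv).1.trans (hi.mono _ _), (h hu hv).2.trans (hi.mono _ _)⟩

theorem bruteForce_spec (hE : Env K π dd s rho σ) (hP : π.Fits K dd) {v : ℕ}
    (hv : σ.v .v = v) (hv' : v < 2 * π.n) :
    WP K bruteForce (fun σ' t =>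
      Improves (2 * π.n) s (pairValue π.D (16 * π.nc) fun u k => σ.m .Y s u k 0) σ σ' ∧
      (∀ u < 2 * π.n, ∀ k < π.D, NewHit σ u v (σ.m .tab s u (σ.m .Y s u k 0) 0) →
        Done π (fun u k => σ.m .Y s u k 0) s σ' u v k) ∧
      t ≤ 2 * π.n * (10 * dd + 2) + 11 * hitTotal σ s (2 * π.n) v + 1) σ := by
  have hr := hP.radix
  have hD := hP.D_le
  have := Nat.le_mul_self π.n
  have hw := Cfg.radix_le K
  have hs := hE.s_lt
  set Y := fun u k => σ.m .Y s u k 0 with hY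
  set F := pairValue π.D (16 * π.nc) Y
  refine (forHits_spec (v := v) hE hP hv hv' rfl rfl
    (fun i j σ' => Improves (2 * π.n) s F σ σ' ∧
      ∀ u r, ((u < i ∧ r ≤ σ.m .nd s u 0 0) ∨ u = i ∧ r < j) → NewHit σ u v r →
        ∀ a < σ.m .cnt s u r 0, Done π Y s σ' u v (σ.m .lst s u r a))
    (fun i j => i * (10 * dd + 2) + 10 * j +
      11 * partialSum (fun u => σ.m .nd s u 0 0) (hitCount σ s v) i j)
    ?_ ⟨.refl .., by simp⟩ (by simp [partialSum_zero]) ?_ ?_ ?_).mono ?_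
  · intro i j σ₁ σ₂ h _ h'
    refine ⟨h'.1.trans (.of_eq (by rw [h])), fun u r hr hn a ha => ?_⟩
    exact (h'.2 u r hr hn a ha).mono (m := 0) (F := F) (.of_eq (by rw [h]))
  · rintro i hi j hj σ' f' E' hu' hr' hv'' ⟨J₁, J₂⟩
    have hnew : NewHit σ' i v j ↔ NewHit σ i v j := by
      refine NewHit.congr (fun A hA => ?_) ?_ ?_ _ _ _
      · simp only [List.mem_cons, List.not_mem_nil, or_false] at hA
        rcases hA with rfl | rfl | rfl | rfl <;> exact f'.m _ rfl
      · exact f'.v .s rfl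
      · exact f'.v .rho rfl
    have hnd := (hE.row i hi).nd_le
    have hcnt : σ.m .cnt s i j 0 ≤ π.D := by
      refine le_trans ?_ (hE.row i hi).sum_cnt
      exact Finset.single_le_sum (f := fun r => σ.m .cnt s i r 0) (fun _ _ => Nat.zero_le _)
        (Finset.mem_range.2 (by omega))
    refine ⟨fun h => ?_, fun h => ⟨⟨J₁, fun u r hur hn => ?_⟩, ?_⟩⟩
    · refine WP.for_le (k := σ.m .cnt s i j 0) (fun a σ₁ => Improves (2 * π.n) s F σ' σ₁ ∧
        ∀ b < a, Done π Y s σ₁ i v (σ.m .lst s i j b)) 10 ?_ ?_ ⟨.refl .., by simp⟩ ?_ ?_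
      · simp only [Expr.Safe, Expr.eval, E'.consts.radix, E'.s_eq, hu', hr', true_and]
        omega
      · simp only [Expr.eval, E'.s_eq, hu', hr', f'.m .cnt rfl]
      · rintro a ha σ₁ f₁ ⟨I₁, I₂⟩
        have E₁ := E'.frame f₁ rfl
        have hu₁ : σ₁.v .u = i := by rw [f₁.v .u rfl, hu']
        have hr₁ : σ₁.v .r = j := by rw [f₁.v .r rfl, hr']
        have hv₁ : σ₁.v .v = v := by rw [f₁.v .v rfl, hv'']
        have hl : σ₁.m .lst s i j a = σ.m .lst s i j a := by rw [f₁.m .lst rfl, f'.m .lst rfl]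
        have hY₁ : σ₁.m .Y = σ.m .Y := by rw [f₁.m .Y rfl, f'.m .Y rfl]
        have hk := (hE.row i hi).lst_lt j a ha
        simp only [wp_seq, wp_assign, Expr.Safe, Expr.eval, St.set_v, St.set_m, reduceCtorEq,
          if_false, if_true, E₁.consts.radix, E₁.s_eq, hu₁, hr₁, hl, true_and]
        refine ⟨by omega, ?_⟩
        have E₂ := (E₁.set .i a rfl).set .k (σ.m .lst s i j a) rfl
        refine (tryIndex_spec hP E₂.consts (by simp [E₁.s_eq, hs.le]) (by simp [hu₁, hi])
          (by simp [hv₁, hv']) (by simpa using hk)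
          (by simpa [E₁.s_eq] using E₁.Y_le)).mono ?_
        simp only [St.set_v, St.set_m, reduceCtorEq, if_false, if_true, E₁.s_eq, hu₁, hv₁, hY₁]
        rintro σ₂ t₂ - ⟨i₂, c₂, b₂⟩
        have i₂ : Improves (2 * π.n) s F σ₁ σ₂ := ⟨i₂.mono, i₂.le, i₂.other⟩
        refine ⟨⟨I₁.trans i₂, fun b hb => ?_⟩, by omega⟩
        rcases Nat.lt_succ_iff_lt_or_eq.1 hb with hb | rfl
        · exact (I₂ b hb).mono i₂
        · exact b₂
      · rintro σ₁ t₁ f₁ ⟨I₁, I₂⟩ c₁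
        refine ⟨⟨J₁.trans I₁, fun u r hur hn a ha => ?_⟩, ?_⟩
        · by_cases e : u = i ∧ r = j
          · obtain ⟨rfl, rfl⟩ := e
            exact I₂ a ha
          · exact (J₂ u r (by omega) hn a ha).mono I₁
        · rw [partialSum_succ, hitCount, if_pos (hnew.1 h)]
          omega
    · by_cases e : u = i ∧ r = j
      · obtain ⟨rfl, rfl⟩ := e
        exact absurd (hnew.2 hn) h
      · exact J₂ u r (by omega) hn
    · rw [partialSum_succ]
      omega
  · rintro i hi σ' ⟨J₁, J₂⟩
    refine ⟨J₁, fun u r hur => J₂ u r ?_⟩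
    rcases hur with ⟨h, h'⟩ | h
    · by_cases e : u = i
      · subst e; omega
      · omega
    · omega
  · intro i hi
    have := hE.nd_lt i hi
    rw [partialSum_row, add_mul]
    omega
  · rintro σ' t _ ⟨⟨J₁, J₂⟩, c'⟩
    refine ⟨J₁, fun u hu k hk hn hYu => ?_, ?_⟩
    · have hrow := hE.row u hu
      obtain ⟨ht, a, ha, hl⟩ := hrow.mem_lst k hk hYu
      have := J₂ u _ (Or.inl ⟨hu, hrow.tab_le _⟩) hn a ha
      rw [hl] at this
      exact this hYu
    · simpa [hitTotal] using c'

/-- The number of covered places. -/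
def coveredTotal (σ : St) (s rho m : ℕ) : ℕ :=
  partialSum (fun u => σ.m .nd s u 0 0)
    (fun u r => if σ.m .cov rho u r 0 = 0 then 0 else σ.m .cnt s u r 0) m 0

theorem coveredTotal_le (hE : Env K π dd s rho σ) :
    coveredTotal σ s rho (2 * π.n) ≤ 2 * π.n * π.D := by
  rw [coveredTotal, partialSum, Finset.sum_range_zero, add_zero]
  refine (Finset.sum_le_card_nsmul _ _ π.D fun u hu => ?_).trans (by simp)
  refine (Finset.sum_le_sum fun r _ => ?_).trans (hE.row u (Finset.mem_range.1 hu)).sum_cnt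
  split_ifs
  · exact Nat.zero_le _
  · exact le_rfl

/-- The pair of the row `u` and the inner index `k` is covered by one of the pivots: the entry is the
guess for `u` and the pivot minus a value of the pivot. -/
def Covered (σ : St) (Y : ℕ → ℕ → ℕ) (s rho u k : ℕ) : Prop :=
  ∃ i < σ.v .R, ∃ r, r ≤ σ.m .nd s (σ.m .piv rho i 0 0) 0 0 ∧
    Y u k + σ.m .val s (σ.m .piv rho i 0 0) r 0 + 2 = σ.m .H rho u (σ.m .piv rho i 0 0) 0

/-- After the choice of the pivots, every triple `u`, `v`, `k` that meets the guess has been searched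
or is covered for `u`.  The number of pivots is at most `g`, since every pivot covers more than
`2 n D / g` of the `2 n D` places for the first time; the invariant for this is
`R * (2 n D) ≤ g * coveredTotal`. -/
theorem cover_spec (hE : Env K π dd s rho σ) (hP : π.Fits K dd)
    (hcov : ∀ u r, σ.m .cov rho u r 0 = 0) :
    WP K cover (fun σ' t =>
      let Y := fun u k => σ.m .Y s u k 0
      Improves (2 * π.n) s (pairValue π.D (16 * π.nc) Y) σ σ' ∧
      (∀ ρ ≠ rho, σ'.m .cov ρ = σ.m .cov ρ) ∧ σ'.v .R ≤ π.g ∧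
      (∀ i < σ'.v .R, σ'.m .piv rho i 0 0 < 2 * π.n) ∧
      (∀ u < 2 * π.n, ∀ v < 2 * π.n, ∀ k < π.D, Y u k ≠ 0 → Y v k ≠ 0 →
        Y u k + Y v k + 2 = σ.m .H rho u v 0 → Done π Y s σ' u v k ∨ Covered σ' Y s rho u k) ∧
      t ≤ 2 * π.n * (4 * π.n * (10 * dd + 2) + 11 * (2 * π.n * π.D / π.g) + 8) + 2) σ := by
  classical
  have hr := hP.radix
  have hD := hP.D_le
  have hn := Nat.le_mul_self π.n
  have hw := Cfg.radix_le K
  have hw2 := Cfg.radix_sq_le K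
  have hs := hE.s_lt
  have hrho := hE.rho_lt
  set Y := fun u k => σ.m .Y s u k 0 with hY
  set F := pairValue π.D (16 * π.nc) Y
  set T := 4 * π.n * (10 * dd + 2) + 11 * (2 * π.n * π.D / π.g) + 7 with hT
  set X := 2 * π.n * π.D with hX
  have hX0 : 0 < X := Nat.mul_pos (Nat.mul_pos two_pos hP.n_pos) hP.D_pos
  have hXle : X ≤ 2 * (π.n * π.n) := by
    rw [hX, mul_assoc]; exact Nat.mul_le_mul_left _ (Nat.mul_le_mul_left _ hD)
  rw [cover, wp_seq, wp_assign]
  refine ⟨by simp only [Expr.Safe]; omega, ?_⟩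
  simp only [Expr.eval]
  refine WP.for_le (k := 2 * π.n) (fun j σ' => Improves (2 * π.n) s F σ σ' ∧
    (∀ ρ ≠ rho, σ'.m .cov ρ = σ.m .cov ρ) ∧
    σ'.v .R * X ≤ π.g * coveredTotal σ' s rho (2 * π.n) ∧
    (∀ i < σ'.v .R, σ'.m .piv rho i 0 0 < 2 * π.n) ∧
    (∀ u < 2 * π.n, ∀ r, σ'.m .cov rho u r 0 ≠ 0 →
      ∃ i < σ'.v .R, Hit σ u (σ'.m .piv rho i 0 0) r) ∧
    (∀ u < 2 * π.n, ∀ v < j, ∀ k < π.D, Y u k ≠ 0 → Y v k ≠ 0 →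
      Y u k + Y v k + 2 = σ.m .H rho u v 0 →
        Done π Y s σ' u v k ∨ σ'.m .cov rho u (σ.m .tab s u (Y u k) 0) 0 ≠ 0)) T trivial
    ((hE.set .R 0 rfl).consts.m) ?_ ?_ ?_
  · refine ⟨⟨fun _ _ => le_rfl, fun h => h, fun _ _ => rfl⟩, fun _ _ => rfl, by simp, by simp, ?_,
      by simp⟩
    intro u _ r h
    exact absurd (hcov u r) h
  · rintro v hv σ₁ f₁ ⟨I₁, C₁, P₁, L₁, H₁, W₁⟩
    have fR : ∀ x, x ≠ .R → (σ.set .R 0).v x = σ.v x := fun x hx => by simp [hx]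
    have E₁ := ((hE.set .R 0 rfl).frame f₁ rfl).set .v v rfl
    have hm₁ : ∀ A, cover.writesArr A = false → σ₁.m A = σ.m A := fun A hA => by
      rw [f₁.m A hA]; rfl
    have hHit₁ : ∀ u v r, Hit σ₁ u v r ↔ Hit σ u v r := Hit.congr
      (by
        intro A hA
        simp only [List.mem_cons, List.not_mem_nil, or_false] at hA
        rcases hA with rfl | rfl | rfl <;> exact hm₁ _ rfl)
      (f₁.v .s rfl) (f₁.v .rho rfl)
    have hR₁ : σ₁.v .R ≤ π.g := by
      have h1 := coveredTotal_le ((hE.set .R 0 rfl).frame f₁ rfl)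
      have h2 := P₁.trans (Nat.mul_le_mul_left π.g h1)
      exact Nat.le_of_mul_le_mul_right h2 hX0
    rw [wp_seq]
    refine (accumulate_spec (v := v) E₁ hP (by simp) hv).mono ?_
    rintro σ₂ t₂ f₂ ⟨A₂, c₂⟩
    have E₂ := E₁.frame f₂ rfl
    have hm₂ : σ₂.m = σ₁.m := funext fun A => f₂.m A rfl
    have hv₂ : σ₂.v .v = v := by rw [f₂.v .v rfl]; simp
    have hR₂ : σ₂.v .R = σ₁.v .R := by rw [f₂.v .R rfl]; simp
    have hHit₂ : ∀ u v r, Hit σ₂ u v r ↔ Hit σ u v r := fun u v r => by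
      rw [← hHit₁]
      exact Hit.congr (fun A _ => by rw [hm₂]) (by rw [f₂.v .s rfl]; simp)
        (by rw [f₂.v .rho rfl]; simp) _ _ _
    have hm₂' : ∀ A, cover.writesArr A = false → σ₂.m A = σ.m A := fun A hA => by
      rw [hm₂, hm₁ A hA]
    have hacc : hitTotal (σ₁.set .v v) s (2 * π.n) v = hitTotal σ₂ s (2 * π.n) v := by
      have : ∀ u r, NewHit (σ₁.set .v v) u v r ↔ NewHit σ₂ u v r := fun u r =>
        (NewHit.congr (fun A _ => by rw [hm₂]; rfl) (f₂.v .s rfl) (f₂.v .rho rfl) u v r).symm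
      have hc : hitCount (σ₁.set .v v) s v = hitCount σ₂ s v := by
        funext u r
        unfold hitCount
        rw [hm₂]
        simp only [St.set_m, hm₂, this]
      unfold hitTotal
      rw [hc, hm₂]
      rfl
    rw [hacc] at A₂
    have hAle : hitTotal σ₂ s (2 * π.n) v ≤ X := by
      have := partialSum_hitCount_le E₂ v (i := 2 * π.n - 1)
        (j := σ₂.m .nd s (2 * π.n - 1) 0 0 + 1) (by omega) le_rfl
      rw [hitTotal]
      have h3 : 2 * π.n = 2 * π.n - 1 + 1 := by omega
      rw [h3, partialSum_row]
      refine this.trans ?_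
      rw [← h3]
    rw [wp_ite]
    have hXD : σ₂.v .m * σ₂.v .D = X := by rw [E₂.consts.m, E₂.consts.D]
    have hAg : hitTotal σ₂ s (2 * π.n) v * π.g ≤ 2 * (π.n * π.n) * (2 * π.n) :=
      Nat.mul_le_mul (hAle.trans hXle) hP.g_le
    have hAg' : hitTotal σ₂ s (2 * π.n) v * π.g < 2 ^ K.w := by
      refine lt_of_le_of_lt (hAle.trans hXle |> fun h => Nat.mul_le_mul h hP.g_le) ?_
      refine lt_of_lt_of_le ?_ hw2
      exact Nat.mul_lt_mul'' (by omega) (by omega)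
    simp only [Expr.Safe, Expr.eval, BinOp.eval, BinOp.Safe, true_and, hXD, A₂, E₂.consts.g]
    refine ⟨⟨by omega, hAg', trivial⟩, fun h => ?_, fun h => ?_⟩
    · -- the row becomes a pivot
      have hlt : X < hitTotal σ₂ s (2 * π.n) v * π.g := by
        by_contra h'; simp [h'] at h
      simp only [wp_seq, wp_put, wp_assign, Expr.Safe, Expr.eval, BinOp.eval, BinOp.Safe,
        E₂.consts.radix, E₂.rho_eq, hR₂, hv₂, true_and, St.put_v, and_true]
      have hgle := hP.g_le
      refine ⟨by omega, ⟨by omega, by omega⟩, ?_⟩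
      have E₃ : Env K π dd s rho
          ((σ₂.put .piv rho (σ₁.v .R) 0 0 v).set .R (σ₁.v .R + 1)) :=
        E₂.of_eq (fun x hx => by
          simp only [St.set_v, St.put_v]
          rw [if_neg]; rintro rfl; revert hx; decide) (fun A hA => by
          simp only [St.set_m]
          rw [St.put_m_ne]; rintro rfl; revert hA; decide)
      refine (markCovered_spec E₃ hP (v := v) (by simp [hv₂]) hv).mono ?_
      rintro σ₃ t₃ f₃ ⟨C₃, V₃, c₃⟩
      have hR₃ : σ₃.v .R = σ₁.v .R + 1 := by rw [f₃.v .R rfl]; simp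
      have hpiv : ∀ i, σ₃.m .piv rho i 0 0 =
          if i = σ₁.v .R then v else σ₁.m .piv rho i 0 0 := fun i => by
        rw [f₃.m .piv rfl]; simp [hm₂]
      have hbest : σ₃.m .best = σ₁.m .best := by
        rw [f₃.m .best rfl]; simp [hm₂]
      have hcov₃ : ∀ u r, ((σ₂.put .piv rho (σ₁.v .R) 0 0 v).set .R (σ₁.v .R + 1)).m .cov rho u r 0
          = σ₁.m .cov rho u r 0 := fun u r => by simp [hm₂]
      have hnd₃ : ((σ₂.put .piv rho (σ₁.v .R) 0 0 v).set .R (σ₁.v .R + 1)).m .nd = σ.m .nd := by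
        simp [hm₂, hm₁ .nd rfl]
      have hnew₃ : ∀ u r, NewHit ((σ₂.put .piv rho (σ₁.v .R) 0 0 v).set .R (σ₁.v .R + 1)) u v r ↔
          NewHit σ₂ u v r := fun u r => NewHit.congr (fun A hA => by
            simp only [St.set_m]
            rw [St.put_m_ne]; rintro rfl; revert hA; decide) (by simp) (by simp) _ _ _
      replace V₃ : ∀ u r, σ₃.m .cov rho u r 0 =
          if (u < 2 * π.n ∧ r ≤ σ.m .nd s u 0 0) ∧ NewHit σ₂ u v r then 1
          else σ₁.m .cov rho u r 0 := fun u r => by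
        rw [V₃ u r, hcov₃]
        refine if_congr ?_ rfl rfl
        rw [hnd₃, hnew₃]
      have hV : ∀ u < 2 * π.n, ∀ r ≤ σ.m .nd s u 0 0,
          (if σ₃.m .cov rho u r 0 = 0 then 0 else σ₃.m .cnt s u r 0) =
          (if σ₁.m .cov rho u r 0 = 0 then 0 else σ₁.m .cnt s u r 0) + hitCount σ₂ s v u r := by
        intro u hu r hr
        have hcnt : σ₃.m .cnt = σ₁.m .cnt := by rw [f₃.m .cnt rfl]; simp [hm₂]
        rw [V₃ u r, hitCount, hcnt, hm₂]
        by_cases h' : NewHit σ₂ u v r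
        · have h0 := h'.2
          rw [E₂.rho_eq, hm₂] at h0
          simp [h', hu, hr, h0]
        · simp [h']
      refine ⟨⟨?_, ?_, ?_, ?_, ?_, ?_⟩, ?_⟩
      · exact I₁.trans (.of_eq hbest)
      · intro ρ hρ
        rw [C₃ ρ hρ, ← C₁ ρ hρ]
        simp [hm₂]
      · have hsum : coveredTotal σ₃ s rho (2 * π.n) =
            coveredTotal σ₁ s rho (2 * π.n) + hitTotal σ₂ s (2 * π.n) v := by
          have hnd₃' : σ₃.m .nd = σ.m .nd := by rw [f₃.m .nd rfl, hnd₃]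
          simp only [coveredTotal, hitTotal, partialSum, Finset.sum_range_zero, add_zero, hnd₃',
            hm₁ .nd rfl, hm₂' .nd rfl, ← Finset.sum_add_distrib]
          refine Finset.sum_congr rfl fun u hu => Finset.sum_congr rfl fun r hr => ?_
          exact hV u (Finset.mem_range.1 hu) r (by have := Finset.mem_range.1 hr; omega)
        rw [hR₃, hsum, add_mul, mul_add]
        have : π.g * hitTotal σ₂ s (2 * π.n) v = hitTotal σ₂ s (2 * π.n) v * π.g := mul_comm _ _
        omega
      · intro i hi
        rw [hpiv]
        split_ifs
        · exact hv
        · exact L₁ i (by omega)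
      · intro u hu r hcr
        rw [V₃ u r] at hcr
        by_cases h' : NewHit σ₂ u v r
        · refine ⟨σ₁.v .R, by omega, ?_⟩
          rw [hpiv, if_pos rfl, ← hHit₂]
          exact h'.1
        · simp only [h', and_false, if_false] at hcr
          obtain ⟨i, hi, hh⟩ := H₁ u hu r hcr
          refine ⟨i, by omega, ?_⟩
          rwa [hpiv, if_neg (by omega)]
      · intro u hu v' hv' k hk hYu hYv hsum
        rw [V₃]
        rcases Nat.lt_succ_iff_lt_or_eq.1 hv' with hv' | rfl
        · rcases W₁ u hu v' hv' k hk hYu hYv hsum with h' | h'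
          · exact Or.inl (h'.mono (m := 0) (F := F) (.of_eq hbest))
          · right
            split_ifs
            · exact one_ne_zero
            · exact h'
        · right
          split_ifs with h'
          · exact one_ne_zero
          · -- the place is hit by the new pivot, so if it was not covered before, it is now
            intro h0
            refine h' ⟨⟨hu, (hE.row u hu).tab_le _⟩, (hHit₂ _ _ _).2 ?_, by
              rw [E₂.rho_eq, hm₂]; exact h0⟩
            have htab := ((hE.row u hu).mem_lst k hk hYu).1
            have hval := (hE.row u hu).val_tab _ htab
            have htv := ((hE.row v' hv).mem_lst k hk hYv).1
            simp only [hY] at hval hsum hYu hYv htv ⊢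
            unfold Hit
            rw [hE.rho_eq, hE.s_eq, hval, ← hsum]
            refine ⟨by omega, ?_⟩
            rwa [show σ.m .Y s u k 0 + σ.m .Y s v' k 0 + 2 - 2 - σ.m .Y s u k 0 =
              σ.m .Y s v' k 0 by omega]
      · have e1 : 4 * π.n * (10 * dd + 2) = 2 * (2 * π.n * (10 * dd + 2)) := by ring
        omega
    · -- exhaustive search for the row
      have hge : hitTotal σ₂ s (2 * π.n) v * π.g ≤ X := by
        by_contra h'; rw [if_pos (by omega)] at h; exact one_ne_zero h
      have hdiv : hitTotal σ₂ s (2 * π.n) v ≤ X / π.g := (Nat.le_div_iff_mul_le hP.g_pos).2 hge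
      refine (bruteForce_spec E₂ hP hv₂ hv).mono ?_
      have hY₂ : (fun u k => σ₂.m .Y s u k 0) = Y := by rw [hm₂' .Y rfl]
      rw [hY₂]
      rintro σ₃ t₃ f₃ ⟨I₃, D₃, c₃⟩
      have hR₃ : σ₃.v .R = σ₁.v .R := by rw [f₃.v .R rfl, hR₂]
      have hcov₃ : σ₃.m .cov = σ₁.m .cov := by rw [f₃.m .cov rfl, hm₂]
      have hpiv₃ : σ₃.m .piv = σ₁.m .piv := by rw [f₃.m .piv rfl, hm₂]
      have I₃' : Improves (2 * π.n) s F σ₁ σ₃ :=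
        (Improves.of_eq (by rw [hm₂])).trans I₃
      refine ⟨⟨I₁.trans I₃', ?_, ?_, ?_, ?_, ?_⟩, ?_⟩
      · rw [hcov₃]; exact C₁
      · rw [hR₃]
        refine P₁.trans (le_of_eq ?_)
        simp only [coveredTotal, hcov₃, f₃.m .nd rfl, f₃.m .cnt rfl, hm₂]
      · rw [hR₃, hpiv₃]; exact L₁
      · rw [hR₃, hpiv₃, hcov₃]; exact H₁
      · intro u hu v' hv' k hk hYu hYv hsum
        rw [hcov₃]
        rcases Nat.lt_succ_iff_lt_or_eq.1 hv' with hv' | rfl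
        · rcases W₁ u hu v' hv' k hk hYu hYv hsum with h' | h'
          · exact Or.inl (h'.mono I₃')
          · exact Or.inr h'
        · rw [or_iff_not_imp_right, not_not]
          intro h0
          refine D₃ u hu k hk ⟨(hHit₂ _ _ _).2 ?_, ?_⟩
          · have htab := ((hE.row u hu).mem_lst k hk hYu).1
            have hval := (hE.row u hu).val_tab _ htab
            have htv := ((hE.row v' hv).mem_lst k hk hYv).1
            simp only [hY] at hval hsum hYu hYv htv ⊢
            unfold Hit
            rw [hm₂' .tab rfl, hm₂' .Y rfl, hE.rho_eq, hE.s_eq, hval, ← hsum]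
            refine ⟨by omega, ?_⟩
            rwa [show σ.m .Y s u k 0 + σ.m .Y s v' k 0 + 2 - 2 - σ.m .Y s u k 0 =
              σ.m .Y s v' k 0 by omega]
          · rw [E₂.rho_eq, hm₂' .tab rfl, hm₂' .Y rfl, hm₂]
            exact h0
      · have e1 : 4 * π.n * (10 * dd + 2) = 2 * (2 * π.n * (10 * dd + 2)) := by ring
        omega
  · rintro σ₁ t₁ f₁ ⟨I₁, C₁, P₁, L₁, H₁, W₁⟩ c₁
    have hm₁ : ∀ A, cover.writesArr A = false → σ₁.m A = σ.m A := fun A hA => by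
      rw [f₁.m A hA]; rfl
    refine ⟨I₁, C₁, ?_, L₁, ?_, ?_⟩
    · have h1 := coveredTotal_le ((hE.set .R 0 rfl).frame f₁ rfl)
      have h2 := P₁.trans (Nat.mul_le_mul_left π.g h1)
      exact Nat.le_of_mul_le_mul_right h2 hX0
    · intro u hu v hv k hk hYu hYv hsum
      refine (W₁ u hu v hv k hk hYu hYv hsum).imp_right fun h => ?_
      obtain ⟨i, hi, h1, h2⟩ := H₁ u hu _ h
      have htab := ((hE.row u hu).mem_lst k hk hYu).1
      have hval := (hE.row u hu).val_tab _ htab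
      have hp := hE.row _ (L₁ i hi)
      rw [hE.rho_eq, hE.s_eq] at h1 h2
      simp only [hY] at hval h1 h2
      rw [hval] at h1 h2
      refine ⟨i, hi, σ.m .tab s (σ₁.m .piv rho i 0 0)
        (σ.m .H rho u (σ₁.m .piv rho i 0 0) 0 - 2 - σ.m .Y s u k 0) 0, ?_, ?_⟩
      · rw [hm₁ .nd rfl]
        exact hp.tab_le (σ.m .H rho u (σ₁.m .piv rho i 0 0) 0 - 2 - σ.m .Y s u k 0)
      · have := hp.val_tab _ h2
        rw [hm₁ .val rfl, hm₁ .H rfl, this]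
        have eY : Y u k = σ.m .Y s u k 0 := rfl
        omega
    · have : T + 1 = 4 * π.n * (10 * dd + 2) + 11 * (2 * π.n * π.D / π.g) + 8 := by omega
      rw [← this]
      omega

end RowWeight

end WordRAM

namespace WordRAM

/-! ### The input of the subroutine -/

open Classical in
/-- The words of the input for the subroutine: `N`, the node weights, the adjacency matrix. -/
theorem graphInput_getD (w N : ℕ) (E : ℕ → ℕ → Prop) (wt : ℕ → ℕ) (x : ℕ) :
    (((graphInput (fun i j : Fin N => E i j) (fun i => (wt i : ℤ))).map (encode w)).getD x 0).toNat =
      if x = 0 then N % 2 ^ w else if x < N + 1 then wt (x - 1) % 2 ^ w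
      else if x < N * N + N + 1 then
        (if E ((x - N - 1) / N) ((x - N - 1) % N) then 1 else 0) % 2 ^ w else 0 := by
  have h1 : ((1 : ℤ) : WithTop ℤ) = (((1 : ℕ) : ℤ) : WithTop ℤ) := rfl
  have h0 : ((0 : ℤ) : WithTop ℤ) = (((0 : ℕ) : ℤ) : WithTop ℤ) := rfl
  have hlen : ∀ (M : Matrix (Fin N) (Fin N) (WithTop ℤ)), (rowMajor M).length = N * N := by
    intro M; simp [rowMajor]
  rcases Nat.eq_zero_or_pos x with rfl | hx
  · simp only [graphInput, List.cons_append, List.map_cons, List.getD_cons_zero, if_true]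
    exact encode_natCast _ _
  rw [if_neg (by omega)]
  by_cases hx1 : x < N + 1
  · rw [if_pos hx1, List.getD_eq_getElem?_getD, List.getElem?_map, graphInput,
      List.getElem?_append_left (by simp; omega), List.getElem?_append_right (by simp; omega)]
    rw [List.getElem?_eq_getElem (by simp; omega)]
    simp only [List.length_cons, List.length_nil, zero_add, List.getElem_ofFn, Option.map_some,
      Option.getD_some]
    exact encode_natCast _ _
  rw [if_neg hx1]
  by_cases hx2 : x < N * N + N + 1
  · rw [if_pos hx2, List.getD_eq_getElem?_getD, List.getElem?_map, graphInput,
      List.getElem?_append_right (by simp; omega), List.getElem?_eq_getElem (by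
        rw [hlen]; simp; omega)]
    simp only [rowMajor, List.getElem_ofFn, Option.map_some, Option.getD_some, Matrix.of_apply]
    have e : x - ([(((N : ℤ)) : WithTop ℤ)] ++
      List.ofFn fun v : Fin N => (((wt v : ℤ)) : WithTop ℤ)).length = x - N - 1 := by
      simp; omega
    simp only [Fin.divNat, Fin.modNat, e]
    split_ifs
    · rw [h1, encode_natCast]
    · rw [h0, encode_natCast]
  · rw [if_neg hx2, List.getD_eq_default]
    · simp
    · simp only [graphInput, List.length_map, List.length_append, hlen]
      simp; omega

/-- The subroutine computes the distances of the nodes in graphs on `N` nodes with node weights of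
absolute value at most `M`, in time at most `T`, on words of `w` bits. -/
def SolvesAPSP (p : Prog) (w N M T : ℕ) : Prop :=
  ∀ (G : SimpleGraph (Fin N)) (wt : Fin N → ℤ), (∀ v, |wt v| ≤ M) →
    ∃ (s : State w) (t : ℕ), Exec p (init w (graphInput G.Adj wt)) s t ∧
      Holds s (rowMajor (Matrix.of (nodeDist G.Adj wt))) ∧ t ≤ T

namespace RowWeight

variable {K : Cfg} {π : Pars} {dd s rho : ℕ} {σ : St}

/-- Row `u` is joined to the node `a` of the layer in the middle for the pivot `w`.  The node `a`
stands for the inner index `a % D` and the rank `a / D`. -/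
def Inc (π : Pars) (s rho : ℕ) (σ : St) (w u a : ℕ) : Prop :=
  σ.m .Y s u (a % π.D) 0 ≠ 0 ∧
    σ.m .Y s u (a % π.D) 0 + σ.m .val s w (a / π.D) 0 + 2 = σ.m .H rho u w 0

theorem Inc.congr {σ' : St} (hm : ∀ A ∈ [Arr.Y, .val, .H], σ'.m A = σ.m A) :
    Inc π s rho σ' = Inc π s rho σ := by
  unfold Inc
  rw [hm .val (by simp), hm .H (by simp), hm .Y (by simp)]

open Classical in
theorem incidence_spec (hE : Env K π dd s rho σ) (hP : π.Fits K dd) {w : Var} {a a' : Expr}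
    {u i : ℕ} (hw : w ≠ .y) (hw' : σ.v w < 2 * π.n)
    (ha : ∀ z, a.Safe K (σ.set .y z) ∧ a.eval K.w (σ.set .y z) = u)
    (ha' : ∀ z, a'.Safe K (σ.set .y z) ∧ a'.eval K.w (σ.set .y z) = i)
    (h₀ : a.Safe K σ ∧ a.eval K.w σ = u) (h₀' : a'.Safe K σ ∧ a'.eval K.w σ = i)
    (hu : u < 8 * π.n) (hi : i < 8 * π.n) :
    WP K (incidence w a a') (fun σ' t =>
      σ'.v .b = (if Inc π s rho σ (σ.v w) u i then 1 else σ.v .b) ∧ t ≤ 4) σ := by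
  have hr := hP.radix
  have hD := hP.D_le
  have hn := Nat.le_mul_self π.n
  have hr2 := Cfg.radix_le K
  have hs := hE.s_lt
  have hrho := hE.rho_lt
  have hY := hE.Y_le u (i % π.D)
  have hv := hE.val_le hw' (i / π.D)
  have hmod := Nat.mod_lt i hP.D_pos
  have hdiv := Nat.div_le_self i π.D
  simp only [incidence, wp_seq, wp_assign, wp_ite, wp_skip, Expr.Safe, Expr.eval, BinOp.eval,
    BinOp.Safe, h₀.1, h₀.2, h₀'.1, h₀'.2, ha, ha', St.set_v, St.set_m, reduceCtorEq, if_false,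
    if_true, hE.s_eq, hE.rho_eq, hE.consts.radix, hE.consts.D, hw, true_and, and_true]
  refine ⟨by omega, fun hy => ⟨by omega, fun h => ⟨by omega, ?_, by omega⟩,
    fun h => ⟨?_, by omega⟩⟩, fun hy => ⟨?_, by omega⟩⟩
  · rw [if_pos]
    refine ⟨hy, ?_⟩
    by_contra h'; simp [h'] at h
  · rw [if_neg]
    rintro ⟨_, h'⟩
    simp [h'] at h
  · rw [if_neg]
    exact fun h => h.1 hy

theorem _root_.WordRAM.LayerEdge.first_iff {D Q : ℕ} {inc inc' : ℕ → ℕ → Prop} {i j : ℕ}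
    (hi : i / Q = 0) (hj : j / Q = 1) :
    LayerEdge D Q inc inc' i j ↔ inc (i % Q) (j % Q) := by
  refine ⟨?_, fun h => Or.inl ⟨hi, hj, h⟩⟩
  rintro (h | h | h)
  · exact h.2.2
  · omega
  · omega

theorem _root_.WordRAM.LayerEdge.last_iff {D Q : ℕ} {inc inc' : ℕ → ℕ → Prop} {i j : ℕ}
    (hi : i / Q = 2) (hj : j / Q = 3) :
    LayerEdge D Q inc inc' i j ↔ inc' (j % Q) (i % Q) := by
  refine ⟨?_, fun h => Or.inr (Or.inr ⟨hi, hj, h⟩)⟩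
  rintro (h | h | h)
  · omega
  · omega
  · exact h.2.2

open Classical in
theorem edge_spec (hE : Env K π dd s rho σ) (hP : π.Fits K dd) {i j : Var} (hi : i ≠ .y)
    (hj : j ≠ .y) (hp : σ.v .p < 2 * π.n)
    (hp' : σ.v .p' < 2 * π.n) :
    WP K (edge i j) (fun σ' t => σ'.v .b = (if LayerEdge π.D (8 * π.n)
      (Inc π s rho σ (σ.v .p)) (Inc π s rho σ (σ.v .p')) (σ.v i) (σ.v j) then 1 else σ.v .b) ∧
      t ≤ 8) σ := by
  have hr := hP.radix
  have hn := hP.n_pos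
  have hr2 := Cfg.radix_le K
  have hQ := hE.consts.Q
  have hmi : σ.v i % (8 * π.n) < 8 * π.n := Nat.mod_lt _ (by omega)
  have hmj : σ.v j % (8 * π.n) < 8 * π.n := Nat.mod_lt _ (by omega)
  have e0 : ∀ {a b : ℕ}, (if a = b then 1 else 0) ≠ 0 → a = b := fun h => by
    by_contra h'; simp [h'] at h
  have e1 : ∀ {a b : ℕ}, (if a = b then 1 else 0) = 0 → a ≠ b := fun h h' => by simp [h'] at h
  simp only [edge, wp_ite, wp_skip, wp_assign, Expr.Safe, Expr.eval, BinOp.eval, BinOp.Safe, hQ,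
    hE.consts.D, true_and, and_true, St.set_v, if_true]
  refine ⟨by omega, fun h0 => ⟨by omega, fun h1 => ?_, fun h1 => ⟨?_, by omega⟩⟩,
    fun h0 => ⟨by omega, fun h1 => ⟨by omega, fun h2 => ⟨fun h3 => ⟨by omega, ?_, by omega⟩,
      fun h3 => ⟨?_, by omega⟩⟩,
      fun h2 => ⟨?_, by omega⟩⟩, fun h1 => ⟨by omega, fun h2 => ⟨by omega, fun h3 => ?_,
      fun h3 => ⟨?_, by omega⟩⟩, fun h2 => ⟨?_, by omega⟩⟩⟩⟩
  · refine (incidence_spec hE hP (u := σ.v i % (8 * π.n)) (i := σ.v j % (8 * π.n)) (by decide) hp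
      ?_ ?_ ?_ ?_ hmi hmj).mono ?_
    · intro z; simp [Expr.Safe, Expr.eval, BinOp.eval, BinOp.Safe, hi, hQ]
    · intro z; simp [Expr.Safe, Expr.eval, BinOp.eval, BinOp.Safe, hj, hQ]
    · simp [Expr.Safe, Expr.eval, BinOp.eval, BinOp.Safe, hQ]
    · simp [Expr.Safe, Expr.eval, BinOp.eval, BinOp.Safe, hQ]
    · rintro σ₁ t₁ _ ⟨h, c⟩
      rw [h]
      refine ⟨if_congr ?_ rfl rfl, by omega⟩
      rw [LayerEdge.first_iff (e0 h0) (e0 h1)]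
  · have := e0 h0
    have := e1 h1
    rw [if_neg]
    unfold LayerEdge
    omega
  · have := e1 h0
    have := e0 h1
    have := e0 h2
    have := e0 h3
    rw [if_pos]
    unfold LayerEdge
    omega
  · have := e1 h0
    have := e0 h1
    have := e0 h2
    have := e1 h3
    rw [if_neg]
    unfold LayerEdge
    omega
  · have := e1 h0
    have := e0 h1
    have := e1 h2
    rw [if_neg]
    unfold LayerEdge
    omega
  · refine (incidence_spec hE hP (u := σ.v j % (8 * π.n)) (i := σ.v i % (8 * π.n)) (by decide) hp'
      ?_ ?_ ?_ ?_ hmj hmi).mono ?_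
    · intro z; simp [Expr.Safe, Expr.eval, BinOp.eval, BinOp.Safe, hj, hQ]
    · intro z; simp [Expr.Safe, Expr.eval, BinOp.eval, BinOp.Safe, hi, hQ]
    · simp [Expr.Safe, Expr.eval, BinOp.eval, BinOp.Safe, hQ]
    · simp [Expr.Safe, Expr.eval, BinOp.eval, BinOp.Safe, hQ]
    · rintro σ₁ t₁ _ ⟨h, c⟩
      rw [h]
      refine ⟨if_congr ?_ rfl rfl, by omega⟩
      rw [LayerEdge.last_iff (e0 h2) (e0 h3)]
  · have := e1 h0
    have := e0 h2
    have := e1 h3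
    rw [if_neg]
    unfold LayerEdge
    omega
  · have := e1 h0
    have := e1 h1
    have := e1 h2
    rw [if_neg]
    unfold LayerEdge
    omega

end RowWeight

end WordRAM

namespace WordRAM

namespace RowWeight

variable {K : Cfg} {π : Pars} {dd s rho t t' : ℕ} {σ : St}

theorem ite_ne_zero_iff {p : Prop} [Decidable p] : (if p then 1 else 0) ≠ 0 ↔ p := by
  split_ifs with h <;> simp [h]

theorem ite_eq_zero_iff {p : Prop} [Decidable p] : (if p then 1 else 0) = 0 ↔ ¬ p := by
  split_ifs with h <;> simp [h]

theorem writeWeights_spec (hE : Env K π dd s rho σ) (hP : π.Fits K dd) (hp : σ.v .p < 2 * π.n)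
    (hp' : σ.v .p' < 2 * π.n) (ht : σ.v .t = t) (ht' : σ.v .t' = t') (htn : t < 2 * π.n)
    (htn' : t' < 2 * π.n) :
    WP K writeWeights (fun σ' τ => (∀ a b c x, σ'.m .ora a b c x =
      if (a = rho ∧ b = t ∧ c = t') ∧ 1 ≤ x ∧ x < 32 * π.n + 1 then
        layerWeight π.D (8 * π.n) (16 * π.nc) (fun r => σ.m .val s (σ.v .p) r 0)
          (fun r => σ.m .val s (σ.v .p') r 0) (x - 1) % 2 ^ K.w₀
      else σ.m .ora a b c x) ∧ τ ≤ 32 * π.n * 6 + 1) σ := by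
  have hr := hP.radix
  have hn := Nat.le_mul_self π.n
  have hr2 := Cfg.radix_le K
  have hs := hE.s_lt
  have hrho := hE.rho_lt
  have hnpos := hP.n_pos
  have hw₀ : 2 ^ K.w₀ - 1 + 1 = 2 ^ K.w₀ := Nat.sub_add_cancel Nat.one_le_two_pow
  have hw₀' : 2 ^ K.w₀ ≤ 2 ^ K.l := Nat.pow_le_pow_right two_pos K.w₀_le
  set val := fun r => σ.m .val s (σ.v .p) r 0
  set val' := fun r => σ.m .val s (σ.v .p') r 0
  set W := layerWeight π.D (8 * π.n) (16 * π.nc) val val' with hW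
  refine WP.for_le (k := 32 * π.n) (fun i σ' => ∀ a b c x, σ'.m .ora a b c x =
      if (a = rho ∧ b = t ∧ c = t') ∧ 1 ≤ x ∧ x < i + 1 then W (x - 1) % 2 ^ K.w₀
      else σ.m .ora a b c x) 5 trivial hE.consts.N ?_ ?_ ?_
  · intro a b c x
    rw [if_neg (by omega)]
  · intro i hi σ₁ f₁ h₁
    have E₁ := hE.frame f₁ rfl
    have ep : σ₁.v .p = σ.v .p := f₁.v _ rfl
    have ep' : σ₁.v .p' = σ.v .p' := f₁.v _ rfl
    have et : σ₁.v .t = t := by rw [f₁.v _ rfl, ht]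
    have et' : σ₁.v .t' = t' := by rw [f₁.v _ rfl, ht']
    have eval : σ₁.m .val = σ.m .val := f₁.m _ rfl
    have hmod : i % (8 * π.n) < 8 * π.n := Nat.mod_lt _ (by omega)
    have hdiv := Nat.div_le_self (i % (8 * π.n)) π.D
    have key : ∀ z, W i = 16 * π.nc - z → ∀ a b c x,
        (if a = rho ∧ b = t ∧ c = t' ∧ x = i + 1 then (16 * π.nc - z) % 2 ^ K.w₀
          else σ₁.m .ora a b c x) =
        if (a = rho ∧ b = t ∧ c = t') ∧ 1 ≤ x ∧ x < i + 1 + 1 then W (x - 1) % 2 ^ K.w₀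
        else σ.m .ora a b c x := by
      intro z hz a b c x
      by_cases e : x = i + 1
      · subst e
        by_cases e' : a = rho ∧ b = t ∧ c = t'
        · rw [if_pos (by tauto), if_pos ⟨e', by omega⟩, Nat.add_sub_cancel, hz]
        · rw [if_neg (by tauto), h₁, if_neg (by tauto), if_neg (by tauto)]
      · rw [if_neg (by tauto), h₁]
        refine if_congr (and_congr_right fun _ => ?_) rfl rfl
        omega
    have hv1 := hE.val_le hp (i % (8 * π.n) / π.D)
    have hv2 := hE.val_le hp' (i % (8 * π.n) / π.D)
    have hnc := hP.nc_pos
    simp only [wp_seq, wp_assign, wp_ite, wp_skip, wp_put, Expr.Safe, Expr.eval, BinOp.eval,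
      BinOp.Safe, E₁.consts.Q, E₁.consts.D, E₁.consts.radix, E₁.consts.M, E₁.consts.mask, E₁.s_eq,
      E₁.rho_eq, true_and, and_true, St.set_v, St.set_m, if_true, reduceCtorEq, if_false, ep, ep',
      et, et', eval, ite_ne_zero_iff, ite_eq_zero_iff, hw₀, St.put_m_self]
    refine ⟨by omega, by omega, fun h => ⟨by omega, by omega, by omega, ?_, by omega⟩,
      fun h => ⟨by omega, fun h' => ⟨by omega, by omega, by omega, ?_, by omega⟩,
        fun h' => ⟨by omega, by omega, ?_, by omega⟩⟩⟩
    · exact key _ (by rw [hW, layerWeight, if_pos h])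
    · exact key _ (by rw [hW, layerWeight, if_neg h, if_pos h'])
    · exact key _ (by rw [hW, layerWeight, if_neg h, if_neg h'])
  · intro σ₁ τ _ h₁ hτ
    exact ⟨h₁, by omega⟩

open Classical in
theorem writeEdges_spec (hE : Env K π dd s rho σ) (hP : π.Fits K dd) (hp : σ.v .p < 2 * π.n)
    (hp' : σ.v .p' < 2 * π.n) (ht : σ.v .t = t) (ht' : σ.v .t' = t') (htn : t < 2 * π.n)
    (htn' : t' < 2 * π.n) {G : ℕ → ℕ → Prop}
    (hG : ∀ i j, G i j ↔
      LayerEdge π.D (8 * π.n) (Inc π s rho σ (σ.v .p)) (Inc π s rho σ (σ.v .p')) i j ∨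
      LayerEdge π.D (8 * π.n) (Inc π s rho σ (σ.v .p)) (Inc π s rho σ (σ.v .p')) j i) :
    WP K writeEdges (fun σ' τ => (∀ a b c x, σ'.m .ora a b c x =
      if (a = rho ∧ b = t ∧ c = t') ∧ 32 * π.n + 1 ≤ x ∧
          x < 32 * π.n * (32 * π.n) + 32 * π.n + 1 then
        (if G ((x - 32 * π.n - 1) / (32 * π.n)) ((x - 32 * π.n - 1) % (32 * π.n)) then 1 else 0)
          % 2 ^ K.w₀
      else σ.m .ora a b c x) ∧ τ ≤ 32 * π.n * (32 * π.n) * 21 + 1) σ := by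
  have hr := hP.radix
  have hn := Nat.le_mul_self π.n
  have hr2 := Cfg.radix_le K
  have hs := hE.s_lt
  have hrho := hE.rho_lt
  have hnpos := hP.n_pos
  have hw₀ : 2 ^ K.w₀ - 1 + 1 = 2 ^ K.w₀ := Nat.sub_add_cancel Nat.one_le_two_pow
  have hw₀' : 2 ^ K.w₀ ≤ 2 ^ K.l := Nat.pow_le_pow_right two_pos K.w₀_le
  set N := 32 * π.n with hN
  have hNN : N * N = 1024 * (π.n * π.n) := by rw [hN]; ring
  set B := fun q => if G (q / N) (q % N) then 1 else 0 with hB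
  change WP K _ (fun σ' τ => (∀ a b c x, σ'.m .ora a b c x = if (a = rho ∧ b = t ∧ c = t') ∧
    N + 1 ≤ x ∧ x < N * N + N + 1 then B (x - N - 1) % 2 ^ K.w₀ else σ.m .ora a b c x) ∧ _) _
  refine WP.for_le (k := N * N) (fun i σ' => ∀ a b c x, σ'.m .ora a b c x =
      if (a = rho ∧ b = t ∧ c = t') ∧ N + 1 ≤ x ∧ x < i + N + 1 then B (x - N - 1) % 2 ^ K.w₀
      else σ.m .ora a b c x) 20 ?_ ?_ ?_ ?_ ?_
  · simp only [Expr.Safe, Expr.eval, BinOp.Safe, hE.consts.N, true_and, ← hN]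
    omega
  · simp only [Expr.eval, BinOp.eval, hE.consts.N, hN]
  · intro a b c x
    rw [if_neg (by omega)]
  · intro q hq σ₁ f₁ h₁
    have E₁ := hE.frame f₁ rfl
    have ep : σ₁.v .p = σ.v .p := f₁.v _ rfl
    have ep' : σ₁.v .p' = σ.v .p' := f₁.v _ rfl
    have et : σ₁.v .t = t := by rw [f₁.v _ rfl, ht]
    have et' : σ₁.v .t' = t' := by rw [f₁.v _ rfl, ht']
    have eI : Inc π s rho σ₁ = Inc π s rho σ := Inc.congr fun A hA => by
      simp only [List.mem_cons, List.not_mem_nil, or_false] at hA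
      rcases hA with rfl | rfl | rfl <;> exact f₁.m _ rfl
    simp only [wp_seq, wp_assign, Expr.Safe, Expr.eval, BinOp.eval, BinOp.Safe, E₁.consts.N,
      true_and, St.set_v, reduceCtorEq, if_false, if_true]
    refine ⟨by omega, ?_⟩
    set σ₂ := (((σ₁.set .q q).set .i (q / (32 * π.n))).set .j (q % (32 * π.n))).set .b 0 with hσ₂
    have E₂ : Env K π dd s rho σ₂ :=
      ((((E₁.set .q q rfl).set .i _ rfl).set .j _ rfl).set .b _ rfl)
    have i₂ : σ₂.v .i = q / N := by simp [hσ₂, hN]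
    have j₂ : σ₂.v .j = q % N := by simp [hσ₂, hN]
    refine (edge_spec E₂ hP (i := .i) (j := .j) (by decide) (by decide)
      (by simpa [hσ₂, ep]) (by simpa [hσ₂, ep'])).mono ?_
    rintro σ₃ t₃ f₃ ⟨b₃, c₃⟩
    have E₃ := E₂.frame f₃ rfl
    have m₃ : σ₃.m = σ₁.m := by
      have : σ₃.m = σ₂.m := funext fun A => f₃.m A rfl
      rw [this]; rfl
    have v₃ : ∀ x, (edge .i .j).writesVar x = false → σ₃.v x = σ₂.v x := f₃.v
    refine (edge_spec E₃ hP (i := .j) (j := .i) (by decide) (by decide)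
      (by rw [v₃ _ rfl]; simpa [hσ₂, ep]) (by rw [v₃ _ rfl]; simpa [hσ₂, ep'])).mono ?_
    rintro σ₄ t₄ f₄ ⟨b₄, c₄⟩
    have E₄ := E₃.frame f₄ rfl
    have m₄ : σ₄.m = σ₁.m := by rw [← m₃]; exact funext fun A => f₄.m A rfl
    have v₄ : ∀ x, (edge .i .j).writesVar x = false → σ₄.v x = σ₂.v x := fun x hx => by
      rw [f₄.v x hx, v₃ x hx]
    have I₂ : Inc π s rho σ₂ = Inc π s rho σ := by rw [← eI]; rfl
    have I₃ : Inc π s rho σ₃ = Inc π s rho σ := by rw [← eI]; exact Inc.congr fun A _ => by rw [m₃]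
    have b₂ : σ₂.v .b = 0 := by simp [hσ₂]
    have p₂ : σ₂.v .p = σ.v .p := by simp [hσ₂, ep]
    have p₂' : σ₂.v .p' = σ.v .p' := by simp [hσ₂, ep']
    rw [b₃, b₂, I₂, I₃, v₃ _ rfl, v₃ _ rfl, v₃ _ rfl, v₃ _ rfl, i₂, j₂, p₂, p₂'] at b₄
    have bq : σ₄.v .b = B q := by
      rw [b₄, hB]
      simp only [hG]
      split_ifs <;> tauto
    have q₄ : σ₄.v .q = q := by rw [v₄ _ rfl]; simp [hσ₂]
    have t₄' : σ₄.v .t = t := by rw [v₄ _ rfl]; simp [hσ₂, et]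
    have t₄'' : σ₄.v .t' = t' := by rw [v₄ _ rfl]; simp [hσ₂, et']
    simp only [wp_put, Expr.Safe, Expr.eval, BinOp.eval, BinOp.Safe, E₄.consts.N, E₄.consts.radix,
      E₄.consts.mask, E₄.rho_eq, q₄, t₄', t₄'', bq, hw₀, true_and, and_true, St.put_m_self, m₄,
      ← hN]
    refine ⟨by omega, by omega, ?_, by omega⟩
    intro a b c x
    by_cases e : x = q + N + 1
    · subst e
      by_cases e' : a = rho ∧ b = t ∧ c = t'
      · rw [if_pos (by tauto), if_pos ⟨e', by omega⟩, show q + N + 1 - N - 1 = q by omega]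
      · rw [if_neg (by tauto), h₁, if_neg (by tauto), if_neg (by tauto)]
    · rw [if_neg (by tauto), h₁]
      refine if_congr (and_congr_right fun _ => ?_) rfl rfl
      omega
  · intro σ₁ τ _ h₁ hτ
    exact ⟨h₁, by omega⟩

end RowWeight

end WordRAM

namespace WordRAM

namespace RowWeight

/-! ### Reading off the distances -/

variable {K : Cfg} {π : Pars} {dd s rho t t' : ℕ} {σ : St}

/-- Rows `u` and `v` are joined by a path of length three through the nodes `a` and `b` of the
layers in the middle, for the pivots `w` and `w'`. -/
def Joined (π : Pars) (s rho : ℕ) (σ : St) (w w' u v a b : ℕ) : Prop :=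
  a < 8 * π.n ∧ b < 8 * π.n ∧ Inc π s rho σ w u a ∧ a % π.D = b % π.D ∧ Inc π s rho σ w' v b

/-- The word that the subroutine returns for the rows `u` and `v`. -/
def distWord (K : Cfg) (π : Pars) (rho t t' : ℕ) (σ : St) (u v : ℕ) : ℕ :=
  σ.m .ora rho t t' ((u * (32 * π.n) + 3 * (8 * π.n) + v) % 2 ^ K.w₀)

/-- The words that the subroutine returns are the distances in the layered graph of the pivots `w`
and `w'`. -/
def HoldsDist (K : Cfg) (π : Pars) (s rho t t' w w' : ℕ) (σ : St) : Prop :=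
  ∀ u < 2 * π.n, ∀ v < 2 * π.n,
    (distWord K π rho t t' σ u v = (2 ^ K.w₀ - 1) / 2 ∧ ∀ a b, ¬ Joined π s rho σ w w' u v a b) ∨
    (distWord K π rho t t' σ u v ≠ (2 ^ K.w₀ - 1) / 2 ∧
      (distWord K π rho t t' σ u v ≤ 3 * (16 * π.nc) → ∃ a b, Joined π s rho σ w w' u v a b ∧
        distWord K π rho t t' σ u v +
          (σ.m .val s w (a / π.D) 0 + σ.m .val s w' (b / π.D) 0) = 3 * (16 * π.nc)) ∧
      ∀ a b, Joined π s rho σ w w' u v a b → distWord K π rho t t' σ u v +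
          (σ.m .val s w (a / π.D) 0 + σ.m .val s w' (b / π.D) 0) ≤ 3 * (16 * π.nc))

/-- Every pair of rows joined for the pivots is accounted for, and no entry of `best` gets too large:
a path of weight at most `3 M` is a triple `u`, `v`, `k` with the sum that its weight encodes. -/
theorem collect_spec (hE : Env K π dd s rho σ) (hP : π.Fits K dd) {w w' : ℕ} (hp : σ.v .p = w)
    (hp' : σ.v .p' = w') (hw : w < 2 * π.n) (hw' : w' < 2 * π.n)
    (ht : σ.v .t = t) (ht' : σ.v .t' = t') (htn : t < 2 * π.n)
    (htn' : t' < 2 * π.n) (hO : HoldsDist K π s rho t t' w w' σ) :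
    WP K collect (fun σ' τ =>
      let Y := fun u k => σ.m .Y s u k 0
      Improves (2 * π.n) s (pairValue π.D (16 * π.nc) Y) σ σ' ∧
      (∀ u < 2 * π.n, ∀ v < 2 * π.n, ∀ a b, Joined π s rho σ w w' u v a b →
        16 * π.nc - (Y u (a % π.D) + Y v (a % π.D)) ≤ σ'.m .best s u v 0) ∧
      τ ≤ 2 * π.n * (2 * π.n * 8 + 2) + 1) σ := by
  have hr := hP.radix
  have hn := Nat.le_mul_self π.n
  have hr2 := Cfg.radix_le K
  have hs := hE.s_lt
  have hrho := hE.rho_lt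
  have hnpos := hP.n_pos
  have hnc := hP.nc_pos
  have hw₀ : 2 ^ K.w₀ - 1 + 1 = 2 ^ K.w₀ := Nat.sub_add_cancel Nat.one_le_two_pow
  have hw₀' : 2 ^ K.w₀ ≤ 2 ^ K.l := Nat.pow_le_pow_right two_pos K.w₀_le
  set Y := fun u k => σ.m .Y s u k 0 with hY
  set F := pairValue π.D (16 * π.nc) Y
  refine WP.for_le (k := 2 * π.n) (fun i σ' => Improves (2 * π.n) s F σ σ' ∧
      ∀ u < i, ∀ v < 2 * π.n, ∀ a b, Joined π s rho σ w w' u v a b →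
        16 * π.nc - (Y u (a % π.D) + Y v (a % π.D)) ≤ σ'.m .best s u v 0)
    (2 * π.n * 8 + 1) trivial hE.consts.m ⟨.refl .., by simp⟩ ?_ ?_
  · rintro u hu σ₁ f₁ ⟨I₁, B₁⟩
    have E₁ := (hE.frame f₁ rfl).set .u u rfl
    refine WP.for_le (k := 2 * π.n) (fun i σ' => Improves (2 * π.n) s F σ σ' ∧
      (∀ u' < u, ∀ v < 2 * π.n, ∀ a b, Joined π s rho σ w w' u' v a b →
        16 * π.nc - (Y u' (a % π.D) + Y v (a % π.D)) ≤ σ'.m .best s u' v 0) ∧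
      ∀ v < i, ∀ a b, Joined π s rho σ w w' u v a b →
        16 * π.nc - (Y u (a % π.D) + Y v (a % π.D)) ≤ σ'.m .best s u v 0)
      7 trivial E₁.consts.m ⟨⟨I₁.mono, I₁.le, I₁.other⟩, B₁, by simp⟩ ?_ ?_
    · rintro v hv σ₂ f₂ ⟨I₂, A₂, B₂⟩
      have E₂ := (E₁.frame f₂ rfl).set .v v rfl
      have ev : ∀ x, collect.writesVar x = false → σ₂.v x = σ.v x := fun x hx => by
        have hx' := hx
        simp only [collect, Stmt.writesVar, Bool.or_eq_false_iff, decide_eq_false_iff_not] at hx'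
        rw [f₂.v x (by simp [collect, Stmt.writesVar, hx']), St.set_v, if_neg (Ne.symm hx'.1),
          f₁.v x hx]
      have em : ∀ A, collect.writesArr A = false → σ₂.m A = σ.m A := fun A hA => by
        rw [f₂.m A hA, St.set_m, f₁.m A hA]
      have eu : σ₂.v .u = u := by rw [f₂.v .u rfl]; simp
      have ep : σ₂.v .p = w := by rw [ev _ rfl, hp]
      have ep' : σ₂.v .p' = w' := by rw [ev _ rfl, hp']
      have et : σ₂.v .t = t := by rw [ev _ rfl, ht]
      have et' : σ₂.v .t' = t' := by rw [ev _ rfl, ht']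
      have hun : u * (32 * π.n) ≤ 64 * (π.n * π.n) := by
        refine (Nat.mul_le_mul_right _ hu.le).trans (le_of_eq ?_)
        ring
      have hmod : (u * (32 * π.n) + 3 * (8 * π.n) + v) % 2 ^ K.w₀ < 2 ^ K.w₀ :=
        Nat.mod_lt _ (by positivity)
      have hdw : distWord K π rho t t' σ u v =
        σ.m .ora rho t t' ((u * (32 * π.n) + 3 * (8 * π.n) + v) % 2 ^ K.w₀) := rfl
      set d := distWord K π rho t t' σ u v
      -- the value computed for a path of length three
      have hval : ∀ a b, Joined π s rho σ w w' u v a b →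
          Y u (a % π.D) ≠ 0 ∧ Y v (a % π.D) ≠ 0 ∧
          Y u (a % π.D) ≤ 2 * π.nc + 1 ∧ Y v (a % π.D) ≤ 2 * π.nc + 1 ∧
          σ.m .H rho u w 0 + σ.m .H rho v w' 0 =
            Y u (a % π.D) + Y v (a % π.D) + 4 +
              (σ.m .val s w (a / π.D) 0 + σ.m .val s w' (b / π.D) 0) := by
        rintro a b ⟨-, -, ⟨h1, h2⟩, h3, h4, h5⟩
        rw [← h3] at h4 h5
        refine ⟨h1, h4, hE.Y_le _ _, hE.Y_le _ _, ?_⟩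
        simp only [hY]
        omega
      have hfin : ∀ σ₃ : St, Improves (2 * π.n) s F σ₂ σ₃ →
          (∀ a b, Joined π s rho σ w w' u v a b →
            16 * π.nc - (Y u (a % π.D) + Y v (a % π.D)) ≤ σ₃.m .best s u v 0) →
          Improves (2 * π.n) s F σ σ₃ ∧
          (∀ u' < u, ∀ v < 2 * π.n, ∀ a b, Joined π s rho σ w w' u' v a b →
            16 * π.nc - (Y u' (a % π.D) + Y v (a % π.D)) ≤ σ₃.m .best s u' v 0) ∧
          ∀ v' < v + 1, ∀ a b, Joined π s rho σ w w' u v' a b →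
            16 * π.nc - (Y u (a % π.D) + Y v' (a % π.D)) ≤ σ₃.m .best s u v' 0 := by
        intro σ₃ I₃ B₃
        refine ⟨I₂.trans I₃, fun u' hu' v' hv' a b h => (A₂ u' hu' v' hv' a b h).trans (I₃.mono _ _),
          fun v' hv' a b h => ?_⟩
        rcases Nat.lt_succ_iff_lt_or_eq.1 hv' with hv' | rfl
        · exact (B₂ v' hv' a b h).trans (I₃.mono _ _)
        · exact B₃ a b h
      simp only [wp_seq, wp_assign, wp_ite, wp_skip, Expr.Safe, Expr.eval, BinOp.eval, BinOp.Safe,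
        E₂.consts.N, E₂.consts.Q, E₂.consts.M, E₂.consts.mask, E₂.consts.radix, E₂.rho_eq, eu, ep,
        ep', et, et', hw₀, true_and, and_true, St.set_v, St.set_m, reduceCtorEq, if_false, if_true,
        ite_ne_zero_iff, ite_eq_zero_iff, em .ora rfl, em .H rfl, ← hdw, pow_one]
      refine ⟨by omega, by omega, fun h => ⟨hfin _ (.of_eq rfl) fun a b hj => ?_, by omega⟩,
        fun h => ⟨by omega, fun h' => ⟨hfin _ (.of_eq rfl) fun a b hj => ?_, by omega⟩,
          fun h' => ⟨?_, ?_⟩⟩⟩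
      · rcases hO u hu v hv with ⟨_, h2⟩ | ⟨h1, _⟩
        · exact absurd hj (h2 a b)
        · exact absurd h h1
      · rcases hO u hu v hv with ⟨_, h2⟩ | ⟨_, _, h1⟩
        · exact absurd hj (h2 a b)
        · have : d + _ ≤ _ := h1 a b hj
          omega
      · rcases hO u hu v hv with ⟨h1, _⟩ | ⟨_, h1, _⟩
        · exact absurd h1 h
        · obtain ⟨a, b, hj, hd⟩ := h1 (by omega)
          change d + _ = _ at hd
          have := hval a b hj
          omega
      · rcases hO u hu v hv with ⟨h1, _⟩ | ⟨_, h1, h2⟩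
        · exact absurd h1 h
        obtain ⟨a, b, hj, hd⟩ := h1 (by omega)
        change d + _ = _ at hd
        have ha := hval a b hj
        set z := 4 * (16 * π.nc) + 4 - (σ.m .H rho u w 0 + σ.m .H rho v w' 0 + d) with hz
        have hzv : z = 16 * π.nc - (Y u (a % π.D) + Y v (a % π.D)) := by omega
        refine (update_spec (F := F) hP ((E₂.set .x d rfl).set .z z rfl).consts ?_ ?_ ?_ ?_).mono ?_
        · simpa [E₂.s_eq, (E₁.frame f₂ rfl).s_eq] using hs.le
        · simpa [eu] using hu
        · simpa using hv
        · simp only [St.set_v, reduceCtorEq, if_false, if_true, eu]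
          rw [hzv]
          exact le_pairValue (Nat.mod_lt _ hP.D_pos) ha.1 ha.2.1
        · rintro σ₃ t₃ f₃ ⟨I₃, c₃, b₃⟩
          simp only [St.set_v, reduceCtorEq, if_false, if_true, eu, (E₁.frame f₂ rfl).s_eq] at I₃ b₃
          refine ⟨hfin σ₃ ⟨I₃.mono, I₃.le, I₃.other⟩ fun a' b' hj' => le_trans ?_ b₃, by omega⟩
          have h3 := h2 a' b' hj'
          change d + _ ≤ _ at h3
          have := hval a' b' hj'
          omega
    · rintro σ₂ t₂ _ ⟨I₂, A₂, B₂⟩ c₂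
      refine ⟨⟨I₂, fun u' hu' => ?_⟩, by omega⟩
      rcases Nat.lt_succ_iff_lt_or_eq.1 hu' with hu' | rfl
      · exact A₂ u' hu'
      · exact B₂
  · rintro σ₁ t₁ _ ⟨I₁, B₁⟩ c₁
    exact ⟨I₁, B₁, by omega⟩

end RowWeight

end WordRAM

namespace WordRAM

namespace RowWeight

/-! ### One call for each pair of pivots -/

variable {K : Cfg} {π : Pars} {dd s rho t t' : ℕ} {σ : St}

/-- The output of the subroutine, decoded by means of the description of the light paths in the
layered graph. -/
theorem holdsDist_of_holds (hE : Env K π dd s rho σ) (hP : π.Fits K dd) {w w' : ℕ}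
    (hw : w < 2 * π.n) (hw' : w' < 2 * π.n) {S : State K.w₀}
    (hS : Holds S (rowMajor (Matrix.of (nodeDist
      (layerGraph (4 * (8 * π.n)) π.D (8 * π.n) (Inc π s rho σ w) (Inc π s rho σ w')).Adj
      (fun x => (layerWeight π.D (8 * π.n) (16 * π.nc) (fun r => σ.m .val s w r 0)
        (fun r => σ.m .val s w' r 0) x : ℤ))))))
    (hora : ∀ x < 2 ^ K.w₀, σ.m .ora rho t t' x = (S.mem (BitVec.ofNat K.w₀ x)).toNat) :
    HoldsDist K π s rho t t' w w' σ := by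
  intro u hu v hv
  have hn := hP.n_pos
  have hnc := hP.nc_pos
  set Q := 8 * π.n with hQ
  set N := 4 * Q with hN
  set a := u * N + (3 * Q + v) with ha
  have hvN : 3 * Q + v < N := by omega
  have haN : a < N * N := mul_add_lt hvN (by omega)
  have hdiv : a / N = u := by rw [ha, mul_comm, Nat.mul_add_div (by omega), Nat.div_eq_of_lt hvN]; rfl
  have hmod : a % N = 3 * Q + v := by rw [ha, mul_comm, Nat.mul_add_mod, Nat.mod_eq_of_lt hvN]
  have hdw : distWord K π rho t t' σ u v = (S.mem (BitVec.ofNat K.w₀ a)).toNat := by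
    rw [distWord, hora _ (Nat.mod_lt _ (by positivity))]
    congr 2
    apply BitVec.eq_of_toNat_eq
    rw [BitVec.toNat_ofNat, BitVec.toNat_ofNat, Nat.mod_mod, ha, show N = 32 * π.n by omega,
      ← add_assoc]
  set wt : Fin N → ℤ := fun x => (layerWeight π.D Q (16 * π.nc) (fun r => σ.m .val s w r 0)
        (fun r => σ.m .val s w' r 0) x : ℤ) with hwt
  set G := layerGraph N π.D Q (Inc π s rho σ w) (Inc π s rho σ w') with hG
  let iu : Fin N := ⟨u, by omega⟩
  let iv : Fin N := ⟨3 * Q + v, hvN⟩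
  have hdec : decode (S.mem (BitVec.ofNat K.w₀ a)) = nodeDist G.Adj wt iu iv := by
    rw [hS a (by simpa [rowMajor] using haN)]
    simp only [rowMajor, List.getElem_ofFn, Matrix.of_apply]
    congr 1
    · exact Fin.ext hdiv
    · exact Fin.ext hmod
  have hiff := fun d (hd : d ≤ 3 * (16 * π.nc)) =>
    layerGraph_path_iff (D := π.D) (Q := Q) (M := 16 * π.nc) (W := 2 * π.nc + 1)
      (inc := Inc π s rho σ w) (inc' := Inc π s rho σ w') (val := fun r => σ.m .val s w r 0)
      (val' := fun r => σ.m .val s w' r 0) (by omega) (hE.val_le hw) (hE.val_le hw') (by omega)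
      (u := u) (v := v) (by omega) (by omega) hd (i := iu) (j := iv) rfl rfl
  have hpath : ∀ a b, Joined π s rho σ w w' u v a b → PathOfWeight G.Adj wt iu iv
      ((3 * (16 * π.nc) - (σ.m .val s w (a / π.D) 0 + σ.m .val s w' (b / π.D) 0) : ℕ) : ℤ) := by
    rintro a b ⟨h1, h2, h3, h4, h5⟩
    have := hE.val_le hw (a / π.D)
    have := hE.val_le hw' (b / π.D)
    exact (hiff _ (Nat.sub_le _ _)).2 ⟨a, h1, b, h2, h3, h4, h5, by omega⟩
  rcases nodeDist_cases (E := G.Adj) (wt := wt) (fun v => Int.natCast_nonneg _) iu iv with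
    ⟨h1, h2⟩ | ⟨d, h1, h2, h3⟩
  · left
    rw [hdw]
    exact ⟨toNat_of_decode_eq_top (hdec.trans h1), fun a b h => h2 _ (hpath a b h)⟩
  · right
    obtain ⟨e1, e2⟩ := toNat_of_decode_eq_natCast (hdec.trans h1)
    rw [hdw]
    refine ⟨e2, fun hd => ?_, fun a b h => ?_⟩
    · rw [e1] at hd ⊢
      obtain ⟨a, h1, b, h2, h3, h4, h5, h6⟩ := (hiff d hd).1 h2
      exact ⟨a, b, ⟨h1, h2, h3, h4, h5⟩, h6⟩
    · have h4 := h3 _ (hpath a b h)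
      have := hE.val_le hw (a / π.D)
      have := hE.val_le hw' (b / π.D)
      omega

/-- The pairs of rows with a common inner index that the pivots `w` and `w'` account for. -/
def PairDone (π : Pars) (s rho : ℕ) (σ σ' : St) (w w' : ℕ) : Prop :=
  ∀ u < 2 * π.n, ∀ v < 2 * π.n, ∀ k < π.D, ∀ r r', r ≤ σ.m .nd s w 0 0 → r' ≤ σ.m .nd s w' 0 0 →
    σ.m .Y s u k 0 ≠ 0 → σ.m .Y s v k 0 ≠ 0 →
    σ.m .Y s u k 0 + σ.m .val s w r 0 + 2 = σ.m .H rho u w 0 →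
    σ.m .Y s v k 0 + σ.m .val s w' r' 0 + 2 = σ.m .H rho v w' 0 →
    16 * π.nc - (σ.m .Y s u k 0 + σ.m .Y s v k 0) ≤ σ'.m .best s u v 0

/-- A bound for the time for one pair of pivots. -/
def pairTime (n T : ℕ) : ℕ :=
  32 * n * 6 + 32 * n * (32 * n) * 21 + 2 * n * (2 * n * 8 + 2) + T + 8

/-- For a fresh memory of the subroutine, one call accounts for all triples `u`, `v`, `k` such that
`w` covers `u`, `k` and `w'` covers `v`, `k`. -/
theorem pivotPair_spec {T : ℕ} (hA : SolvesAPSP K.prog K.w₀ (4 * (8 * π.n)) (16 * π.nc) T)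
    (hE : Env K π dd s rho σ) (hP : π.Fits K dd) {w w' : ℕ}
    (ht : σ.v .t = t) (ht' : σ.v .t' = t') (htn : t < 2 * π.n) (htn' : t' < 2 * π.n)
    (hp : σ.m .piv rho t 0 0 = w) (hp' : σ.m .piv rho t' 0 0 = w') (hw : w < 2 * π.n)
    (hw' : w' < 2 * π.n) (h₀ : ∀ x, σ.m .ora rho t t' x = 0) :
    WP K pivotPair (fun σ' τ =>
      Improves (2 * π.n) s (pairValue π.D (16 * π.nc) fun u k => σ.m .Y s u k 0) σ σ' ∧
      (∀ a b c, ¬ (a = rho ∧ b = t ∧ c = t') → σ'.m .ora a b c = σ.m .ora a b c) ∧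
      PairDone π s rho σ σ' w w' ∧ τ ≤ pairTime π.n T) σ := by
  classical
  have hr := hP.radix
  have hn := Nat.le_mul_self π.n
  have hr2 := Cfg.radix_le K
  have hs := hE.s_lt
  have hrho := hE.rho_lt
  have hnpos := hP.n_pos
  have hw₀ : 2 ^ K.w₀ - 1 + 1 = 2 ^ K.w₀ := Nat.sub_add_cancel Nat.one_le_two_pow
  have hw₀' : 2 ^ K.w₀ ≤ 2 ^ K.l := Nat.pow_le_pow_right two_pos K.w₀_le
  simp only [pivotPair, wp_seq, wp_assign, wp_put, Expr.Safe, Expr.eval, BinOp.eval, BinOp.Safe,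
    hE.consts.radix, hE.consts.N, hE.consts.mask, hE.rho_eq, ht, ht', hp, hp', hw₀, true_and,
    and_true, St.set_v, St.set_m, reduceCtorEq, if_false, if_true]
  refine ⟨by omega, by omega, by omega, by omega, ?_⟩
  set σ₁ := ((σ.set .p w).set .p' w').put .ora rho t t' 0 (32 * π.n % 2 ^ K.w₀) with hσ₁
  have E₁ : Env K π dd s rho σ₁ := hE.of_eq (fun x hx => by
      simp only [hσ₁, St.set_v, St.put_v]
      rw [if_neg, if_neg] <;> · rintro rfl; revert hx; decide) (fun A hA => by
      rw [hσ₁, St.put_m_ne]; · rfl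
      rintro rfl; revert hA; decide)
  refine (writeWeights_spec E₁ hP (t := t) (t' := t') (by simpa [hσ₁]) (by simpa [hσ₁])
    (by simp [hσ₁, ht]) (by simp [hσ₁, ht']) htn htn').mono ?_
  rintro σ₂ t₂ f₂ ⟨O₂, c₂⟩
  have E₂ := E₁.frame f₂ rfl
  have p₂ : σ₂.v .p = w := by rw [f₂.v _ rfl]; simp [hσ₁]
  have p₂' : σ₂.v .p' = w' := by rw [f₂.v _ rfl]; simp [hσ₁]
  have tt₂ : σ₂.v .t = t := by rw [f₂.v _ rfl]; simp [hσ₁, ht]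
  have tt₂' : σ₂.v .t' = t' := by rw [f₂.v _ rfl]; simp [hσ₁, ht']
  refine (writeEdges_spec E₂ hP (t := t) (t' := t') (by simpa [p₂]) (by simpa [p₂'])
    tt₂ tt₂' htn htn' (fun _ _ => Iff.rfl)).mono ?_
  rintro σ₃ t₃ f₃ ⟨O₃, c₃⟩
  have E₃ := E₂.frame f₃ rfl
  have tt₃ : σ₃.v .t = t := by rw [f₃.v _ rfl, tt₂]
  have tt₃' : σ₃.v .t' = t' := by rw [f₃.v _ rfl, tt₂']
  have m₁ : ∀ A, A ≠ .ora → σ₁.m A = σ.m A := fun A hA => by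
    rw [hσ₁, St.put_m_ne _ _ _ _ _ _ hA]; rfl
  have m₂ : ∀ A, A ≠ .ora → σ₂.m A = σ.m A := fun A hA => by
    rw [f₂.m A (by simp [writeWeights, Stmt.writesArr, Ne.symm hA]), m₁ A hA]
  have m₃ : ∀ A, A ≠ .ora → σ₃.m A = σ.m A := fun A hA => by
    rw [f₃.m A (by simp [writeEdges, edge, incidence, Stmt.writesArr, Ne.symm hA]), m₂ A hA]
  have hIncA : ∀ σ' : St, (∀ A, A ≠ Arr.ora → σ'.m A = σ.m A) →
      Inc π s rho σ' = Inc π s rho σ := fun σ' h => Inc.congr fun A hA => by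
    refine h A ?_
    rintro rfl; revert hA; decide
  rw [p₂, p₂', hIncA σ₂ m₂] at O₃
  simp only [hσ₁, St.put_v, St.set_v, reduceCtorEq, if_true, if_false] at O₂
  rw [← hσ₁, m₁ .val (by decide)] at O₂
  -- the run of the subroutine
  obtain ⟨S', τ, hexec, hholds, hτ⟩ := hA
    (layerGraph (4 * (8 * π.n)) π.D (8 * π.n) (Inc π s rho σ w) (Inc π s rho σ w'))
    (fun x => (layerWeight π.D (8 * π.n) (16 * π.nc) (fun r => σ.m .val s w r 0)
        (fun r => σ.m .val s w' r 0) x : ℤ)) (fun v => by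
          rw [Nat.abs_cast]; exact_mod_cast layerWeight_le _)
  have hmem : ∀ x : BitVec K.w₀, ((init K.w₀ (graphInput
      (layerGraph (4 * (8 * π.n)) π.D (8 * π.n) (Inc π s rho σ w) (Inc π s rho σ w')).Adj
      (fun x => (layerWeight π.D (8 * π.n) (16 * π.nc) (fun r => σ.m .val s w r 0)
        (fun r => σ.m .val s w' r 0) x : ℤ)))).mem x).toNat =
      σ₃.m .ora rho t t' x.toNat := by
    intro x
    refine (graphInput_getD K.w₀ (4 * (8 * π.n)) (fun i j =>
      LayerEdge π.D (8 * π.n) (Inc π s rho σ w) (Inc π s rho σ w') i j ∨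
      LayerEdge π.D (8 * π.n) (Inc π s rho σ w) (Inc π s rho σ w') j i) _ x.toNat).trans ?_
    rw [show 4 * (8 * π.n) = 32 * π.n by omega, O₃, O₂]
    simp only [true_and, and_self]
    by_cases h0 : x.toNat = 0
    · rw [if_pos h0, if_neg (by omega), if_neg (by omega), h0, hσ₁]
      simp
    · rw [if_neg h0]
      by_cases h1 : x.toNat < 32 * π.n + 1
      · rw [if_pos h1, if_neg (by omega), if_pos (by omega)]
      · rw [if_neg h1]
        by_cases h2 : x.toNat < 32 * π.n * (32 * π.n) + 32 * π.n + 1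
        · rw [if_pos h2, if_pos (show 32 * π.n + 1 ≤ x.toNat ∧
            x.toNat < 32 * π.n * (32 * π.n) + 32 * π.n + 1 from ⟨by omega, h2⟩)]
        · rw [if_neg h2, if_neg (by omega), if_neg (by omega), hσ₁]
          simp [h₀, h0]
  have hcall := Big.call (K := K) (A := .ora) (a := .var .rho) (b := .var .t) (c := .var .t')
    (σ := σ₃) (by
      simp only [Expr.Safe, Expr.eval, E₃.consts.radix, E₃.rho_eq, tt₃, tt₃', true_and, and_true]
      omega) E₃.consts.mask (s := init K.w₀ _) rfl (by
      simp only [Expr.eval, E₃.rho_eq, tt₃, tt₃']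
      exact hmem) hexec
  simp only [Expr.eval, E₃.rho_eq, tt₃, tt₃'] at hcall
  set σ₄ : St := ⟨σ₃.v, fun A' a' b' c' d' =>
    if A' = .ora ∧ a' = rho ∧ b' = t ∧ c' = t' ∧ d' < 2 ^ K.w₀
    then (S'.mem (BitVec.ofNat K.w₀ d')).toNat else σ₃.m A' a' b' c' d'⟩ with hσ₄
  refine ⟨σ₄, τ + 1, hcall, ?_⟩
  have m₄ : ∀ A, A ≠ .ora → σ₄.m A = σ.m A := fun A hA => by
    rw [← m₃ A hA]
    funext a b c d
    simp [hσ₄, hA]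
  have E₄ : Env K π dd s rho σ₄ := E₃.frame hcall.frame rfl
  have p₄ : σ₄.v .p = w := by rw [← p₂, ← f₃.v _ rfl]
  have p₄' : σ₄.v .p' = w' := by rw [← p₂', ← f₃.v _ rfl]
  have hO : HoldsDist K π s rho t t' w w' σ₄ := by
    refine holdsDist_of_holds E₄ hP hw hw' (S := S') ?_ ?_
    · rw [hIncA σ₄ m₄, m₄ .val (by decide)]
      exact hholds
    · intro x hx
      simp [hσ₄, hx]
  refine (collect_spec E₄ hP p₄ p₄' hw hw' tt₃ tt₃' htn htn' hO).mono ?_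
  simp only [m₄ .Y (by decide)]
  rintro σ₅ t₅ f₅ ⟨I₅, B₅, c₅⟩
  refine ⟨(Improves.of_eq (m₄ .best (by decide))).trans I₅, ?_, ?_, ?_⟩
  · intro a b c habc
    funext x
    rw [f₅.m .ora rfl]
    have e4 : σ₄.m .ora a b c x = σ₃.m .ora a b c x := by
      simp only [hσ₄]
      rw [if_neg (by tauto)]
    rw [e4, O₃, if_neg (by tauto), O₂, if_neg (by tauto), hσ₁, St.put_m_self, if_neg (by tauto)]
    rfl
  · intro u hu v hv k hk r r' hr hr' hYu hYv h1 h2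
    have hdd : ∀ w < 2 * π.n, ∀ r ≤ σ.m .nd s w 0 0, r * π.D + k < 8 * π.n := by
      intro w hw r hr
      refine lt_of_lt_of_le ?_ hP.dd_le
      exact mul_add_lt hk (lt_of_le_of_lt hr (hE.nd_lt w hw))
    have hd : ∀ r, (r * π.D + k) / π.D = r := fun r => layer_div hP.D_pos r hk
    have hm : ∀ r, (r * π.D + k) % π.D = k := fun r => layer_mod r hk
    have := B₅ u hu v hv (r * π.D + k) (r' * π.D + k) ⟨hdd w hw r hr, hdd w' hw' r' hr', ?_, ?_, ?_⟩
    · simpa only [hm] using this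
    · rw [hIncA σ₄ m₄, Inc, hd, hm]
      exact ⟨hYu, h1⟩
    · rw [hm, hm]
    · rw [hIncA σ₄ m₄, Inc, hd, hm]
      exact ⟨hYv, h2⟩
  · unfold pairTime
    omega

theorem PairDone.mono {σ σ' σ'' : St} {w w' m : ℕ} {F : ℕ → ℕ → ℕ}
    (h : PairDone π s rho σ σ' w w') (hi : Improves m s F σ' σ'') :
    PairDone π s rho σ σ'' w w' := fun u hu v hv k hk r r' hr hr' h1 h2 h3 h4 =>
  (h u hu v hv k hk r r' hr hr' h1 h2 h3 h4).trans (hi.mono _ _)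

theorem PairDone.congr {σ₁ σ σ' : St} {w w' : ℕ} (h : PairDone π s rho σ₁ σ' w w')
    (hm : ∀ A ∈ [Arr.Y, .val, .H, .nd], σ₁.m A = σ.m A) : PairDone π s rho σ σ' w w' := by
  unfold PairDone at h ⊢
  rwa [hm .Y (by simp), hm .val (by simp), hm .H (by simp), hm .nd (by simp)] at h

theorem pivotPairs_spec {T : ℕ} (hA : SolvesAPSP K.prog K.w₀ (4 * (8 * π.n)) (16 * π.nc) T)
    (hE : Env K π dd s rho σ) (hP : π.Fits K dd) {R : ℕ} (hR : σ.v .R = R) (hRg : R ≤ π.g)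
    (hpiv : ∀ i < R, σ.m .piv rho i 0 0 < 2 * π.n) (h₀ : ∀ t t' x, σ.m .ora rho t t' x = 0) :
    WP K pivotPairs (fun σ' τ =>
      Improves (2 * π.n) s (pairValue π.D (16 * π.nc) fun u k => σ.m .Y s u k 0) σ σ' ∧
      (∀ ρ ≠ rho, σ'.m .ora ρ = σ.m .ora ρ) ∧
      (∀ i < R, ∀ j < R,
        PairDone π s rho σ σ' (σ.m .piv rho i 0 0) (σ.m .piv rho j 0 0)) ∧
      τ ≤ π.g * (π.g * (pairTime π.n T + 1) + 2) + 1) σ := by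
  have hg := hP.g_le
  set F := pairValue π.D (16 * π.nc) fun u k => σ.m .Y s u k 0 with hF
  set P := pairTime π.n T
  have hm : ∀ {σ' : St}, (∀ A, pivotPair.writesArr A = false → σ'.m A = σ.m A) →
      ∀ A ∈ [Arr.Y, .val, .H, .nd], σ'.m A = σ.m A := fun h A hA => by
    simp only [List.mem_cons, List.not_mem_nil, or_false] at hA
    rcases hA with rfl | rfl | rfl | rfl <;> exact h _ rfl
  refine WP.for_le (k := R) (fun i σ' => Improves (2 * π.n) s F σ σ' ∧
      (∀ ρ ≠ rho, σ'.m .ora ρ = σ.m .ora ρ) ∧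
      (∀ t ≥ i, ∀ t' x, σ'.m .ora rho t t' x = 0) ∧
      (∀ t < i, ∀ j < R,
        PairDone π s rho σ σ' (σ.m .piv rho t 0 0) (σ.m .piv rho j 0 0)))
    (R * (P + 1) + 1) trivial hR ⟨.refl .., fun _ _ => rfl, fun _ _ => h₀ _, by simp⟩ ?_ ?_
  · rintro t ht σ₁ f₁ ⟨I₁, A₁, O₁, D₁⟩
    have E₁ := (hE.frame f₁ rfl).set .t t rfl
    refine WP.for_le (k := R) (fun j σ' => Improves (2 * π.n) s F σ σ' ∧
      (∀ ρ ≠ rho, σ'.m .ora ρ = σ.m .ora ρ) ∧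
      (∀ a b, (t < a ∨ a = t ∧ j ≤ b) → ∀ x, σ'.m .ora rho a b x = 0) ∧
      (∀ i < t, ∀ j < R,
        PairDone π s rho σ σ' (σ.m .piv rho i 0 0) (σ.m .piv rho j 0 0)) ∧
      (∀ i < j, PairDone π s rho σ σ' (σ.m .piv rho t 0 0) (σ.m .piv rho i 0 0)))
      P trivial ?_ ⟨⟨I₁.mono, I₁.le, I₁.other⟩, A₁, ?_, fun i hi j hj => ?_, by simp⟩ ?_ ?_
    · simp only [Expr.eval, St.set_v, reduceCtorEq, if_false]
      rw [f₁.v .R rfl, hR]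
    · intro a b hab x
      exact O₁ a (by omega) b x
    · exact (D₁ i hi j hj).mono (m := 0) (F := F) (.of_eq rfl)
    · rintro t' ht' σ₂ f₂ ⟨I₂, A₂, O₂, D₂, B₂⟩
      have E₂ := (E₁.frame f₂ rfl).set .t' t' rfl
      have em : ∀ A, pivotPair.writesArr A = false → σ₂.m A = σ.m A := fun A hA => by
        rw [f₂.m A hA, St.set_m, f₁.m A hA]
      refine (pivotPair_spec hA E₂ hP (t := t) (t' := t') (w := σ.m .piv rho t 0 0)
        (w' := σ.m .piv rho t' 0 0) ?_ (by simp) (by omega) (by omega) ?_ ?_ (hpiv t ht)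
        (hpiv t' ht') ?_).mono ?_
      · simp only [St.set_v, reduceCtorEq, if_false]
        rw [f₂.v .t rfl]; simp
      · rw [St.set_m, em .piv rfl]
      · rw [St.set_m, em .piv rfl]
      · exact O₂ t t' (Or.inr ⟨rfl, le_rfl⟩)
      · simp only [St.set_m, em .Y rfl]
        rintro σ₃ τ f₃ ⟨I₃, O₃, D₃, c₃⟩
        have I₃' : Improves (2 * π.n) s F σ₂ σ₃ := ⟨I₃.mono, I₃.le, I₃.other⟩
        refine ⟨⟨I₂.trans I₃', fun ρ hρ => ?_, fun a b hab x => ?_, fun i hi j hj => ?_,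
          fun i hi => ?_⟩, c₃⟩
        · rw [← A₂ ρ hρ]
          funext b c
          exact O₃ ρ b c (by tauto)
        · rw [O₃ rho a b (by omega)]
          exact O₂ a b (by omega) x
        · exact (D₂ i hi j hj).mono I₃'
        · rcases Nat.lt_succ_iff_lt_or_eq.1 hi with hi | rfl
          · exact (B₂ i hi).mono I₃'
          · exact D₃.congr (hm em)
    · rintro σ₂ τ f₂ ⟨I₂, A₂, O₂, D₂, B₂⟩ c₂
      refine ⟨⟨I₂, A₂, fun a ha b x => O₂ a b (by omega) x, fun i hi => ?_⟩, by omega⟩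
      rcases Nat.lt_succ_iff_lt_or_eq.1 hi with hi | rfl
      · exact D₂ i hi
      · exact B₂
  · rintro σ₁ τ f₁ ⟨I₁, A₁, O₁, D₁⟩ c₁
    refine ⟨I₁, A₁, D₁, c₁.trans ?_⟩
    exact Nat.add_le_add_right (Nat.mul_le_mul hRg
      (Nat.add_le_add_right (Nat.mul_le_mul_right (P + 1) hRg) 2)) 1

end RowWeight

end WordRAM

namespace WordRAM

namespace RowWeight

/-! ### Guesses from the coarser scale, and one round -/

theorem exists_eq_pairValue {D M : ℕ} {Y : ℕ → ℕ → ℕ} {u v : ℕ} (h : pairValue D M Y u v ≠ 0) :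
    ∃ k < D, Y u k ≠ 0 ∧ Y v k ≠ 0 ∧ pairValue D M Y u v = M - (Y u k + Y v k) := by
  have hD : (Finset.range D).Nonempty := by
    rw [Finset.nonempty_range_iff]
    rintro rfl
    simp [pairValue] at h
  obtain ⟨k, hk, hs⟩ := Finset.exists_mem_eq_sup (Finset.range D) hD
    fun k => if Y u k = 0 ∨ Y v k = 0 then 0 else M - (Y u k + Y v k)
  rw [pairValue, hs] at h
  have h0 : ¬ (Y u k = 0 ∨ Y v k = 0) := fun h' => h (if_pos h')
  rw [not_or] at h0
  refine ⟨k, Finset.mem_range.1 hk, h0.1, h0.2, ?_⟩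
  rw [pairValue, hs, if_neg (by tauto)]

/-- One step of the scaling: if the entries of `Y'` are the halves of the entries of `Y`, rounded up,
then a minimum for `Y` is one of three numbers that the minimum for `Y'` determines. -/
theorem exists_pairValue_eq {D M B : ℕ} {Y Y' : ℕ → ℕ → ℕ} {u v : ℕ}
    (hY' : ∀ k < D, Y' u k = (Y u k + 1) / 2 ∧ Y' v k = (Y v k + 1) / 2)
    (hB : ∀ k < D, Y u k ≤ B ∧ Y v k ≤ B) (hM : 2 * B + 2 < M) (h : pairValue D M Y u v ≠ 0) :
    pairValue D M Y' u v ≠ 0 ∧ ∃ k < D, Y u k ≠ 0 ∧ Y v k ≠ 0 ∧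
      pairValue D M Y u v = M - (Y u k + Y v k) ∧
      ∃ e < 3, Y u k + Y v k + 2 = 2 * (M - pairValue D M Y' u v) + e := by
  obtain ⟨k, hk, hu, hv, hval⟩ := exists_eq_pairValue h
  have h1 := le_pairValue (D := D) (M := M) (Y := Y') (u := u) (v := v) hk
    (by have := (hY' k hk).1; omega) (by have := (hY' k hk).2; omega)
  have hk1 := hY' k hk
  have hk2 := hB k hk
  have h' : pairValue D M Y' u v ≠ 0 := by omega
  obtain ⟨k', hk', hu', hv', hval'⟩ := exists_eq_pairValue h'
  have hk1' := hY' k' hk'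
  have hk2' := hB k' hk'
  have h2 := le_pairValue (D := D) (M := M) (Y := Y) (u := u) (v := v) hk'
    (by omega) (by omega)
  refine ⟨h', k, hk, hu, hv, hval, Y u k + Y v k + 2 - 2 * (M - pairValue D M Y' u v), ?_, ?_⟩
  · omega
  · omega

variable {K : Cfg} {π : Pars} {dd s rho : ℕ} {σ : St}

/-- The constants and the indices of the rows at all scales. -/
structure Data (K : Cfg) (π : Pars) (dd : ℕ) (σ : St) : Prop where
  consts : Consts K π σ
  Y_le : ∀ s u k, σ.m .Y s u k 0 ≤ 2 * π.nc + 1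
  row : ∀ s < π.Sc, ∀ u < 2 * π.n, RowIndex π.D (fun k => σ.m .Y s u k 0)
    (fun x => σ.m .tab s u x 0) (fun r => σ.m .val s u r 0) (fun r => σ.m .cnt s u r 0)
    (fun r i => σ.m .lst s u r i) (σ.m .nd s u 0 0)
  nd_lt : ∀ s < π.Sc, ∀ u < 2 * π.n, σ.m .nd s u 0 0 < dd

/-- The arrays of `Data`. -/
def dataArrs : List Arr := [.Y, .tab, .val, .cnt, .lst, .nd]

theorem Data.of_eq {σ' : St} (h : Data K π dd σ) (hv : ∀ x ∈ fixedVars, σ'.v x = σ.v x)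
    (hm : ∀ A ∈ dataArrs, σ'.m A = σ.m A) : Data K π dd σ' := by
  simp only [dataArrs, List.mem_cons, List.not_mem_nil, or_false, forall_eq_or_imp,
    forall_eq] at hm
  obtain ⟨h1, h2, h3, h4, h5, h6⟩ := hm
  refine ⟨h.consts.of_eq hv, ?_, ?_, ?_⟩
  · rw [h1]; exact h.Y_le
  · rw [h1, h2, h3, h4, h5, h6]; exact h.row
  · rw [h6]; exact h.nd_lt

theorem Data.frame {σ' : St} {c : Stmt} (h : Data K π dd σ) (hF : Frame c σ σ')
    (hc : (fixedVars.any c.writesVar || dataArrs.any c.writesArr) = false) : Data K π dd σ' := by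
  simp only [Bool.or_eq_false_iff, List.any_eq_false, Bool.not_eq_true] at hc
  exact h.of_eq (fun x hx => hF.v x (hc.1 x hx)) fun A hA => hF.m A (hc.2 A hA)

theorem Data.set (h : Data K π dd σ) (x : Var) (z : ℕ)
    (hx : (fixedVars.all fun y => !decide (y = x)) = true) : Data K π dd (σ.set x z) :=
  h.of_eq (fun y hy => by
    have : y ≠ x := by simpa using List.all_eq_true.1 hx y hy
    simp [this]) fun _ _ => rfl

theorem guess_spec (hd : Data K π dd σ) (hP : π.Fits K dd) {e : ℕ} (hs : σ.v .s = s)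
    (hs' : s < π.Sc) (hrho : σ.v .rho = rho) (hrho' : rho < 3 * π.Sc) (he : σ.v .e = e)
    (he' : e < 3)
    (hb : ∀ u < 2 * π.n, ∀ v < 2 * π.n, σ.m .best (s + 1) u v 0 ≤ 16 * π.nc) :
    WP K guess (fun σ' t => (∀ u < 2 * π.n, ∀ v < 2 * π.n, σ'.m .H rho u v 0 =
      2 * (16 * π.nc - σ.m .best (s + 1) u v 0) + e) ∧ t ≤ 2 * π.n * (2 * π.n * 2 + 2) + 1) σ := by
  have hr := hP.radix
  have hn := Nat.le_mul_self π.n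
  have hr2 := Cfg.radix_le K
  refine WP.for_le (k := 2 * π.n) (fun i σ' => ∀ u < i, ∀ v < 2 * π.n, σ'.m .H rho u v 0 =
      2 * (16 * π.nc - σ.m .best (s + 1) u v 0) + e) (2 * π.n * 2 + 1) trivial hd.consts.m
      (by simp) ?_ ?_
  · rintro u hu σ₁ f₁ h₁
    have d₁ := (hd.frame f₁ rfl).set .u u rfl
    refine WP.for_le (k := 2 * π.n) (fun i σ' => (∀ u' < u, ∀ v < 2 * π.n, σ'.m .H rho u' v 0 =
      2 * (16 * π.nc - σ.m .best (s + 1) u' v 0) + e) ∧ ∀ v < i, σ'.m .H rho u v 0 =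
      2 * (16 * π.nc - σ.m .best (s + 1) u v 0) + e) 1 trivial d₁.consts.m
      ⟨h₁, by simp⟩ ?_ ?_
    · rintro v hv σ₂ f₂ ⟨h₂, h₂'⟩
      have c₂ := ((d₁.frame f₂ rfl).set .v v rfl).consts
      have ev : ∀ x, guess.writesVar x = false → σ₂.v x = σ.v x := fun x hx => by
        have hx' := hx
        simp only [guess, Stmt.writesVar, Bool.or_eq_false_iff, decide_eq_false_iff_not] at hx'
        rw [f₂.v x (by simp [guess, Stmt.writesVar, hx']), St.set_v, if_neg (Ne.symm hx'.1),
          f₁.v x hx]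
      have eu : σ₂.v .u = u := by rw [f₂.v .u rfl]; simp
      have eb : σ₂.m .best = σ.m .best := by rw [f₂.m .best rfl, St.set_m, f₁.m .best rfl]
      have hbuv := hb u hu v hv
      simp only [wp_put, Expr.Safe, Expr.eval, BinOp.eval, BinOp.Safe, c₂.radix, c₂.M, ev .s rfl,
        ev .rho rfl, ev .e rfl, eu, eb, hs, hrho, he, true_and, and_true, St.set_v, St.set_m,
        reduceCtorEq, if_false, if_true, St.put_m_self]
      refine ⟨by omega, by omega, ⟨fun u' hu' v' hv' => ?_, fun v' hv' => ?_⟩, le_rfl⟩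
      · rw [if_neg (by omega)]
        exact h₂ u' hu' v' hv'
      · split_ifs with h
        · rw [h]
        · exact h₂' v' (by omega)
    · rintro σ₂ t₂ _ ⟨h₂, h₂'⟩ c₂
      refine ⟨fun u' hu' => ?_, by omega⟩
      rcases Nat.lt_succ_iff_lt_or_eq.1 hu' with hu' | rfl
      · exact h₂ u' hu'
      · exact h₂'
  · intro σ₁ t₁ _ h₁ c₁
    exact ⟨h₁, by omega⟩

/-- A bound for the time of one round. -/
def roundTime (π : Pars) (dd T : ℕ) : ℕ :=
  2 * π.n * (2 * π.n * 2 + 2) + 1 +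
    (2 * π.n * (4 * π.n * (10 * dd + 2) + 11 * (2 * π.n * π.D / π.g) + 8) + 2) +
    (π.g * (π.g * (pairTime π.n T + 1) + 2) + 1)

/-- In the round of the guess number `e`, all triples that meet this guess are accounted for.  The
guess is required for `u`, `v` and for `v`, `u`, because both places have to be covered or searched. -/
theorem round_spec {T : ℕ} (hA : SolvesAPSP K.prog K.w₀ (4 * (8 * π.n)) (16 * π.nc) T)
    (hd : Data K π dd σ) (hP : π.Fits K dd) {e : ℕ} (hs : σ.v .s = s)
    (hs' : s < π.Sc) (hrho : σ.v .rho = rho) (hrho' : rho < 3 * π.Sc) (he : σ.v .e = e)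
    (he' : e < 3)
    (hb : ∀ u < 2 * π.n, ∀ v < 2 * π.n, σ.m .best (s + 1) u v 0 ≤ 16 * π.nc)
    (hcov : ∀ u r, σ.m .cov rho u r 0 = 0) (hora : ∀ t t' x, σ.m .ora rho t t' x = 0) :
    WP K round (fun σ' t =>
      let Y := fun u k => σ.m .Y s u k 0
      Improves (2 * π.n) s (pairValue π.D (16 * π.nc) Y) σ σ' ∧
      (∀ ρ ≠ rho, σ'.m .cov ρ = σ.m .cov ρ) ∧ (∀ ρ ≠ rho, σ'.m .ora ρ = σ.m .ora ρ) ∧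
      (∀ u < 2 * π.n, ∀ v < 2 * π.n, ∀ k < π.D, Y u k ≠ 0 → Y v k ≠ 0 →
        Y u k + Y v k + 2 = 2 * (16 * π.nc - σ.m .best (s + 1) u v 0) + e →
        Y u k + Y v k + 2 = 2 * (16 * π.nc - σ.m .best (s + 1) v u 0) + e →
        16 * π.nc - (Y u k + Y v k) ≤ σ'.m .best s u v 0) ∧
      t ≤ roundTime π dd T) σ := by
  rw [round, wp_seq]
  refine (guess_spec hd hP hs hs' hrho hrho' he he' hb).mono ?_
  rintro σ₁ t₁ f₁ ⟨H₁, c₁⟩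
  have d₁ := hd.frame f₁ rfl
  have E₁ : Env K π dd s rho σ₁ := by
    refine ⟨d₁.consts, by rw [f₁.v _ rfl, hs], hs', by rw [f₁.v _ rfl, hrho], hrho', d₁.Y_le s,
      d₁.row s hs', d₁.nd_lt s hs', fun u hu v hv => ?_⟩
    rw [H₁ u hu v hv]
    omega
  rw [wp_seq]
  refine (cover_spec E₁ hP (by rw [f₁.m _ rfl]; exact hcov)).mono ?_
  simp only [f₁.m .Y rfl]
  set Y := fun u k => σ.m .Y s u k 0 with hY
  set F := pairValue π.D (16 * π.nc) Y with hF
  rintro σ₂ t₂ f₂ ⟨I₂, C₂, R₂, P₂, W₂, c₂⟩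
  have E₂ := E₁.frame f₂ rfl
  have hY₂ : σ₂.m .Y = σ.m .Y := by rw [f₂.m _ rfl, f₁.m _ rfl]
  refine (pivotPairs_spec hA E₂ hP rfl R₂ P₂ (by rw [f₂.m _ rfl, f₁.m _ rfl]; exact hora)).mono ?_
  simp only [hY₂]
  rintro σ₃ t₃ f₃ ⟨I₃, O₃, D₃, c₃⟩
  have I₁ : Improves (2 * π.n) s F σ σ₁ := .of_eq (f₁.m _ rfl)
  refine ⟨(I₁.trans I₂).trans I₃, fun ρ hρ => ?_, fun ρ hρ => ?_, ?_, ?_⟩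
  · rw [f₃.m _ rfl, C₂ ρ hρ, f₁.m _ rfl]
  · rw [O₃ ρ hρ, f₂.m _ rfl, f₁.m _ rfl]
  · intro u hu v hv k hk hYu hYv h h'
    rcases W₂ u hu v hv k hk hYu hYv (by rw [H₁ u hu v hv, ← h]) with hD | ⟨i, hi, r, hr, hir⟩
    · exact (hD hYu hYv).1.trans (I₃.mono _ _)
    rcases W₂ v hv u hu k hk hYv hYu (by rw [H₁ v hv u hu, ← h']; omega) with
      hD | ⟨j, hj, r', hr', hjr⟩
    · rw [add_comm (Y u k)]
      exact (hD hYv hYu).2.trans (I₃.mono _ _)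
    have := D₃ i hi j hj u hu v hv k hk r r' hr hr'
    rw [hY₂] at this
    exact this hYu hYv hir hjr
  · unfold roundTime
    omega

end RowWeight

end WordRAM

namespace WordRAM

namespace RowWeight

/-! ### All scales -/

variable {K : Cfg} {π : Pars} {dd : ℕ} {σ : St}

/-- The rows at the scale `s` of the state `σ`. -/
def rows (σ : St) (s u k : ℕ) : ℕ := σ.m .Y s u k 0

/-- The entries of `best` at the scale `s` are correct wherever the minimum is finite.  Where it is
infinite, they do not matter, because then it is infinite at the finer scales, too. -/
def Exact (π : Pars) (Y : ℕ → ℕ → ℕ → ℕ) (s : ℕ) (σ : St) : Prop :=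
  ∀ u < 2 * π.n, ∀ v < 2 * π.n, σ.m .best s u v 0 ≤ 16 * π.nc ∧
    (pairValue π.D (16 * π.nc) (Y s) u v ≠ 0 →
      σ.m .best s u v 0 = pairValue π.D (16 * π.nc) (Y s) u v)

/-- After all scales, `best` at the scale `0` holds the values of all pairs of rows.  At each scale
`best` never exceeds the true value, and one of the three guesses attains it. -/
theorem scales_spec {T : ℕ} (hA : SolvesAPSP K.prog K.w₀ (4 * (8 * π.n)) (16 * π.nc) T)
    (hd : Data K π dd σ) (hP : π.Fits K dd) (hSc : 0 < π.Sc)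
    (hhalf : ∀ s < π.Sc, ∀ u < 2 * π.n, ∀ k < π.D,
      rows σ (s + 1) u k = (rows σ s u k + 1) / 2)
    (htop : Exact π (rows σ) π.Sc σ)
    (hbest : ∀ s < π.Sc, ∀ u v, σ.m .best s u v 0 = 0)
    (hcov : ∀ ρ u r, σ.m .cov ρ u r 0 = 0) (hora : ∀ ρ t t' x, σ.m .ora ρ t t' x = 0) :
    WP K scales (fun σ' t => (∀ u < 2 * π.n, ∀ v < 2 * π.n,
      σ'.m .best 0 u v 0 = pairValue π.D (16 * π.nc) (rows σ 0) u v) ∧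
      t ≤ π.Sc * (3 * (roundTime π dd T + 2) + 3) + 1) σ := by
  have hr := hP.radix
  have hn := Nat.le_mul_self π.n
  have hr2 := Cfg.radix_le K
  set Y := rows σ with hY
  set V := fun s => pairValue π.D (16 * π.nc) (Y s) with hV
  have hYeq : ∀ s, (fun u k => σ.m .Y s u k 0) = Y s := fun _ => rfl
  refine WP.for_le (k := π.Sc) (fun i σ' => Exact π Y (π.Sc - i) σ' ∧
      (i = 0 ∨ ∀ u < 2 * π.n, ∀ v < 2 * π.n, σ'.m .best (π.Sc - i) u v 0 = V (π.Sc - i) u v) ∧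
      (∀ s < π.Sc - i, ∀ u v, σ'.m .best s u v 0 = 0) ∧
      (∀ ρ, 3 * i ≤ ρ → ∀ u r, σ'.m .cov ρ u r 0 = 0) ∧
      (∀ ρ, 3 * i ≤ ρ → ∀ t t' x, σ'.m .ora ρ t t' x = 0))
    (3 * (roundTime π dd T + 2) + 2) trivial hd.consts.Sc
    ⟨htop, Or.inl rfl, hbest, fun ρ _ => hcov ρ, fun ρ _ => hora ρ⟩ ?_ ?_
  · rintro i hi σ₁ f₁ ⟨X₁, -, B₁, C₁, O₁⟩
    have d₁ := (hd.frame f₁ rfl).set .stage i rfl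
    set s := π.Sc - 1 - i with hs
    have hs1 : s + 1 = π.Sc - i := by omega
    have hlt : s < π.Sc := by omega
    have Y₁ : σ₁.m .Y = σ.m .Y := f₁.m _ rfl
    rw [wp_seq, wp_assign]
    simp only [Expr.Safe, Expr.eval, BinOp.eval, BinOp.Safe, d₁.consts.Sc, true_and, St.set_v,
      reduceCtorEq, if_false, if_true, ← hs]
    refine ⟨by omega, ?_⟩
    have d₁' := d₁.set .s s rfl
    refine WP.for_le (k := 3) (fun e σ' =>
      (∀ u < 2 * π.n, ∀ v < 2 * π.n, σ'.m .best s u v 0 ≤ V s u v) ∧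
      (∀ s' ≠ s, σ'.m .best s' = σ₁.m .best s') ∧
      (∀ ρ, 3 * i + e ≤ ρ → ∀ u r, σ'.m .cov ρ u r 0 = 0) ∧
      (∀ ρ, 3 * i + e ≤ ρ → ∀ t t' x, σ'.m .ora ρ t t' x = 0) ∧
      ∀ e' < e, ∀ u < 2 * π.n, ∀ v < 2 * π.n, ∀ k < π.D, Y s u k ≠ 0 → Y s v k ≠ 0 →
        Y s u k + Y s v k + 2 = 2 * (16 * π.nc - σ₁.m .best (s + 1) u v 0) + e' →
        Y s u k + Y s v k + 2 = 2 * (16 * π.nc - σ₁.m .best (s + 1) v u 0) + e' →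
        16 * π.nc - (Y s u k + Y s v k) ≤ σ'.m .best s u v 0)
      (roundTime π dd T + 1) ?_ rfl ⟨?_, fun _ _ => rfl, C₁, O₁, by simp⟩ ?_ ?_
    · simp only [Expr.Safe]; omega
    · intro u hu v hv
      simp only [St.set_m]
      rw [B₁ s (by omega)]
      exact Nat.zero_le _
    · rintro e he σ₂ f₂ ⟨L₂, A₂, C₂, O₂, W₂⟩
      have d₂ := (d₁'.frame f₂ rfl).set .e e rfl
      have es : σ₂.v .s = s := by rw [f₂.v .s rfl]; simp
      have est : σ₂.v .stage = i := by rw [f₂.v .stage rfl]; simp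
      have Y₂ : σ₂.m .Y = σ.m .Y := by rw [f₂.m _ rfl]; exact Y₁
      rw [wp_seq, wp_assign]
      simp only [Expr.Safe, Expr.eval, BinOp.eval, BinOp.Safe, true_and, St.set_v, est,
        reduceCtorEq, if_false, if_true]
      refine ⟨by omega, ?_⟩
      refine (round_spec (s := s) (rho := 3 * i + e) (e := e) hA (d₂.set .rho (3 * i + e) rfl) hP
        (by simpa using es) hlt (by simp) (by omega) (by simp) he ?_ (C₂ _ le_rfl)
        (O₂ _ le_rfl)).mono ?_
      · intro u hu v hv
        simp only [St.set_m]
        rw [A₂ (s + 1) (by omega), hs1]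
        exact (X₁ u hu v hv).1
      · simp only [St.set_m, Y₂, hYeq, A₂ (s + 1) (by omega)]
        rintro σ₃ t₃ f₃ ⟨I₃, C₃, O₃, W₃, c₃⟩
        refine ⟨⟨?_, fun s' hs' => ?_, fun ρ hρ => ?_, fun ρ hρ => ?_, ?_⟩, by omega⟩
        · exact I₃.le L₂
        · rw [I₃.other s' hs', St.set_m, St.set_m, A₂ s' hs']
        · rw [C₃ ρ (by omega)]
          exact C₂ ρ (by omega)
        · rw [O₃ ρ (by omega)]
          exact O₂ ρ (by omega)
        · intro e' he' u hu v hv k hk hYu hYv h h'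
          rcases Nat.lt_succ_iff_lt_or_eq.1 he' with he' | rfl
          · exact (W₂ e' he' u hu v hv k hk hYu hYv h h').trans (I₃.mono _ _)
          · exact W₃ u hu v hv k hk hYu hYv h h'
    · rintro σ₂ t₂ f₂ ⟨L₂, A₂, C₂, O₂, W₂⟩ c₂
      have hfin : ∀ u < 2 * π.n, ∀ v < 2 * π.n, σ₂.m .best s u v 0 = V s u v := by
        intro u hu v hv
        by_cases h0 : V s u v = 0
        · have := L₂ u hu v hv
          omega
        refine le_antisymm (L₂ u hu v hv) ?_
        have hnc := hP.nc_pos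
        obtain ⟨h', k, hk, hYu, hYv, hval, e, he, heq⟩ :=
          exists_pairValue_eq (D := π.D) (M := 16 * π.nc) (B := 2 * π.nc + 1) (Y := Y s)
            (Y' := Y (s + 1)) (u := u) (v := v)
            (fun k hk => ⟨hhalf s hlt u hu k hk, hhalf s hlt v hv k hk⟩)
            (fun k _ => ⟨hd.Y_le s u k, hd.Y_le s v k⟩) (by omega) h0
        have X' := X₁
        rw [← hs1] at X'
        have e1 := (X' u hu v hv).2 h'
        have e2 := (X' v hv u hu).2 (by rwa [pairValue_comm])
        rw [pairValue_comm] at e2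
        change V s u v = _ at hval
        rw [hval]
        exact W₂ e he u hu v hv k hk hYu hYv (by rw [e1, heq]) (by rw [e2, heq])
      have hsi : π.Sc - (i + 1) = s := by omega
      rw [hsi]
      refine ⟨⟨fun u hu v hv => ⟨?_, fun _ => hfin u hu v hv⟩, Or.inr hfin, fun s' hs' u v => ?_,
        fun ρ hρ => C₂ ρ (by omega), fun ρ hρ => O₂ ρ (by omega)⟩, by omega⟩
      · rw [hfin u hu v hv]
        refine Finset.sup_le fun k _ => ?_
        split_ifs <;> omega
      · rw [A₂ s' (by omega)]
        exact B₁ s' (by omega) u v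
  · rintro σ₁ t₁ _ ⟨-, h₁, -⟩ c₁
    rw [Nat.sub_self] at h₁
    exact ⟨h₁.resolve_left (by omega), c₁⟩

theorem startScale_spec (hd : Data K π dd σ) (hP : π.Fits K dd) :
    WP K startScale (fun σ' t => (∀ u < 2 * π.n, ∀ v < 2 * π.n,
      σ'.m .best π.Sc u v 0 = 16 * π.nc - 2) ∧ (∀ s ≠ π.Sc, σ'.m .best s = σ.m .best s) ∧
      t ≤ 2 * π.n * (2 * π.n * 2 + 2) + 1) σ := by
  have hr := hP.radix
  have hn := Nat.le_mul_self π.n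
  have hr2 := Cfg.radix_le K
  have hnc := hP.nc_pos
  refine WP.for_le (k := 2 * π.n) (fun i σ' => (∀ u < i, ∀ v < 2 * π.n,
      σ'.m .best π.Sc u v 0 = 16 * π.nc - 2) ∧ ∀ s ≠ π.Sc, σ'.m .best s = σ.m .best s)
    (2 * π.n * 2 + 1) trivial hd.consts.m ⟨by simp, fun _ _ => rfl⟩ ?_ ?_
  · rintro u hu σ₁ f₁ ⟨h₁, h₁'⟩
    have d₁ := (hd.frame f₁ rfl).set .u u rfl
    refine WP.for_le (k := 2 * π.n) (fun i σ' => ((∀ u' < u, ∀ v < 2 * π.n,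
      σ'.m .best π.Sc u' v 0 = 16 * π.nc - 2) ∧ ∀ s ≠ π.Sc, σ'.m .best s = σ.m .best s) ∧
      ∀ v < i, σ'.m .best π.Sc u v 0 = 16 * π.nc - 2) 1 trivial d₁.consts.m
      ⟨⟨h₁, h₁'⟩, by simp⟩ ?_ ?_
    · rintro v hv σ₂ f₂ ⟨⟨h₂, h₂'⟩, h₂''⟩
      have c₂ := ((d₁.frame f₂ rfl).set .v v rfl).consts
      have eu : σ₂.v .u = u := by rw [f₂.v .u rfl]; simp
      simp only [wp_put, Expr.Safe, Expr.eval, BinOp.eval, BinOp.Safe, c₂.radix, c₂.M, c₂.Sc, eu,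
        true_and, and_true, St.set_v, St.set_m, reduceCtorEq, if_false, if_true, St.put_m_self]
      refine ⟨by omega, by omega, ⟨⟨fun u' hu' v' hv' => ?_, fun s hs => ?_⟩, fun v' hv' => ?_⟩,
        le_rfl⟩
      · rw [if_neg (by omega)]
        exact h₂ u' hu' v' hv'
      · rw [← h₂' s hs]
        funext a b x
        simp [hs]
      · split_ifs with h
        · rfl
        · exact h₂'' v' (by omega)
    · rintro σ₂ t₂ _ ⟨⟨h₂, h₂'⟩, h₂''⟩ c₂
      refine ⟨⟨fun u' hu' => ?_, h₂'⟩, by omega⟩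
      rcases Nat.lt_succ_iff_lt_or_eq.1 hu' with hu' | rfl
      · exact h₂ u' hu'
      · exact h₂''
  · rintro σ₁ t₁ _ ⟨h₁, h₁'⟩ c₁
    exact ⟨h₁, h₁', by omega⟩

end RowWeight

end WordRAM

namespace WordRAM

/-! ### Preparation of the rows at all scales -/

/-- The rule for two nested loops, with an invariant for the arrays. -/
theorem WP.for₂_le {K : Cfg} {σ : St} {Q : St → ℕ → Prop} {x y : Var} {e e' : Expr} {p : Stmt}
    {k k' : ℕ} (I : ℕ → ℕ → (Arr → ℕ → ℕ → ℕ → ℕ → ℕ) → Prop) (T : ℕ) (hxy : x ≠ y)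
    (hp : p.writesVar x = false) (he : e.Safe K σ) (hk : e.eval K.w σ = k)
    (he' : ∀ σ', Frame (.for x e (.for y e' p)) σ σ' → e'.Safe K σ' ∧ e'.eval K.w σ' = k')
    (h₀ : I 0 0 σ.m)
    (step : ∀ i < k, ∀ j < k', ∀ σ', Frame (.for x e (.for y e' p)) σ σ' → σ'.v x = i →
      σ'.v y = j → I i j σ'.m → WP K p (fun σ'' t => I i (j + 1) σ''.m ∧ t ≤ T) σ')
    (row : ∀ i < k, ∀ m, I i k' m → I (i + 1) 0 m)
    (hQ : ∀ σ' t, Frame (.for x e (.for y e' p)) σ σ' → I k 0 σ'.m →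
      t ≤ k * (k' * (T + 1) + 2) + 1 → Q σ' t) :
    WP K (.for x e (.for y e' p)) Q σ := by
  have hset : ∀ {σ' : St} (z : ℕ) (i : ℕ) (w : Var), w = x ∨ w = y →
      Frame (.for x e (.for y e' p)) σ σ' → Frame (.for x e (.for y e' p)) σ (σ'.set w z) := by
    intro σ' z i w hw hf
    refine ⟨fun v hv => ?_, hf.m⟩
    have hv' := hv
    simp only [Stmt.writesVar, Bool.or_eq_false_iff, decide_eq_false_iff_not] at hv'
    rw [St.set_v, if_neg, hf.v v hv]
    rintro rfl
    rcases hw with h | h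
    · exact hv'.1 h.symm
    · exact hv'.2.1 h.symm
  refine WP.for_le (k := k) (fun i σ' => I i 0 σ'.m) (k' * (T + 1) + 1) he hk h₀ ?_ ?_
  · intro i hi σ₁ f₁ h₁
    have F₁ := hset i i x (Or.inl rfl) f₁
    obtain ⟨s₁, s₂⟩ := he' _ F₁
    refine WP.for_le (k := k') (fun j σ' => I i j σ'.m) T s₁ s₂ h₁ ?_ ?_
    · intro j hj σ₂ f₂ h₂
      have F₂ : Frame (.for x e (.for y e' p)) σ σ₂ := by
        refine ⟨fun v hv => ?_, fun A hA => ?_⟩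
        · rw [f₂.v v (by simp only [Stmt.writesVar] at hv ⊢; exact (Bool.or_eq_false_iff.1 hv).2),
            F₁.v v hv]
        · rw [f₂.m A hA, F₁.m A hA]
      refine step i hi j hj _ (hset j j y (Or.inr rfl) F₂) ?_ (by simp) h₂
      rw [St.set_v, if_neg hxy, f₂.v x (by
        simp only [Stmt.writesVar, hp, Bool.or_false, decide_eq_false_iff_not]
        exact Ne.symm hxy)]
      simp
    · intro σ₂ t₂ _ h₂ c₂
      exact ⟨row i hi _ h₂, c₂⟩
  · intro σ₁ t₁ f₁ h₁ c₁
    exact hQ _ _ f₁ h₁ c₁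

namespace RowWeight

variable {K : Cfg} {π : Pars} {dd : ℕ} {σ : St}

theorem RowIndex.insert_zero {j : ℕ} {y tab val cnt : ℕ → ℕ} {lst : ℕ → ℕ → ℕ} {nd : ℕ}
    (h : RowIndex j y tab val cnt lst nd) (hy : y j = 0) :
    RowIndex (j + 1) y tab val cnt lst nd where
  tab_le := h.tab_le
  tab_zero := h.tab_zero
  val_tab := h.val_tab
  tab_val := h.tab_val
  val_mem r := (h.val_mem r).imp_right fun ⟨k, hk, e⟩ => ⟨k, by omega, e⟩
  mem_lst k hk hyk := by
    rcases Nat.lt_succ_iff_lt_or_eq.1 hk with hk | rfl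
    · exact h.mem_lst k hk hyk
    · exact absurd hy hyk
  lst_lt r i hi := (h.lst_lt r i hi).trans (by omega)
  cnt_eq_zero := h.cnt_eq_zero
  sum_cnt := h.sum_cnt.trans (by omega)
  nd_le := h.nd_le.trans (by omega)

/-- A further entry of a row, whose value has the rank `r`, possibly a new one. -/
theorem RowIndex.insert_rank {j r : ℕ} {y tab val cnt tab' val' : ℕ → ℕ} {lst : ℕ → ℕ → ℕ}
    {nd nd' : ℕ} (h : RowIndex j y tab val cnt lst nd) (hr : r ≠ 0) (hyr : tab' (y j) = r)
    (tab_le : ∀ x, tab' x ≤ nd') (tab_zero : tab' 0 = 0)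
    (val_tab : ∀ x, tab' x ≠ 0 → val' (tab' x) = x)
    (tab_val : ∀ r, r ≠ 0 → r ≤ nd' → tab' (val' r) = r)
    (val_mem : ∀ r, val' r = 0 ∨ ∃ k < j + 1, y k = val' r)
    (hext : ∀ x, tab x ≠ 0 → tab' x = tab x) (hnd : nd' = nd ∨ nd' = nd + 1) :
    RowIndex (j + 1) y tab' val' (Function.update cnt r (cnt r + 1))
      (Function.update lst r (Function.update (lst r) (cnt r) j)) nd' where
  tab_le := tab_le
  tab_zero := tab_zero
  val_tab := val_tab
  tab_val := tab_val
  val_mem := val_mem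
  mem_lst k hk hyk := by
    rcases Nat.lt_succ_iff_lt_or_eq.1 hk with hk | rfl
    · obtain ⟨h1, i, hi, e⟩ := h.mem_lst k hk hyk
      rw [hext _ h1]
      refine ⟨h1, i, ?_, ?_⟩
      · rw [Function.update_apply]
        split_ifs with h'
        · rw [h'] at hi; omega
        · exact hi
      · by_cases h' : tab (y k) = r
        · rw [h'] at hi e ⊢
          rw [Function.update_self, Function.update_of_ne (by omega), e]
        · rw [Function.update_of_ne h', e]
    · rw [hyr]
      exact ⟨hr, cnt r, by simp, by simp⟩
  lst_lt r' i hi := by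
    by_cases h' : r' = r
    · subst h'
      rw [Function.update_self] at hi ⊢
      rw [Function.update_apply]
      split_ifs with h''
      · omega
      · exact (h.lst_lt _ _ (by omega)).trans (by omega)
    · rw [Function.update_of_ne h'] at hi ⊢
      exact (h.lst_lt _ _ hi).trans (by omega)
  cnt_eq_zero r' hr' := by
    have := tab_le (y j)
    rw [Function.update_of_ne (by omega)]
    exact h.cnt_eq_zero r' (by omega)
  sum_cnt := by
    have hrn : r ∈ Finset.range (nd' + 1) := by
      have := tab_le (y j)
      rw [Finset.mem_range]; omega
    have hs := h.sum_cnt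
    have e1 : ∑ a ∈ Finset.range (nd' + 1), cnt a = ∑ a ∈ Finset.range (nd + 1), cnt a := by
      rcases hnd with rfl | rfl
      · rfl
      · rw [Finset.sum_range_succ, h.cnt_eq_zero (nd + 1) (by omega), add_zero]
    rw [← Finset.add_sum_erase _ _ hrn] at e1 ⊢
    rw [Function.update_self, Finset.sum_congr rfl fun a ha =>
      Function.update_of_ne (Finset.ne_of_mem_erase ha) _ _]
    omega
  nd_le := by
    have := h.nd_le
    omega

/-- A further entry of a row, with a new value. -/
theorem RowIndex.insert_new {j : ℕ} {y tab val cnt : ℕ → ℕ} {lst : ℕ → ℕ → ℕ} {nd : ℕ}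
    (h : RowIndex j y tab val cnt lst nd) (hy : y j ≠ 0) (ht : tab (y j) = 0) :
    RowIndex (j + 1) y (Function.update tab (y j) (nd + 1)) (Function.update val (nd + 1) (y j))
      (Function.update cnt (nd + 1) (cnt (nd + 1) + 1)) (Function.update lst (nd + 1)
        (Function.update (lst (nd + 1)) (cnt (nd + 1)) j)) (nd + 1) := by
  refine h.insert_rank (Nat.succ_ne_zero nd) (by simp) (fun x => ?_) ?_ (fun x hx => ?_)
    (fun r hr hr' => ?_) (fun r => ?_) (fun x hx => ?_) (Or.inr rfl)
  · rw [Function.update_apply]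
    split_ifs
    · exact le_rfl
    · exact (h.tab_le x).trans (Nat.le_succ nd)
  · rw [Function.update_of_ne hy.symm, h.tab_zero]
  · by_cases e : x = y j
    · subst e; simp
    · rw [Function.update_of_ne e] at hx ⊢
      have := h.tab_le x
      rw [Function.update_of_ne (by omega), h.val_tab x hx]
  · by_cases e : r = nd + 1
    · subst e; simp
    · have h1 := h.tab_val r hr (by omega)
      rw [Function.update_of_ne e, Function.update_of_ne, h1]
      intro h2
      rw [h2, ht] at h1
      exact hr h1.symm
  · by_cases e : r = nd + 1
    · subst e
      exact Or.inr ⟨j, by omega, by simp⟩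
    · rw [Function.update_of_ne e]
      exact (h.val_mem r).imp_right fun ⟨k, hk, e⟩ => ⟨k, by omega, e⟩
  · rw [Function.update_of_ne]
    rintro rfl
    exact hx ht

/-- The number of ranks is at most the number of values. -/
theorem RowIndex.nd_le_card {D : ℕ} {y tab val cnt : ℕ → ℕ} {lst : ℕ → ℕ → ℕ} {nd : ℕ}
    (h : RowIndex D y tab val cnt lst nd) {S : Finset ℕ} (hS : ∀ k < D, y k ≠ 0 → y k ∈ S) :
    nd ≤ S.card := by
  have h0 : ∀ r, r ≠ 0 → r ≤ nd → val r ≠ 0 := fun r hr hr' h0 => by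
    have := h.tab_val r hr hr'
    rw [h0, h.tab_zero] at this
    exact hr this.symm
  have hmem : ∀ r, r ≠ 0 → r ≤ nd → val r ∈ S := fun r hr hr' => by
    rcases h.val_mem r with e | ⟨k, hk, e⟩
    · exact absurd e (h0 r hr hr')
    · rw [← e]
      exact hS k hk (e ▸ h0 r hr hr')
  have := Finset.card_le_card_of_injOn (s := Finset.Icc 1 nd) (t := S) val
    (fun r hr => by
      rw [Finset.mem_coe, Finset.mem_Icc] at hr
      exact hmem r (by omega) hr.2)
    (fun r hr r' hr' e => by
      rw [Finset.mem_coe, Finset.mem_Icc] at hr hr'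
      rw [← h.tab_val r (by omega) hr.2, e, h.tab_val r' (by omega) hr'.2])
  simpa using this

/-- The index of row `u` at the scale `s`, for the first `j` entries. -/
def RowIndexAt (j s u : ℕ) (m : Arr → ℕ → ℕ → ℕ → ℕ → ℕ) : Prop :=
  RowIndex j (fun k => m .Y s u k 0) (fun x => m .tab s u x 0) (fun r => m .val s u r 0)
    (fun r => m .cnt s u r 0) (fun r i => m .lst s u r i) (m .nd s u 0 0)

theorem RowIndexAt.of_eq {j s u nd : ℕ} {m : Arr → ℕ → ℕ → ℕ → ℕ → ℕ} {y tab val cnt : ℕ → ℕ}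
    {lst : ℕ → ℕ → ℕ} (h : RowIndex j y tab val cnt lst nd) (h1 : ∀ k, m .Y s u k 0 = y k)
    (h2 : ∀ x, m .tab s u x 0 = tab x) (h3 : ∀ r, m .val s u r 0 = val r)
    (h4 : ∀ r, m .cnt s u r 0 = cnt r) (h5 : ∀ r i, m .lst s u r i = lst r i)
    (h6 : m .nd s u 0 0 = nd) : RowIndexAt j s u m := by
  unfold RowIndexAt
  simpa only [h1, h2, h3, h4, h5, h6] using h

theorem insert_spec (hC : Consts K π σ) (hP : π.Fits K dd) {s u k : ℕ} (hs : σ.v .s = s)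
    (hs' : s < π.Sc) (hu : σ.v .u = u) (hu' : u < 2 * π.n) (hk : σ.v .k = k) (hk' : k < π.D)
    (hY : ∀ s u k, σ.m .Y s u k 0 ≤ 2 * π.nc + 1) (h : RowIndexAt k s u σ.m) :
    WP K insert (fun σ' t => RowIndexAt (k + 1) s u σ'.m ∧
      (∀ A s' u', ¬ (s' = s ∧ u' = u) → σ'.m A s' u' = σ.m A s' u') ∧ t ≤ 11) σ := by
  have hr := hP.radix
  have hn := Nat.le_mul_self π.n
  have hr2 := Cfg.radix_le K
  have hD := hP.D_le
  have hyle := hY s u k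
  have hput : ∀ (σ : St) (A : Arr) (c d z : ℕ), ∀ A' s' u', ¬ (s' = s ∧ u' = u) →
      (σ.put A s u c d z).m A' s' u' = σ.m A' s' u' := by
    intro σ A c d z A' s' u' hne
    funext c' d'
    rw [St.put_m, if_neg (by tauto)]
  have hcnt : ∀ r, σ.m .cnt s u r 0 ≤ k := by
    intro r
    rcases Nat.lt_or_ge (σ.m .nd s u 0 0) r with hr | hr
    · exact (h.cnt_eq_zero r hr).le.trans (Nat.zero_le _)
    · exact (Finset.single_le_sum (f := fun r => σ.m .cnt s u r 0) (fun _ _ => Nat.zero_le _)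
        (Finset.mem_range.2 (by omega))).trans h.sum_cnt
  have hnd := h.nd_le
  have htab := h.tab_le (σ.m .Y s u k 0)
  rw [insert, wp_seq, wp_assign]
  simp only [Expr.Safe, Expr.eval, hC.radix, hs, hu, hk, true_and, and_true]
  refine ⟨by omega, ?_⟩
  rw [wp_ite]
  simp only [Expr.Safe, Expr.eval, St.set_v, if_true, wp_skip, true_and]
  refine ⟨fun hy => ?_, fun hy => ⟨?_, fun _ _ _ _ => rfl, by norm_num⟩⟩
  · simp only [wp_seq, wp_assign, wp_ite, wp_skip, wp_put, Expr.Safe, Expr.eval, BinOp.eval,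
      BinOp.Safe, hC.radix, hs, hu, hk, true_and, and_true, St.set_v, St.set_m, St.put_v, if_true,
      reduceCtorEq, if_false, St.put_m, false_and, and_self]
    have hc0 := hcnt (σ.m .tab s u (σ.m .Y s u k 0) 0)
    have hc1 := hcnt (σ.m .nd s u 0 0 + 1)
    refine ⟨by omega,
      fun ht => ⟨by omega, by omega, by omega, by omega, ?_, fun A s' u' hne => ?_, by omega⟩,
      fun ht => ⟨by omega, by omega, by omega, by omega, by omega, by omega, by omega, by omega,
        ?_, fun A s' u' hne => ?_, by omega⟩⟩
    · -- the value has a rank already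
      refine .of_eq (h.insert_rank (r := σ.m .tab s u (σ.m .Y s u k 0) 0) ht rfl h.tab_le
        h.tab_zero h.val_tab h.tab_val
        (fun r => (h.val_mem r).imp_right fun ⟨k, hk, e⟩ => ⟨k, by omega, e⟩)
        (fun _ _ => rfl) (Or.inl rfl)) (by simp) (by simp) (by simp) ?_ ?_ (by simp)
      · intro r
        simp [St.put_m, Function.update_apply]
      · intro r i
        by_cases e : r = σ.m .tab s u (σ.m .Y s u k 0) 0
        · subst e; simp [St.put_m, Function.update_apply]
        · simp [St.put_m, e]
    · rw [hput _ _ _ _ _ _ _ _ hne, hput _ _ _ _ _ _ _ _ hne]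
      rfl
    · -- a new rank
      refine .of_eq (h.insert_new hy ht) (by simp [St.put_m]) ?_ ?_ ?_ ?_ (by simp [St.put_m])
      · intro x
        simp [St.put_m, Function.update_apply]
      · intro x
        simp [St.put_m, Function.update_apply]
      · intro r
        simp [St.put_m, Function.update_apply]
      · intro r i
        by_cases e : r = σ.m .nd s u 0 0 + 1
        · subst e; simp [St.put_m, Function.update_apply]
        · simp [St.put_m, e]
    · rw [hput _ _ _ _ _ _ _ _ hne, hput _ _ _ _ _ _ _ _ hne, St.set_m,
        hput _ _ _ _ _ _ _ _ hne, hput _ _ _ _ _ _ _ _ hne, hput _ _ _ _ _ _ _ _ hne]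
      rfl
  · exact h.insert_zero hy

theorem index_spec (hC : Consts K π σ) (hP : π.Fits K dd)
    (hY : ∀ s u k, σ.m .Y s u k 0 ≤ 2 * π.nc + 1)
    (h₀ : ∀ A ∈ [Arr.tab, .val, .cnt, .lst, .nd], ∀ a b c d, σ.m A a b c d = 0) :
    WP K index (fun σ' t => (∀ s < π.Sc, ∀ u < 2 * π.n, RowIndexAt π.D s u σ'.m) ∧
      t ≤ π.Sc * (2 * π.n * (π.D * 12 + 2) + 2) + 1) σ := by
  have hzero : ∀ s u, RowIndexAt 0 s u σ.m := fun s u => by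
    simp only [List.mem_cons, List.not_mem_nil, or_false, forall_eq_or_imp, forall_eq] at h₀
    obtain ⟨h1, h2, h3, h4, h5⟩ := h₀
    constructor <;> simp [h1, h2, h3, h4, h5]
    omega
  refine WP.for_le (k := π.Sc) (fun i σ' =>
    (∀ s < i, ∀ u < 2 * π.n, RowIndexAt π.D s u σ'.m) ∧
    ∀ s, i ≤ s → ∀ u < 2 * π.n, RowIndexAt 0 s u σ'.m)
    (2 * π.n * (π.D * 12 + 2) + 1) trivial hC.Sc ⟨by simp, fun s _ u _ => hzero s u⟩ ?_ ?_
  · rintro s hs σ₁ f₁ ⟨h₁, h₁'⟩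
    have C₁ := (hC.frame f₁ rfl).set .s s rfl
    have Y₁ : σ₁.m .Y = σ.m .Y := f₁.m _ rfl
    refine WP.for₂_le (k := 2 * π.n) (k' := π.D) (fun u k m =>
      (∀ s' < s, ∀ u < 2 * π.n, RowIndexAt π.D s' u m) ∧
      (∀ s', s + 1 ≤ s' → ∀ u < 2 * π.n, RowIndexAt 0 s' u m) ∧
      (∀ u' < u, RowIndexAt π.D s u' m) ∧ (∀ u', u < u' → u' < 2 * π.n → RowIndexAt 0 s u' m) ∧
      (u < 2 * π.n → RowIndexAt k s u m)) 11 (by decide) rfl trivial C₁.m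
      (fun σ' f => ⟨trivial, (C₁.frame f rfl).D⟩) ?_ ?_ ?_ ?_
    · exact ⟨h₁, fun s' hs' => h₁' s' (by omega), by simp, fun u' _ => h₁' s le_rfl u',
        fun hu => h₁' s le_rfl 0 hu⟩
    · rintro u hu k hk σ₂ f₂ eu ek ⟨a₁, a₂, a₃, a₄, a₅⟩
      refine (insert_spec (C₁.frame f₂ rfl) hP (s := s) (u := u) (k := k)
        (by rw [f₂.v .s rfl]; simp) hs eu hu ek hk (by rw [f₂.m .Y rfl, St.set_m, Y₁]; exact hY)
        (a₅ hu)).mono ?_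
      rintro σ₃ t₃ _ ⟨h₃, h₃', c₃⟩
      have hsame : ∀ j s' u', ¬ (s' = s ∧ u' = u) → RowIndexAt j s' u' σ₂.m →
          RowIndexAt j s' u' σ₃.m := by
        intro j s' u' hne h
        unfold RowIndexAt
        simp only [h₃' _ s' u' hne]
        exact h
      exact ⟨⟨fun s' hs' u' hu' => hsame _ _ _ (by omega) (a₁ s' hs' u' hu'),
        fun s' hs' u' hu' => hsame _ _ _ (by omega) (a₂ s' hs' u' hu'),
        fun u' hu' => hsame _ _ _ (by omega) (a₃ u' hu'),
        fun u' hu' hu'' => hsame _ _ _ (by omega) (a₄ u' hu' hu''), fun _ => h₃⟩, c₃⟩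
    · rintro u hu m ⟨a₁, a₂, a₃, a₄, a₅⟩
      refine ⟨a₁, a₂, fun u' hu' => ?_, fun u' hu' => a₄ u' (by omega),
        fun h => a₄ _ (by omega) h⟩
      rcases Nat.lt_succ_iff_lt_or_eq.1 hu' with hu' | rfl
      · exact a₃ u' hu'
      · exact a₅ hu
    · rintro σ₂ t₂ _ ⟨a₁, a₂, a₃, a₄, a₅⟩ c₂
      refine ⟨⟨fun s' hs' => ?_, a₂⟩, c₂⟩
      rcases Nat.lt_succ_iff_lt_or_eq.1 hs' with hs' | rfl
      · exact a₁ s' hs'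
      · exact a₃
  · rintro σ₁ t₁ _ ⟨h₁, _⟩ c₁
    exact ⟨h₁, c₁⟩

theorem halve_spec (hC : Consts K π σ) (hP : π.Fits K dd)
    (hY : ∀ s u k, σ.m .Y s u k 0 ≤ 2 * π.nc + 1) :
    WP K halve (fun σ' t => rows σ' 0 = rows σ 0 ∧
      (∀ s < π.Sc, ∀ u < 2 * π.n, ∀ k < π.D, rows σ' (s + 1) u k = (rows σ' s u k + 1) / 2) ∧
      (∀ s u k, σ'.m .Y s u k 0 ≤ 2 * π.nc + 1) ∧
      t ≤ π.Sc * (2 * π.n * (π.D * 2 + 2) + 2) + 1) σ := by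
  have hr := hP.radix
  have hn := Nat.le_mul_self π.n
  have hr2 := Cfg.radix_le K
  have hD := hP.D_le
  refine WP.for_le (k := π.Sc) (fun i σ' => (∀ u k, σ'.m .Y 0 u k 0 = σ.m .Y 0 u k 0) ∧
    (∀ s < i, ∀ u < 2 * π.n, ∀ k < π.D, σ'.m .Y (s + 1) u k 0 = (σ'.m .Y s u k 0 + 1) / 2) ∧
    (∀ s u k, σ'.m .Y s u k 0 ≤ 2 * π.nc + 1))
    (2 * π.n * (π.D * 2 + 2) + 1) trivial hC.Sc ⟨fun _ _ => rfl, by simp, hY⟩ ?_ ?_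
  · rintro s hs σ₁ f₁ ⟨z₁, h₁, b₁⟩
    have C₁ := (hC.frame f₁ rfl).set .s s rfl
    refine WP.for₂_le (k := 2 * π.n) (k' := π.D) (fun u k m =>
      (∀ u k, m .Y 0 u k 0 = σ.m .Y 0 u k 0) ∧
      (∀ s' < s, ∀ u < 2 * π.n, ∀ k < π.D, m .Y (s' + 1) u k 0 = (m .Y s' u k 0 + 1) / 2) ∧
      (∀ s u k, m .Y s u k 0 ≤ 2 * π.nc + 1) ∧
      ∀ u' k', (u' < u ∧ k' < π.D ∨ u' = u ∧ k' < k) →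
        m .Y (s + 1) u' k' 0 = (m .Y s u' k' 0 + 1) / 2) 1 (by decide) rfl trivial C₁.m
      (fun σ' f => ⟨trivial, (C₁.frame f rfl).D⟩) ⟨z₁, h₁, b₁, by simp⟩ ?_ ?_ ?_
    · rintro u hu k hk σ₂ f₂ eu ek ⟨z₂, h₂, b₂, w₂⟩
      have C₂ := C₁.frame f₂ rfl
      have es : σ₂.v .s = s := by rw [f₂.v .s rfl]; simp
      have := b₂ s u k
      simp only [wp_put, Expr.Safe, Expr.eval, BinOp.eval, BinOp.Safe, C₂.radix, es, eu, ek,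
        true_and, and_true, St.put_m_self, pow_one]
      refine ⟨by omega, by omega, ⟨fun u' k' => ?_, fun s' hs' u' hu' k' hk' => ?_,
        fun s' u' k' => ?_, fun u' k' huk => ?_⟩, le_rfl⟩
      · rw [if_neg (by omega)]; exact z₂ u' k'
      · rw [if_neg (by omega), if_neg (by omega)]; exact h₂ s' hs' u' hu' k' hk'
      · split_ifs
        · omega
        · exact b₂ s' u' k'
      · rw [if_neg (show ¬ (s = s + 1 ∧ u' = u ∧ k' = k) by omega)]
        split_ifs with h
        · rw [h.1, h.2]
        · exact w₂ u' k' (by omega)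
    · rintro u hu m ⟨z, h, b, w⟩
      exact ⟨z, h, b, fun u' k' huk => w u' k' (by omega)⟩
    · rintro σ₂ t₂ _ ⟨z, h, b, w⟩ c₂
      refine ⟨⟨z, fun s' hs' => ?_, b⟩, c₂⟩
      rcases Nat.lt_succ_iff_lt_or_eq.1 hs' with hs' | rfl
      · exact h s' hs'
      · exact fun u hu k hk => w u k (Or.inl ⟨hu, hk⟩)
  · rintro σ₁ t₁ _ ⟨z₁, h₁, b₁⟩ c₁
    exact ⟨funext₂ z₁, h₁, b₁, c₁⟩

end RowWeight

end WordRAM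

namespace WordRAM

/-! ### Entries as words and as positive numbers -/

theorem encode_coe_toNat (w : ℕ) (z : ℤ) :
    ((encode w (z : WithTop ℤ)).toNat : ℤ) = z % (2 ^ w : ℕ) := by
  change ((BitVec.ofInt w z).toNat : ℤ) = _
  rw [BitVec.toNat_ofInt, Int.toNat_of_nonneg (Int.emod_nonneg _ (by positivity))]

theorem encode_top_toNat (w : ℕ) :
    (encode w (⊤ : WithTop ℤ)).toNat = 2 ^ (w - 1) - 1 := by
  change (BitVec.intMax w).toNat = _
  rw [BitVec.toNat_intMax]

theorem decode_encode_coe {w : ℕ} {z : ℤ} (hw : 0 < w) (hz : |z| + 1 < (2 ^ (w - 1) : ℕ)) :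
    decode (encode w (z : WithTop ℤ)) = ((z : WithTop ℤ) : WithBot (WithTop ℤ)) := by
  have h2 : 2 ^ w = 2 * 2 ^ (w - 1) := by
    rw [← pow_succ', Nat.sub_add_cancel hw]
  have hz1 := neg_abs_le z
  have hz2 := le_abs_self z
  have hint : (BitVec.ofInt w z).toInt = z := by
    rw [BitVec.toInt_ofInt, h2]
    refine Int.bmod_eq_of_le_mul_two ?_ ?_ <;> push_cast at hz ⊢ <;> omega
  change decode (BitVec.ofInt w z) = _
  unfold decode
  push_cast at hz
  rw [if_neg, if_neg, hint]
  · intro h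
    rw [h, BitVec.toInt_intMin_of_pos hw] at hint
    omega
  · intro h
    rw [h, BitVec.toInt_intMax] at hint
    omega

theorem decode_encode_top (w : ℕ) : decode (encode w (⊤ : WithTop ℤ)) = ⊤ := by
  change decode (BitVec.intMax w) = _
  simp [decode]

namespace RowWeight

/-- The positive number that stands for an entry of absolute value at most `b`; `0` stands for
infinity. -/
def entryCode (b : ℕ) : WithTop ℤ → ℕ
  | none => 0
  | some z => (z + b + 1).toNat

theorem entryCode_coe (b : ℕ) (z : ℤ) : entryCode b (z : WithTop ℤ) = (z + b + 1).toNat := rfl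

theorem entryCode_le {b : ℕ} {e : WithTop ℤ} (h : ∀ z : ℤ, e = z → |z| ≤ b) :
    entryCode b e ≤ 2 * b + 1 := by
  induction e with
  | top => exact Nat.zero_le _
  | coe z =>
    have := h z rfl
    have := le_abs_self z
    rw [entryCode_coe]
    omega

/-- How the program obtains `entryCode` from an input word. -/
theorem entryCode_eq {w b : ℕ} {e : WithTop ℤ} (hw : 0 < w) (h : ∀ z : ℤ, e = z → |z| ≤ b)
    (hb : b + 1 < 2 ^ (w - 1)) :
    entryCode b e = if (encode w e).toNat = 2 ^ (w - 1) - 1 then 0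
      else ((encode w e).toNat + (b + 1)) % 2 ^ w := by
  have h2 : 2 ^ w = 2 * 2 ^ (w - 1) := by
    rw [← pow_succ', Nat.sub_add_cancel hw]
  induction e with
  | top => rw [if_pos (encode_top_toNat w)]; rfl
  | coe z =>
    have hz := h z rfl
    have h1 := neg_abs_le z
    have h3 := le_abs_self z
    have he := encode_coe_toNat w z
    set x := (encode w (z : WithTop ℤ)).toNat
    rw [entryCode_coe]
    rcases le_or_gt 0 z with h0 | h0
    · rw [Int.emod_eq_of_lt h0 (by omega)] at he
      rw [if_neg (by omega), Nat.mod_eq_of_lt (by omega)]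
      omega
    · rw [← Int.add_emod_right, Int.emod_eq_of_lt (by omega) (by omega)] at he
      rw [if_neg (by omega)]
      by_cases hc : x + (b + 1) < 2 ^ w
      · omega
      · rw [Nat.mod_eq_sub_mod (by omega), Nat.mod_eq_of_lt (by omega)]
        omega

/-- The output word for an entry of the product, computed from the entry of `best`: the sum
`16 b - x` of two positive codes, minus their two shifts by `b + 1`. -/
def outWord (w b x : ℕ) : ℕ :=
  if x = 0 then 2 ^ (w - 1) - 1 else (2 ^ w - (2 * b + 2) + (16 * b - x)) % 2 ^ w

theorem decode_outWord {w b D : ℕ} {X : ℕ → ℕ → WithTop ℤ} {u v : ℕ} (hw : 0 < w)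
    (hu : ∀ k < D, ∀ z : ℤ, X u k = z → |z| ≤ b) (hv : ∀ k < D, ∀ z : ℤ, X v k = z → |z| ≤ b)
    (hb : 0 < b) (hbw : 2 * b + 2 < 2 ^ (w - 1)) {W : BitVec w}
    (hW : W.toNat = outWord w b (pairValue D (16 * b) (fun u k => entryCode b (X u k)) u v)) :
    decode W = (((Finset.univ : Finset (Fin D)).inf fun k => X u k + X v k : WithTop ℤ) :
      WithBot (WithTop ℤ)) := by
  have h2 : 2 ^ w = 2 * 2 ^ (w - 1) := by
    rw [← pow_succ', Nat.sub_add_cancel hw]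
  set Y := fun u k => entryCode b (X u k) with hY
  have hY0 : ∀ {e : WithTop ℤ}, (∀ z : ℤ, e = z → |z| ≤ b) → entryCode b e ≠ 0 →
      ∃ z : ℤ, e = z ∧ |z| ≤ b ∧ (entryCode b e : ℤ) = z + b + 1 := by
    intro e he h
    induction e with
    | top => exact absurd rfl h
    | coe z =>
      have := he z rfl
      have h1 := neg_abs_le z
      exact ⟨z, rfl, this, by rw [entryCode_coe]; omega⟩
  have hYz : ∀ {z : ℤ}, |z| ≤ b → (entryCode b (z : WithTop ℤ) : ℤ) = z + b + 1 := by
    intro z hz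
    have h1 := neg_abs_le z
    rw [entryCode_coe]; omega
  by_cases h0 : pairValue D (16 * b) Y u v = 0
  · have hC : (Finset.univ : Finset (Fin D)).inf (fun k => X u k + X v k) = ⊤ := by
      rw [Finset.inf_eq_top_iff]
      intro k _
      by_contra hk
      rw [WithTop.add_eq_top, not_or] at hk
      obtain ⟨z, hz⟩ := WithTop.ne_top_iff_exists.1 hk.1
      obtain ⟨z', hz'⟩ := WithTop.ne_top_iff_exists.1 hk.2
      have b1 := hu k k.2 z hz.symm
      have b2 := hv k k.2 z' hz'.symm
      have e1 : (Y u k : ℤ) = z + b + 1 := by simp only [hY, ← hz]; exact hYz b1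
      have e2 : (Y v k : ℤ) = z' + b + 1 := by simp only [hY, ← hz']; exact hYz b2
      have a1 := neg_abs_le z
      have a2 := neg_abs_le z'
      have a3 := le_abs_self z
      have a4 := le_abs_self z'
      have := le_pairValue (D := D) (M := 16 * b) (Y := Y) (u := u) (v := v) k.2 (by omega)
        (by omega)
      omega
    rw [hC]
    have : W = encode w ⊤ := by
      apply BitVec.eq_of_toNat_eq
      rw [hW, outWord, if_pos h0, encode_top_toNat]
    rw [this, decode_encode_top]
    rfl
  · obtain ⟨k, hk, h1, h3, hval⟩ := exists_eq_pairValue h0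
    obtain ⟨z, hz, b1, e1⟩ := hY0 (hu k hk) h1
    obtain ⟨z', hz', b2, e2⟩ := hY0 (hv k hk) h3
    change (Y u k : ℤ) = _ at e1
    change (Y v k : ℤ) = _ at e2
    have a1 := neg_abs_le z
    have a2 := neg_abs_le z'
    have a3 := le_abs_self z
    have a4 := le_abs_self z'
    have hC : (Finset.univ : Finset (Fin D)).inf (fun k => X u k + X v k) =
        ((z + z' : ℤ) : WithTop ℤ) := by
      refine le_antisymm ?_ (Finset.le_inf fun j _ => ?_)
      · refine (Finset.inf_le (Finset.mem_univ (⟨k, hk⟩ : Fin D))).trans (le_of_eq ?_)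
        simp only [hz, hz']
        rfl
      · rcases eq_or_ne (X u j + X v j) ⊤ with ht | ht
        · rw [ht]; exact le_top
        rw [Ne, WithTop.add_eq_top, not_or] at ht
        obtain ⟨y, hy⟩ := WithTop.ne_top_iff_exists.1 ht.1
        obtain ⟨y', hy'⟩ := WithTop.ne_top_iff_exists.1 ht.2
        have c1 := hu j j.2 y hy.symm
        have c2 := hv j j.2 y' hy'.symm
        have f1 : (Y u j : ℤ) = y + b + 1 := by simp only [hY, ← hy]; exact hYz c1
        have f2 : (Y v j : ℤ) = y' + b + 1 := by simp only [hY, ← hy']; exact hYz c2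
        have d1 := neg_abs_le y
        have d2 := neg_abs_le y'
        have d3 := le_abs_self y
        have d4 := le_abs_self y'
        have := le_pairValue (D := D) (M := 16 * b) (Y := Y) (u := u) (v := v) j.2 (by omega)
          (by omega)
        rw [← hy, ← hy', ← WithTop.coe_add, WithTop.coe_le_coe]
        omega
    rw [hC]
    have : W = encode w ((z + z' : ℤ) : WithTop ℤ) := by
      apply BitVec.eq_of_toNat_eq
      have he := encode_coe_toNat w (z + z')
      rw [hW, outWord, if_neg h0, hval]
      set x := (encode w ((z + z' : ℤ) : WithTop ℤ)).toNat
      rcases le_or_gt 0 (z + z') with h0 | h0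
      · rw [Int.emod_eq_of_lt h0 (by omega)] at he
        rw [Nat.mod_eq_sub_mod (by omega), Nat.mod_eq_of_lt (by omega)]
        omega
      · rw [← Int.add_emod_right, Int.emod_eq_of_lt (by omega) (by omega)] at he
        rw [Nat.mod_eq_of_lt (by omega)]
        omega
    rw [this, decode_encode_coe hw]
    have : |z + z'| ≤ 2 * b := (abs_add_le _ _).trans (by omega)
    have hbw' : ((2 * b + 2 : ℕ) : ℤ) < (2 ^ (w - 1) : ℕ) := by exact_mod_cast hbw
    push_cast at hbw' ⊢
    omega

end RowWeight

end WordRAM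

namespace WordRAM

namespace RowWeight

/-! ### Constants, input and output -/

variable {K : Cfg} {π : Pars} {dd : ℕ} {σ : St}

theorem bitLength_spec {n : ℕ} (hn : σ.v .n = n) (hpos : 0 < n) (hlt : n < 2 ^ K.l) :
    WP K bitLength (fun σ' t => σ'.v .L = Nat.log 2 n + 1 ∧ t ≤ n * 4 + 3) σ := by
  have hr2 := Cfg.radix_le K
  have hlog : Nat.log 2 n < n := Nat.log_lt_self 2 (by omega)
  simp only [bitLength, wp_seq, wp_assign, Expr.Safe, Expr.eval, true_and]
  refine ⟨by omega, ?_⟩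
  refine WP.for_le (k := n) (fun i σ' => σ'.v .L = min i (Nat.log 2 n + 1) ∧
    σ'.v .x = n / 2 ^ σ'.v .L) 3 trivial (by simp [Expr.eval, hn]) (by simp [hn]) ?_ ?_
  · rintro i hi σ₁ f₁ ⟨h₁, h₁'⟩
    have hx : σ₁.v .x ≠ 0 ↔ σ₁.v .L ≤ Nat.log 2 n := by
      rw [h₁', Nat.div_ne_zero_iff, Nat.le_log_iff_pow_le (by norm_num) (by omega)]
      simp
    simp only [wp_ite, wp_seq, wp_assign, wp_skip, Expr.Safe, Expr.eval, BinOp.eval, BinOp.Safe,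
      true_and, and_true, St.set_v, reduceCtorEq, if_false, if_true]
    refine ⟨fun h => ⟨⟨by omega, by omega⟩, by omega, ⟨?_, ?_⟩, by omega⟩,
      fun h => ⟨⟨?_, h₁'⟩, by omega⟩⟩
    · have := hx.1 h
      omega
    · rw [h₁', Nat.div_div_eq_div_mul, pow_one, ← pow_succ]
    · have : ¬ σ₁.v .L ≤ Nat.log 2 n := fun h' => hx.2 h' h
      omega
  · rintro σ₁ t₁ _ ⟨h₁, _⟩ c₁
    exact ⟨by omega, by omega⟩

theorem power_spec {n c : ℕ} (hn : σ.v .n = n) (hpos : 0 < n) (hc : c < 2 ^ K.w)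
    (hlt : n ^ c < 2 ^ K.l) :
    WP K (power c) (fun σ' t => σ'.v .nc = n ^ c ∧ t ≤ c * 2 + 2) σ := by
  have hr2 := Cfg.radix_le K
  simp only [power, wp_seq, wp_assign, Expr.Safe, Expr.eval, true_and]
  refine ⟨by omega, ?_⟩
  refine WP.for_le (k := c) (fun i σ' => σ'.v .nc = n ^ i) 1 hc rfl (by simp) ?_ ?_
  · intro i hi σ₁ f₁ h₁
    have hn₁ : σ₁.v .n = n := by rw [f₁.v .n rfl]; simpa using hn
    have hle : n ^ i * n ≤ n ^ c := by
      rw [← pow_succ]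
      exact Nat.pow_le_pow_right hpos hi
    simp only [wp_assign, Expr.Safe, Expr.eval, BinOp.eval, BinOp.Safe,
      true_and, and_true, St.set_v, reduceCtorEq, if_false, if_true, h₁, hn₁]
    exact ⟨by omega, by rw [pow_succ], le_rfl⟩
  · intro σ₁ t₁ _ h₁ c₁
    exact ⟨h₁, by omega⟩

/-- The relations between the parameters of the machine and of the program.  The graph of the
subroutine has `32 n` nodes, which is the reason for the `5` in its word size. -/
structure Sizes (K : Cfg) (n c κ₀ κ₁ a : ℕ) : Prop where
  l_eq : K.l = κ₁ * (Nat.log 2 n + 1)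
  w_eq : K.w = 5 * κ₁ * (Nat.log 2 n + 1)
  w₀_eq : K.w₀ = κ₀ * (Nat.log 2 n + 1 + 5)
  a_le : a ≤ κ₁

/-- The fixed numbers for the instances of size `n` and inner dimension `D`.  The parameter `g` is
about `n ^ (1 / a)`. -/
def pars (n D c a : ℕ) : Pars where
  n := n
  D := D
  nc := n ^ c
  g := 2 ^ ((Nat.log 2 n + 1) / a)
  Sc := (c + 2) * (Nat.log 2 n + 1)

/-- The values of the variables that are used for input and output only. -/
structure IOVars (K : Cfg) (π : Pars) (σ : St) : Prop where
  consts : Consts K π σ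
  n : σ.v .n = π.n
  nc : σ.v .nc = π.nc
  inf : σ.v .inf = 2 ^ (K.w - 1) - 1

theorem IOVars.frame {σ' : St} {c : Stmt} (h : IOVars K π σ)
    (hF : Frame c σ σ')
    (hc : ((.n :: .nc :: .inf :: fixedVars).all fun x => !c.writesVar x) = true) :
    IOVars K π σ' := by
  have hv : ∀ x ∈ Var.n :: .nc :: .inf :: fixedVars, σ'.v x = σ.v x := fun x hx =>
    hF.v x (by simpa using List.all_eq_true.1 hc x hx)
  refine ⟨h.consts.of_eq fun x hx => hv x (by simp [hx]), ?_, ?_, ?_⟩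
  · rw [hv _ (by simp), h.n]
  · rw [hv _ (by simp), h.nc]
  · rw [hv _ (by simp), h.inf]

theorem constants_spec {n D c κ₀ κ₁ a : ℕ} (hK : Sizes K n c κ₀ κ₁ a)
    (hP : (pars n D c a).Fits K dd) (hn : σ.v .n = n) (hD : σ.v .D = D)
    (hL : σ.v .L = Nat.log 2 n + 1) (hnc : σ.v .nc = n ^ c) :
    WP K (constants c κ₀ κ₁ a) (fun σ' t => IOVars K (pars n D c a) σ' ∧ t ≤ 9) σ := by
  have hr := hP.radix
  have hr2 := Cfg.radix_le K
  have hnn := Nat.le_mul_self n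
  have hnpos := hP.n_pos
  simp only [pars] at hr hnpos
  obtain ⟨hl, hw, hw₀, ha⟩ := hK
  set L := Nat.log 2 n + 1 with hLdef
  have hLpos : 0 < L := by omega
  have hlw : K.l < 2 ^ K.l := Nat.lt_two_pow_self
  have hww : K.w < 2 ^ K.w := Nat.lt_two_pow_self
  have hw₀l := K.w₀_le
  have hκ₁ : κ₁ ≤ K.l := by rw [hl]; exact Nat.le_mul_of_pos_right _ hLpos
  have hκ₁' : 5 * κ₁ ≤ K.w := by rw [hw]; exact Nat.le_mul_of_pos_right _ hLpos
  have hκ₀ : κ₀ ≤ K.w₀ := by rw [hw₀]; exact Nat.le_mul_of_pos_right _ (by omega)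
  have hLl : L ≤ K.l := by
    rcases Nat.eq_zero_or_pos κ₁ with h | h
    · have := K.l_ge; rw [h, zero_mul] at hl; omega
    · rw [hl]; exact Nat.le_mul_of_pos_left _ h
  have hc : c + 2 ≤ (c + 2) * L := Nat.le_mul_of_pos_right _ hLpos
  have hw₀' : 2 ^ K.w₀ ≤ 2 ^ K.l := Nat.pow_le_pow_right two_pos K.w₀_le
  have hwpos : 0 < K.w := by have := K.l_ge; have := K.l_le; omega
  have hw1 : 2 ^ (K.w - 1) < 2 ^ K.w := Nat.pow_lt_pow_right (by norm_num) (by omega)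
  have hg : 2 ^ (L / a) ≤ 2 ^ K.l :=
    Nat.pow_le_pow_right two_pos ((Nat.div_le_self _ _).trans hLl)
  have h1 : 1 ≤ 2 ^ K.w₀ := Nat.one_le_two_pow
  have h2 : 1 ≤ 2 ^ (K.w - 1) := Nat.one_le_two_pow
  simp only [constants, wp_seq, wp_assign, Expr.Safe, Expr.eval, BinOp.eval, BinOp.Safe, true_and,
    and_true, St.set_v, reduceCtorEq, if_false, if_true, hn, hL, hnc, one_mul, ← hw₀, ← hl, ← hw]
  refine ⟨by omega, by omega, by omega, by omega, by omega, by omega, by omega, by omega,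
    by omega, ⟨⟨?_, ?_, ?_, ?_, ?_, ?_, ?_, ?_, ?_⟩, ?_, ?_, ?_⟩, by omega⟩ <;>
    simp [pars, hn, hD, hnc, ← hLdef]

theorem readEntry_spec (hI : IOVars K π σ) (hP : π.Fits K dd) {a : Expr} {u k b : ℕ}
    {e : WithTop ℤ} (ha : a.Safe K σ) (hab : a.eval K.w σ = b) (hb : b < 2 ^ K.l)
    (hu : σ.v .u = u) (hu' : u < 2 * π.n) (hk : σ.v .k = k) (hk' : k < π.D)
    (he : ∀ z : ℤ, e = z → |z| ≤ π.nc) (hio : σ.m .io 0 0 0 b = (encode K.w e).toNat)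
    (h₀ : σ.m .Y 0 u k 0 = 0) :
    WP K (readEntry a) (fun σ' t => (∀ s' u' k', σ'.m .Y s' u' k' 0 =
      if s' = 0 ∧ u' = u ∧ k' = k then entryCode π.nc e else σ.m .Y s' u' k' 0) ∧ t ≤ 3) σ := by
  have hr := hP.radix
  have hr2 := Cfg.radix_le K
  have hnn := Nat.le_mul_self π.n
  have hD := hP.D_le
  have hw : 0 < K.w := by have := K.l_ge; have := K.l_le; omega
  have h2 : 2 ^ K.w = 2 * 2 ^ (K.w - 1) := by
    rw [← pow_succ', Nat.sub_add_cancel hw]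
  have hcode := entryCode_eq hw he (by omega : π.nc + 1 < 2 ^ (K.w - 1))
  simp only [readEntry, wp_seq, wp_assign, wp_ite, wp_skip, wp_put, Expr.Safe, Expr.eval,
    BinOp.eval, BinOp.Safe, ha, hab, hio, hI.consts.radix, hI.inf, hI.nc, hu, hk, true_and,
    and_true, St.set_v, St.set_m, reduceCtorEq, if_false, if_true, ite_ne_zero_iff,
    ite_eq_zero_iff]
  refine ⟨hb, fun h => ⟨fun s' u' k' => ?_, by omega⟩, fun h => ⟨by omega, by omega,
    fun s' u' k' => ?_, by omega⟩⟩
  · rw [hcode, if_pos h]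
    split_ifs with h'
    · obtain ⟨rfl, rfl, rfl⟩ := h'
      exact h₀
    · rfl
  · rw [hcode, if_neg h, St.put_m]
    simp

theorem readRows_spec (hI : IOVars K π σ) (hP : π.Fits K dd) {X : ℕ → ℕ → WithTop ℤ}
    (hX : ∀ u < π.n, ∀ k < π.D, ∀ z : ℤ, X u k = z → |z| ≤ π.nc)
    (hio : ∀ u < π.n, ∀ k < π.D, σ.m .io 0 0 0 (2 + (u * π.D + k)) = (encode K.w (X u k)).toNat)
    (h₀ : ∀ s u k, σ.m .Y s u k 0 = 0) :
    WP K readRows (fun σ' t => (∀ s u k, σ'.m .Y s u k 0 =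
      if s = 0 ∧ u < π.n ∧ k < π.D then entryCode π.nc (X u k) else 0) ∧
      t ≤ π.n * (π.D * 5 + 2) + 1) σ := by
  have hr := hP.radix
  have hr2 := Cfg.radix_le K
  have hnn := Nat.le_mul_self π.n
  have hD := hP.D_le
  refine WP.for₂_le (k := π.n) (k' := π.D) (fun i j m => ∀ s u k, m .Y s u k 0 =
      if s = 0 ∧ (u < i ∧ k < π.D ∨ u = i ∧ k < j) then entryCode π.nc (X u k) else 0) 4
      (by decide) rfl trivial hI.n (fun σ' f => ⟨trivial, (hI.frame f rfl).consts.D⟩)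
      (by simpa using h₀) ?_ ?_ ?_
  · intro i hi j hj σ₁ f₁ ei ej h₁
    have I₁ := hI.frame f₁ rfl
    have hij : i * π.D + j < π.n * π.D := mul_add_lt hj hi
    have hle : π.n * π.D ≤ π.n * π.n := Nat.mul_le_mul_left _ hD
    rw [wp_seq, wp_assign]
    refine ⟨trivial, ?_⟩
    simp only [Expr.eval, ei]
    have I₂ : IOVars K π (σ₁.set .u (i)) :=
      ⟨I₁.consts.set .u _ rfl, by simpa using I₁.n, by simpa using I₁.nc, by simpa using I₁.inf⟩
    refine (readEntry_spec (u := i) (k := j) (b := 2 + (i * π.D + j)) (e := X i j) I₂ hP ?_ ?_ ?_ ?_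
      ?_ ?_ hj (hX i hi j hj) ?_ ?_).mono ?_
    · simp only [Expr.Safe, Expr.eval, BinOp.eval, BinOp.Safe, St.set_v, reduceCtorEq, if_false,
        ei, ej, I₁.consts.D, true_and]
      omega
    · simp only [Expr.eval, BinOp.eval, St.set_v, reduceCtorEq, if_false, ei, ej, I₁.consts.D]
    · omega
    · simp [Expr.eval, ei]
    · omega
    · simpa using ej
    · rw [St.set_m, f₁.m .io rfl, hio i hi j hj]
    · rw [St.set_m, h₁, if_neg (by omega)]
    · rintro σ₂ t₂ _ ⟨h₂, c₂⟩
      refine ⟨fun s u k => ?_, by omega⟩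
      rw [h₂, St.set_m, h₁]
      by_cases e : s = 0 ∧ u = i ∧ k = j
      · obtain ⟨rfl, rfl, rfl⟩ := e
        rw [if_pos ⟨rfl, rfl, rfl⟩, if_pos (by omega)]
      · rw [if_neg e]
        exact if_congr (by omega) rfl rfl
  · intro i hi m h s u k
    rw [h]
    refine if_congr (and_congr_right fun _ => ?_) rfl rfl
    constructor
    · rintro (h | ⟨rfl, h⟩) <;> omega
    · rintro (h | h) <;> omega
  · intro σ₁ t₁ _ h₁ c₁
    refine ⟨fun s u k => ?_, c₁⟩
    rw [h₁]
    exact if_congr (by omega) rfl rfl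

theorem readColumns_spec (hI : IOVars K π σ) (hP : π.Fits K dd) {X : ℕ → ℕ → WithTop ℤ}
    (hX : ∀ u < 2 * π.n, ∀ k < π.D, ∀ z : ℤ, X u k = z → |z| ≤ π.nc)
    (hio : ∀ j < π.n, ∀ k < π.D, σ.m .io 0 0 0 (2 + (π.n * π.D + (k * π.n + j))) =
      (encode K.w (X (π.n + j) k)).toNat)
    (h₀ : ∀ s u k, σ.m .Y s u k 0 =
      if s = 0 ∧ u < π.n ∧ k < π.D then entryCode π.nc (X u k) else 0) :
    WP K readColumns (fun σ' t => (∀ s u k, σ'.m .Y s u k 0 =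
      if s = 0 ∧ u < 2 * π.n ∧ k < π.D then entryCode π.nc (X u k) else 0) ∧
      t ≤ π.n * (π.D * 5 + 2) + 1) σ := by
  have hr := hP.radix
  have hr2 := Cfg.radix_le K
  have hnn := Nat.le_mul_self π.n
  have hD := hP.D_le
  refine WP.for₂_le (k := π.n) (k' := π.D) (fun i j m => ∀ s u k, m .Y s u k 0 =
      if s = 0 ∧ (u < π.n + i ∧ k < π.D ∨ u = π.n + i ∧ k < j) then entryCode π.nc (X u k) else 0) 4
      (by decide) rfl trivial hI.n (fun σ' f => ⟨trivial, (hI.frame f rfl).consts.D⟩)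
      (by simpa using h₀) ?_ ?_ ?_
  · intro i hi j hj σ₁ f₁ ei ej h₁
    have I₁ := hI.frame f₁ rfl
    have hij : j * π.n + i < π.D * π.n := mul_add_lt hi hj
    have hle : π.n * π.D ≤ π.n * π.n := Nat.mul_le_mul_left _ hD
    have hle' : π.D * π.n ≤ π.n * π.n := Nat.mul_le_mul_right _ hD
    rw [wp_seq, wp_assign]
    simp only [Expr.Safe, Expr.eval, BinOp.eval, BinOp.Safe, true_and, I₁.n, ei]
    refine ⟨by omega, ?_⟩
    have I₂ : IOVars K π (σ₁.set .u (π.n + i)) :=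
      ⟨I₁.consts.set .u _ rfl, by simpa using I₁.n, by simpa using I₁.nc, by simpa using I₁.inf⟩
    refine (readEntry_spec (u := π.n + i) (k := j) (b := 2 + (π.n * π.D + (j * π.n + i)))
      (e := X (π.n + i) j) I₂ hP ?_ ?_ ?_ ?_
      ?_ ?_ hj (hX _ (by omega) j hj) ?_ ?_).mono ?_
    · simp only [Expr.Safe, Expr.eval, BinOp.eval, BinOp.Safe, St.set_v, reduceCtorEq, if_false,
        ei, ej, I₁.n, I₁.consts.D, true_and]
      omega
    · simp only [Expr.eval, BinOp.eval, St.set_v, reduceCtorEq, if_false, ei, ej, I₁.n,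
        I₁.consts.D]
    · omega
    · simp
    · omega
    · simpa using ej
    · rw [St.set_m, f₁.m .io rfl, hio i hi j hj]
    · rw [St.set_m, h₁, if_neg (by omega)]
    · rintro σ₂ t₂ _ ⟨h₂, c₂⟩
      refine ⟨fun s u k => ?_, by omega⟩
      rw [h₂, St.set_m, h₁]
      by_cases e : s = 0 ∧ u = π.n + i ∧ k = j
      · obtain ⟨rfl, rfl, rfl⟩ := e
        rw [if_pos ⟨rfl, rfl, rfl⟩, if_pos (by omega)]
      · rw [if_neg e]
        exact if_congr (by omega) rfl rfl
  · intro i hi m h s u k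
    rw [h]
    refine if_congr (and_congr_right fun _ => ?_) rfl rfl
    constructor
    · rintro (h | ⟨rfl, h⟩) <;> omega
    · rintro (h | h) <;> omega
  · intro σ₁ t₁ _ h₁ c₁
    refine ⟨fun s u k => ?_, c₁⟩
    rw [h₁]
    exact if_congr (by omega) rfl rfl

theorem writeProduct_spec (hI : IOVars K π σ) (hP : π.Fits K dd) (hSc : 0 < π.Sc)
    (hb : ∀ u < 2 * π.n, ∀ v < 2 * π.n, σ.m .best 0 u v 0 ≤ 16 * π.nc) :
    WP K writeProduct (fun σ' t => (∀ i < π.n, ∀ j < π.n, σ'.m .io 0 0 0 (i * π.n + j) =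
      outWord K.w π.nc (σ.m .best 0 i (π.n + j) 0)) ∧ t ≤ π.n * (π.n * 4 + 2) + 1) σ := by
  have hr := hP.radix
  have hr2 := Cfg.radix_le K
  have hnn := Nat.le_mul_self π.n
  refine WP.for₂_le (k := π.n) (k' := π.n) (fun i j m => ∀ a b, (a < i ∧ b < π.n ∨ a = i ∧ b < j) →
      a < π.n → b < π.n → m .io 0 0 0 (a * π.n + b) =
        outWord K.w π.nc (σ.m .best 0 a (π.n + b) 0)) 3
      (by decide) rfl trivial hI.n (fun σ' f => ⟨trivial, (hI.frame f rfl).n⟩)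
      (by simp) ?_ ?_ ?_
  · intro i hi j hj σ₁ f₁ ei ej h₁
    have I₁ := hI.frame f₁ rfl
    have b₁ : σ₁.m .best = σ.m .best := f₁.m _ rfl
    have hij : i * π.n + j < π.n * π.n := mul_add_lt hj hi
    have hbij := hb i (by omega) (π.n + j) (by omega)
    have hfin : ∀ z, z = outWord K.w π.nc (σ.m .best 0 i (π.n + j) 0) → ∀ a b,
        (a < i ∧ b < π.n ∨ a = i ∧ b < j + 1) → a < π.n → b < π.n →
        (if a * π.n + b = i * π.n + j then z else σ₁.m .io 0 0 0 (a * π.n + b)) =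
          outWord K.w π.nc (σ.m .best 0 a (π.n + b) 0) := by
      intro z hz a b hab ha hb'
      split_ifs with h
      · obtain ⟨rfl, rfl⟩ := mul_add_inj hb' hj h
        exact hz
      · refine h₁ a b ?_ ha hb'
        rcases hab with hab | ⟨rfl, hab⟩
        · exact Or.inl hab
        · refine Or.inr ⟨rfl, ?_⟩
          rcases Nat.lt_succ_iff_lt_or_eq.1 hab with h' | rfl
          · exact h'
          · exact absurd rfl h
    simp only [wp_seq, wp_assign, wp_ite, wp_out, Expr.Safe, Expr.eval, BinOp.eval, BinOp.Safe,
      I₁.consts.radix, I₁.consts.M, I₁.inf, I₁.nc, I₁.n, ei, ej, b₁, true_and, and_true, St.set_v,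
      St.set_m, reduceCtorEq, if_false, if_true, St.put_m_self]
    refine ⟨by omega, fun h => ⟨by omega, by omega, hfin _ ?_, by omega⟩,
      fun h => ⟨by omega, hfin _ ?_, by omega⟩⟩
    · rw [outWord, if_neg h]
    · rw [outWord, if_pos h]
  · intro i hi m h a b hab
    exact h a b (by omega)
  · intro σ₁ t₁ _ h₁ c₁
    exact ⟨fun i hi j hj => h₁ i j (Or.inl ⟨hi, hj⟩) hi hj, c₁⟩

end RowWeight

end WordRAM

namespace WordRAM

namespace RowWeight

/-! ### The whole program, as a statement -/

variable {K : Cfg} {π : Pars} {dd : ℕ} {σ : St}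

theorem half_iterate_le_one (s : ℕ) {y : ℕ} (h : y ≤ 2 ^ s) :
    (fun y => (y + 1) / 2)^[s] y ≤ 1 := by
  induction s generalizing y with
  | zero => simpa using h
  | succ s ih =>
    rw [Function.iterate_succ_apply]
    refine ih ?_
    rw [pow_succ] at h
    omega

theorem half_iterate_zero (s : ℕ) : (fun y => (y + 1) / 2)^[s] 0 = 0 :=
  Function.iterate_fixed (by norm_num) s

theorem rows_eq_iterate {u k : ℕ} (hhalf : ∀ s < π.Sc, ∀ u < 2 * π.n, ∀ k < π.D,
      rows σ (s + 1) u k = (rows σ s u k + 1) / 2) (hu : u < 2 * π.n) (hk : k < π.D) (s : ℕ)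
    (hs : s ≤ π.Sc) : rows σ s u k = (fun y => (y + 1) / 2)^[s] (rows σ 0 u k) := by
  induction s with
  | zero => rfl
  | succ s ih =>
    rw [hhalf s hs u hu k hk, ih (by omega), Function.iterate_succ_apply']

/-- Rounding to a coarser scale does not increase the number of values in a row. -/
theorem nd_lt_of_rows {S : ℕ → Finset ℕ} (hS : ∀ u < 2 * π.n, ∀ k < π.D, rows σ 0 u k ≠ 0 →
      rows σ 0 u k ∈ S u) (hcard : ∀ u < 2 * π.n, (S u).card < dd)
    (hhalf : ∀ s < π.Sc, ∀ u < 2 * π.n, ∀ k < π.D, rows σ (s + 1) u k = (rows σ s u k + 1) / 2)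
    {s u : ℕ} (hs : s < π.Sc) (hu : u < 2 * π.n) {tab val cnt : ℕ → ℕ} {lst : ℕ → ℕ → ℕ} {nd : ℕ}
    (h : RowIndex π.D (rows σ s u) tab val cnt lst nd) : nd < dd := by
  refine lt_of_le_of_lt ?_ (hcard u hu)
  refine (h.nd_le_card (S := (S u).image (fun y => (y + 1) / 2)^[s]) fun k hk h0 => ?_).trans
    Finset.card_image_le
  rw [rows_eq_iterate hhalf hu hk s hs.le] at h0 ⊢
  refine Finset.mem_image_of_mem _ (hS u hu k hk fun h => h0 ?_)
  rw [h, half_iterate_zero]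

/-- At the coarsest scale all entries are `0` or `1`. -/
theorem exact_top (hhalf : ∀ s < π.Sc, ∀ u < 2 * π.n, ∀ k < π.D,
      rows σ (s + 1) u k = (rows σ s u k + 1) / 2)
    (hY : ∀ s u k, σ.m .Y s u k 0 ≤ 2 * π.nc + 1) (hSc : 2 * π.nc + 1 ≤ 2 ^ π.Sc)
    (hb : ∀ u < 2 * π.n, ∀ v < 2 * π.n, σ.m .best π.Sc u v 0 = 16 * π.nc - 2) :
    Exact π (rows σ) π.Sc σ := by
  intro u hu v hv
  have hone : ∀ {u k}, u < 2 * π.n → k < π.D → rows σ π.Sc u k ≤ 1 := fun {u k} hu hk => by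
    rw [rows_eq_iterate hhalf hu hk _ le_rfl]
    exact half_iterate_le_one _ ((hY 0 u k).trans hSc)
  rw [hb u hu v hv]
  refine ⟨Nat.sub_le _ _, fun h => ?_⟩
  obtain ⟨k, hk, h1, h2, hval⟩ := exists_eq_pairValue h
  have h3 := hone hu hk
  have h4 := hone hv hk
  rw [hval]
  omega

theorem pairValue_le (D M : ℕ) (Y : ℕ → ℕ → ℕ) (u v : ℕ) : pairValue D M Y u v ≤ M :=
  Finset.sup_le fun k _ => by split_ifs <;> omega

theorem pairValue_congr {D M : ℕ} {Y Y' : ℕ → ℕ → ℕ} {u v : ℕ} (hu : ∀ k < D, Y u k = Y' u k)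
    (hv : ∀ k < D, Y v k = Y' v k) : pairValue D M Y u v = pairValue D M Y' u v :=
  Finset.sup_congr rfl fun k hk => by
    rw [hu k (Finset.mem_range.1 hk), hv k (Finset.mem_range.1 hk)]

/-- A bound for the running time of `product`. -/
def productTime (π : Pars) (c dd T : ℕ) : ℕ :=
  2 + (π.n * 4 + 3) + (c * 2 + 2) + 9 + 2 * (π.n * (π.D * 5 + 2) + 1) +
  (π.Sc * (2 * π.n * (π.D * 2 + 2) + 2) + 1) + (π.Sc * (2 * π.n * (π.D * 12 + 2) + 2) + 1) +
  (2 * π.n * (2 * π.n * 2 + 2) + 1) + (π.Sc * (3 * (roundTime π dd T + 2) + 3) + 1) +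
  (π.n * (π.n * 4 + 2) + 1)

/-- The program, run on rows `X u` with entries of absolute value at most `n ^ c` and with less than
`dd` values each, writes the words for their pairwise min-plus products. -/
theorem product_spec {n D c κ₀ κ₁ a T : ℕ} (hK : Sizes K n c κ₀ κ₁ a)
    (hP : (pars n D c a).Fits K dd)
    (hA : SolvesAPSP K.prog K.w₀ (4 * (8 * n)) (16 * n ^ c) T) {X : ℕ → ℕ → WithTop ℤ}
    (hX : ∀ u < 2 * n, ∀ k < D, ∀ z : ℤ, X u k = z → |z| ≤ (n ^ c : ℕ))
    {S : ℕ → Finset ℕ} (hS : ∀ u < 2 * n, ∀ k < D, entryCode (n ^ c) (X u k) ≠ 0 →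
      entryCode (n ^ c) (X u k) ∈ S u) (hcard : ∀ u < 2 * n, (S u).card < dd)
    (hin : σ.m .io 0 0 0 0 = n) (hiD : σ.m .io 0 0 0 1 = D)
    (hrow : ∀ u < n, ∀ k < D, σ.m .io 0 0 0 (2 + (u * D + k)) = (encode K.w (X u k)).toNat)
    (hcol : ∀ j < n, ∀ k < D, σ.m .io 0 0 0 (2 + (n * D + (k * n + j))) =
      (encode K.w (X (n + j) k)).toNat)
    (h₀ : ∀ A, A ≠ Arr.io → ∀ a b c d, σ.m A a b c d = 0) :
    WP K (product c κ₀ κ₁ a) (fun σ' t => (∀ i < n, ∀ j < n, σ'.m .io 0 0 0 (i * n + j) =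
      outWord K.w (n ^ c) (pairValue D (16 * n ^ c) (fun u k => entryCode (n ^ c) (X u k))
        i (n + j))) ∧ t ≤ productTime (pars n D c a) c dd T) σ := by
  have hr := hP.radix
  have hr2 := Cfg.radix_le K
  have hnn := Nat.le_mul_self n
  have hnpos : 0 < n := hP.n_pos
  set π := pars n D c a with hπ
  have en : π.n = n := rfl
  have eD : π.D = D := rfl
  have enc : π.nc = n ^ c := rfl
  have eSc : π.Sc = (c + 2) * (Nat.log 2 n + 1) := rfl
  have hc2 : c + 2 ≤ π.Sc := by rw [eSc]; exact Nat.le_mul_of_pos_right _ (by omega)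
  have hSc' : 0 < π.Sc := lt_of_lt_of_le (Nat.succ_pos _) hc2
  rw [en, enc] at hr
  have hSc : 2 * π.nc + 1 ≤ 2 ^ π.Sc := by
    have h1 : n ^ c ≤ (2 ^ (Nat.log 2 n + 1)) ^ c :=
      Nat.pow_le_pow_left (Nat.lt_pow_succ_log_self (by norm_num) n).le c
    have h2 : 1 ≤ n ^ c := Nat.one_le_pow _ _ hnpos
    have h3 : 2 ≤ 2 ^ (Nat.log 2 n + 1) := by
      rw [pow_succ]; have := Nat.one_le_two_pow (n := Nat.log 2 n); omega
    rw [enc, eSc, mul_comm (c + 2), pow_mul, pow_add (2 ^ (Nat.log 2 n + 1))]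
    have h4 : 2 * 2 ≤ (2 ^ (Nat.log 2 n + 1)) ^ 2 := by
      rw [pow_two]; exact Nat.mul_le_mul h3 h3
    have := Nat.mul_le_mul h1 h4
    omega
  unfold product
  rw [wp_seq, wp_assign]
  refine ⟨⟨by simp only [Expr.Safe]; omega, by simp only [Expr.eval]; omega⟩, ?_⟩
  rw [wp_seq, wp_assign]
  refine ⟨⟨by simp only [Expr.Safe]; omega, by simp only [Expr.eval]; omega⟩, ?_⟩
  simp only [Expr.eval, hin, hiD, St.set_m]
  rw [wp_seq]
  refine (bitLength_spec (n := n) (by simp) hnpos (by omega)).mono ?_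
  rintro σ₁ t₁ f₁ ⟨L₁, c₁⟩
  have n₁ : σ₁.v .n = n := by rw [f₁.v _ rfl]; simp
  have D₁ : σ₁.v .D = D := by rw [f₁.v _ rfl]; simp
  rw [wp_seq]
  refine (power_spec (c := c) n₁ hnpos (by omega) (by omega)).mono ?_
  rintro σ₂ t₂ f₂ ⟨N₂, c₂⟩
  rw [wp_seq]
  refine (constants_spec hK hP (by rw [f₂.v _ rfl, n₁]) (by rw [f₂.v _ rfl, D₁])
    (by rw [f₂.v _ rfl, L₁]) N₂).mono ?_
  rintro σ₃ t₃ f₃ ⟨I₃, c₃⟩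
  have m₃ : σ₃.m = σ.m := by
    funext A
    rw [f₃.m A rfl, f₂.m A rfl, f₁.m A rfl]
    rfl
  rw [wp_seq]
  refine (readRows_spec (X := X) I₃ hP (fun u hu => hX u (by change u < n at hu; omega))
    (by rw [m₃]; exact hrow)
    (fun s u k => by rw [m₃]; exact h₀ _ (by decide) _ _ _ _)).mono ?_
  rintro σ₄ t₄ f₄ ⟨Y₄, c₄⟩
  have I₄ := I₃.frame f₄ rfl
  have m₄ : ∀ A, A ≠ .Y → σ₄.m A = σ.m A := fun A hA => by
    rw [f₄.m A (by cases A <;> first | rfl | exact absurd rfl hA), m₃]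
  rw [wp_seq]
  refine (readColumns_spec (X := X) I₄ hP hX (by rw [m₄ _ (by decide)]; exact hcol) Y₄).mono ?_
  rintro σ₅ t₅ f₅ ⟨Y₅, c₅⟩
  have I₅ := I₄.frame f₅ rfl
  have m₅ : ∀ A, A ≠ .Y → σ₅.m A = σ.m A := fun A hA => by
    rw [f₅.m A (by cases A <;> first | rfl | exact absurd rfl hA), m₄ A hA]
  rw [wp_seq]
  refine (halve_spec I₅.consts hP fun s u k => ?_).mono ?_
  · rw [Y₅]
    split_ifs with h
    · exact entryCode_le (hX u h.2.1 k h.2.2)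
    · exact Nat.zero_le _
  rintro σ₆ t₆ f₆ ⟨R₆, H₆, B₆, c₆⟩
  have I₆ := I₅.frame f₆ rfl
  have m₆ : ∀ A, A ≠ .Y → σ₆.m A = σ.m A := fun A hA => by
    rw [f₆.m A (by cases A <;> first | rfl | exact absurd rfl hA), m₅ A hA]
  have Z₆ : ∀ A, A ≠ .Y → A ≠ .io → ∀ a b c d, σ₆.m A a b c d = 0 := fun A hA hA' => by
    rw [m₆ A hA]; exact h₀ A hA'
  have E₆ : ∀ u < 2 * n, ∀ k < D, rows σ₆ 0 u k = entryCode (n ^ c) (X u k) := by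
    intro u hu k hk
    rw [R₆]
    exact (Y₅ 0 u k).trans (if_pos ⟨rfl, hu, hk⟩)
  rw [wp_seq]
  refine (index_spec I₆.consts hP B₆ fun A hA => Z₆ A ?_ ?_).mono ?_
  · rintro rfl
    revert hA
    decide
  · rintro rfl
    revert hA
    decide
  rintro σ₇ t₇ f₇ ⟨X₇, c₇⟩
  have I₇ := I₆.frame f₇ rfl
  have Y₇ : σ₇.m .Y = σ₆.m .Y := f₇.m _ rfl
  have r₇ : rows σ₇ = rows σ₆ := by
    funext s u k
    unfold rows
    rw [Y₇]
  have H₇ := H₆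
  rw [← r₇] at H₇ E₆
  have d₇ : Data K π dd σ₇ := by
    refine ⟨I₇.consts, ?_, X₇, fun s hs u hu => ?_⟩
    · rw [Y₇]; exact B₆
    · refine nd_lt_of_rows (S := S) (fun u hu k hk => ?_) hcard H₇ hs hu (X₇ s hs u hu)
      rw [E₆ u hu k hk]
      exact hS u hu k hk
  rw [wp_seq]
  refine (startScale_spec d₇ hP).mono ?_
  rintro σ₈ t₈ f₈ ⟨T₈, O₈, c₈⟩
  have I₈ := I₇.frame f₈ rfl
  have d₈ := d₇.frame f₈ rfl
  have r₈ : rows σ₈ = rows σ₇ := by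
    funext s u k
    unfold rows
    rw [f₈.m .Y rfl]
  rw [← r₈] at H₇ E₆
  rw [wp_seq]
  refine (scales_spec hA d₈ hP hSc' H₇ (exact_top H₇ d₈.Y_le hSc T₈) ?_ ?_ ?_).mono ?_
  · intro s hs u v
    rw [O₈ s (by omega), f₇.m .best rfl]
    exact Z₆ _ (by decide) (by decide) _ _ _ _
  · intro ρ u r
    rw [f₈.m .cov rfl, f₇.m .cov rfl]
    exact Z₆ _ (by decide) (by decide) _ _ _ _
  · intro ρ t t' x
    rw [f₈.m .ora rfl, f₇.m .ora rfl]
    exact Z₆ _ (by decide) (by decide) _ _ _ _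
  rintro σ₉ t₉ f₉ ⟨F₉, c₉⟩
  have I₉ := I₈.frame f₉ rfl
  refine (writeProduct_spec I₉ hP hSc' fun u hu v hv => ?_).mono ?_
  · rw [F₉ u hu v hv]
    exact pairValue_le ..
  rintro σ' t _ ⟨W, c'⟩
  refine ⟨fun i hi j hj => ?_, ?_⟩
  · refine (W i hi j hj).trans ?_
    rw [F₉ i (show i < 2 * n by omega) (π.n + j) (show n + j < 2 * n by omega)]
    congr 1
    exact pairValue_congr (fun k hk => E₆ i (by omega) k hk)
      (fun k hk => E₆ (n + j) (by omega) k hk)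
  · unfold productTime
    change t₁ ≤ π.n * 4 + 3 at c₁
    simp only [← hπ] at c₄ c₅ c₆ c₇ c₈ c₉ c'
    omega

end RowWeight

end WordRAM

/-! ### The whole program, on the machine -/

theorem rowMajor_length {α : Type} {m n : ℕ} (A : Matrix (Fin m) (Fin n) α) :
    (rowMajor A).length = m * n := by simp [rowMajor]

theorem rowMajor_getElem? {α : Type} {m n : ℕ} (A : Matrix (Fin m) (Fin n) α) (i : Fin m)
    (j : Fin n) : (rowMajor A)[(i : ℕ) * n + j]? = some (A i j) := by
  have hlt : (i : ℕ) * n + j < m * n := WordRAM.mul_add_lt j.2 i.2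
  have hn : 0 < n := j.pos
  rw [List.getElem?_eq_getElem (by rwa [rowMajor_length])]
  simp only [rowMajor, List.getElem_ofFn, Option.some.injEq]
  congr 1
  · ext
    simp only [Fin.coe_divNat]
    rw [mul_comm, Nat.mul_add_div hn, Nat.div_eq_of_lt j.2, add_zero]
  · ext
    simp only [Fin.coe_modNat]
    rw [mul_comm, Nat.mul_add_mod, Nat.mod_eq_of_lt j.2]

namespace WordRAM

/-- The state of the language that the initial state of the machine represents. -/
def initSt (w : ℕ) (input : List (WithTop ℤ)) : St where
  v _ := 0
  m A a b c d := if A = .io ∧ a = 0 ∧ b = 0 ∧ c = 0 then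
    ((input.map (encode w)).getD d 0).toNat else 0

theorem rep_initSt (K : Cfg) {input : List (WithTop ℤ)} (h : input.length ≤ 2 ^ K.l) :
    Rep K (initSt K.w input) (init K.w input) := by
  refine ⟨fun _ => rfl, fun A a b c d ha hb hc hd => ?_⟩
  have hlt := adr_lt K A ha hb hc hd
  simp only [init, initSt, BitVec.toNat_ofNat, Nat.mod_eq_of_lt hlt]
  split_ifs with h0
  · obtain ⟨rfl, rfl, rfl, rfl⟩ := h0
    rw [adr_io]
  · rw [List.getD_eq_default]
    · rfl
    · rw [List.length_map]
      refine h.trans ?_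
      by_contra hlt
      refine h0 ?_
      have hR : 0 < 2 ^ K.l := by positivity
      have key : ∀ {x y : ℕ}, x * 2 ^ K.l + y < 2 ^ K.l → x = 0 := fun {x y} hxy => by
        by_contra hx
        have := Nat.le_mul_of_pos_left (2 ^ K.l) (Nat.pos_of_ne_zero hx)
        omega
      have h1 := key (not_le.1 hlt)
      obtain ⟨h2, h3⟩ := Nat.add_eq_zero_iff.1 h1
      have h4 := (Nat.mul_eq_zero.1 h2).resolve_right hR.ne'
      obtain ⟨h5, h6⟩ := Nat.add_eq_zero_iff.1 h4
      have h7 := (Nat.mul_eq_zero.1 h5).resolve_right hR.ne'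
      obtain ⟨h8, h9⟩ := Nat.add_eq_zero_iff.1 h7
      have h10 := (Nat.mul_eq_zero.1 h8).resolve_right hR.ne'
      exact ⟨Arr.idx_injective h10, h9, h6, h3⟩

namespace RowWeight

theorem card_codes_le (b : ℕ) {D : ℕ} (x : Fin D → WithTop ℤ) :
    ((Finset.univ.image fun k => entryCode b (x k)).erase 0).card ≤
      {z : ℤ | ∃ k, x k = z}.ncard := by
  have hfin : {z : ℤ | ∃ k, x k = z}.Finite :=
    show (((↑) : ℤ → WithTop ℤ) ⁻¹' Set.range x).Finite from
      (Set.finite_range x).preimage WithTop.coe_injective.injOn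
  rw [← Set.ncard_coe_finset]
  refine le_trans (Set.ncard_le_ncard ?_ (hfin.image fun z : ℤ => entryCode b (z : WithTop ℤ)))
    (Set.ncard_image_le hfin)
  intro y hy
  simp only [Finset.coe_erase, Finset.coe_image, Finset.coe_univ, Set.image_univ, Set.mem_sdiff,
    Set.mem_range, Set.mem_singleton_iff] at hy
  obtain ⟨⟨k, rfl⟩, h0⟩ := hy
  have hk : x k ≠ ⊤ := fun h => h0 (by rw [h]; rfl)
  obtain ⟨z, hz⟩ := WithTop.ne_top_iff_exists.1 hk
  exact ⟨z, ⟨k, hz.symm⟩, congrArg (entryCode b) hz⟩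

section Instances

variable {c d n D : ℕ}

/-- The rows of the first matrix, followed by the columns of the second matrix. -/
def allRows (I : RowWeightMinPlusInstance c d n D) (u k : ℕ) : WithTop ℤ :=
  if hk : k < D then
    if hu : u < n then I.A ⟨u, hu⟩ ⟨k, hk⟩
    else if hv : u - n < n then I.B ⟨k, hk⟩ ⟨u - n, hv⟩ else ⊤
  else ⊤

theorem allRows_left (I : RowWeightMinPlusInstance c d n D) (i : Fin n) (k : Fin D) :
    allRows I i k = I.A i k := by
  simp [allRows]

theorem allRows_right (I : RowWeightMinPlusInstance c d n D) (j : Fin n) (k : Fin D) :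
    allRows I (n + j) k = I.B k j := by
  simp [allRows]

theorem allRows_bounded (I : RowWeightMinPlusInstance c d n D) (u k : ℕ) (z : ℤ)
    (h : allRows I u k = z) : |z| ≤ (n ^ c : ℕ) := by
  rw [Nat.cast_pow]
  unfold allRows at h
  split_ifs at h
  · exact I.A_bounded _ _ _ h
  · exact I.B_bounded _ _ _ h
  · exact absurd h WithTop.top_ne_coe
  · exact absurd h WithTop.top_ne_coe

theorem allRows_distinct (I : RowWeightMinPlusInstance c d n D) {u : ℕ} (hu : u < 2 * n) :
    {z : ℤ | ∃ k : Fin D, allRows I u k = z}.ncard ≤ d := by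
  rcases lt_or_ge u n with h | h
  · have := I.A_rows ⟨u, h⟩
    simpa only [← allRows_left] using this
  · obtain ⟨j, rfl⟩ := Nat.exists_eq_add_of_le h
    have := I.B_columns ⟨j, by omega⟩
    simpa only [← allRows_right] using this

/-- The program computes the min-plus product. -/
theorem exec_product {K : Cfg} {κ₀ κ₁ a T : ℕ} (hK : Sizes K n c κ₀ κ₁ a)
    (hP : (pars n D c a).Fits K (d + 1))
    (hA : SolvesAPSP K.prog K.w₀ (4 * (8 * n)) (16 * n ^ c) T)
    (I : RowWeightMinPlusInstance c d n D) :
    ∃ (s : State K.w) (t : ℕ), Exec ((product c κ₀ κ₁ a).code K.prog 0)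
      (init K.w ([(((n : ℤ)) : WithTop ℤ), (((D : ℤ)) : WithTop ℤ)] ++ rowMajor I.A ++
        rowMajor I.B)) s t ∧
      Holds s ((rowMajor (minPlusProduct I.A I.B)).map WithBot.some) ∧
      t ≤ (product c κ₀ κ₁ a).size K.prog * productTime (pars n D c a) c (d + 1) T := by
  set input := [(((n : ℤ)) : WithTop ℤ), (((D : ℤ)) : WithTop ℤ)] ++ rowMajor I.A ++ rowMajor I.B
    with hinput
  have hr : 4096 * (n * n) + 4096 * n ^ c + 16 * ((c + 2) * (Nat.log 2 n + 1)) + 4096 ≤ 2 ^ K.l :=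
    hP.radix
  have hr2 := Cfg.radix_le K
  have hD : D ≤ n := hP.D_le
  have hn : 0 < n := hP.n_pos
  have hnD : n * D ≤ n * n := Nat.mul_le_mul_left _ hD
  have hnn := Nat.le_mul_self n
  have hw : 0 < K.w := by have := K.l_ge; have := K.l_le; omega
  have h2w : 2 ^ K.w = 2 * 2 ^ (K.w - 1) := by rw [← pow_succ', Nat.sub_add_cancel hw]
  have hlen : input.length = 2 + n * D + D * n := by
    simp only [hinput, List.length_append, rowMajor_length, List.length_cons, List.length_nil]
  have hl : input.length ≤ 2 ^ K.l := by rw [hlen, mul_comm D n]; omega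
  have hget : ∀ x e, input[x]? = some e →
      (initSt K.w input).m .io 0 0 0 x = (encode K.w e).toNat := fun x e he => by
    simp [initSt, List.getD_eq_getElem?_getD, List.getElem?_map, he]
  have hrow : ∀ u < n, ∀ k < D, (initSt K.w input).m .io 0 0 0 (2 + (u * D + k)) =
      (encode K.w (allRows I u k)).toNat := fun u hu k hk => hget _ _ <| by
    have hlt : u * D + k < n * D := mul_add_lt hk hu
    rw [hinput, List.append_assoc, List.getElem?_append_right (by simp),
      List.getElem?_append_left (by rw [rowMajor_length]; simp; omega)]
    have := rowMajor_getElem? I.A ⟨u, hu⟩ ⟨k, hk⟩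
    rw [← allRows_left] at this
    simpa using this
  have hcol : ∀ j < n, ∀ k < D, (initSt K.w input).m .io 0 0 0 (2 + (n * D + (k * n + j))) =
      (encode K.w (allRows I (n + j) k)).toNat := fun j hj k hk => hget _ _ <| by
    rw [hinput, List.append_assoc, List.getElem?_append_right (by simp),
      List.getElem?_append_right (by rw [rowMajor_length]; simp)]
    have := rowMajor_getElem? I.B ⟨k, hk⟩ ⟨j, hj⟩
    rw [← allRows_right] at this
    simpa [rowMajor_length] using this
  obtain ⟨σ, t, hb, hout, ht⟩ := product_spec (σ := initSt K.w input) (X := allRows I)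
    (S := fun u => (Finset.univ.image fun k : Fin D => entryCode (n ^ c) (allRows I u k)).erase 0)
    hK hP hA (fun u _ k _ z => allRows_bounded I u k z)
    (fun u _ k hk h0 => Finset.mem_erase.2 ⟨h0, Finset.mem_image.2
      ⟨⟨k, hk⟩, Finset.mem_univ _, rfl⟩⟩)
    (fun u hu => Nat.lt_succ_of_le ((card_codes_le _ _).trans (allRows_distinct I hu)))
    (((hget 0 _ rfl).trans (encode_natCast _ _)).trans (Nat.mod_eq_of_lt (by omega)))
    (((hget 1 _ rfl).trans (encode_natCast _ _)).trans (Nat.mod_eq_of_lt (by omega)))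
    hrow hcol (fun A hA _ _ _ _ => by simp [initSt, hA])
  obtain ⟨S, t', he, ht', -, hS⟩ := Stmt.code_spec K hb 0 (rep_initSt K hl)
  refine ⟨S, t', he, fun x hx => ?_, ht'.trans (Nat.mul_le_mul_left _ ht)⟩
  rw [List.length_map, rowMajor_length] at hx
  have hjn : x % n < n := Nat.mod_lt _ hn
  have hin : x / n < n := Nat.div_lt_of_lt_mul hx
  have hx' : x / n * n + x % n = x := Nat.div_add_mod' x n
  have hm := hS.m .io 0 0 0 x (by positivity) (by positivity) (by positivity) (by omega)
  rw [adr_io, ← hx', hout _ hin _ hjn, hx'] at hm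
  rw [decode_outWord hw (fun k _ => allRows_bounded I _ k) (fun k _ => allRows_bounded I _ k)
    (Nat.one_le_pow _ _ hn) (by omega) hm]
  have := rowMajor_getElem? (minPlusProduct I.A I.B) ⟨_, hin⟩ ⟨_, hjn⟩
  simp only [hx'] at this
  rw [List.getElem_map, ((List.getElem?_eq_some_iff.1 this).2)]
  congr 1
  simp only [minPlusProduct, Matrix.of_apply]
  congr 1
  funext k
  rw [← allRows_left, ← allRows_right]

end Instances

end RowWeight

end WordRAM

namespace WordRAM

/-! ### Sizes, and bounds for the time -/

theorem SolvesAPSP.mono {p : Prog} {w N M T M' T' : ℕ} (h : SolvesAPSP p w N M T) (hM : M' ≤ M)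
    (hT : T ≤ T') : SolvesAPSP p w N M' T' := by
  intro G wt hwt
  obtain ⟨s, t, h1, h2, h3⟩ := h G wt fun v => (hwt v).trans (by exact_mod_cast hM)
  exact ⟨s, t, h1, h2, h3.trans hT⟩

theorem exists_solvesAPSP_of_undirected {c : ℕ} {e : ℝ}
    (h : (undirectedNodeWeightedAPSP c).SolvableInTime fun n => (n : ℝ) ^ e) :
    ∃ (p : Prog) (κ : ℕ) (K : ℝ), ∀ N : ℕ, 1 ≤ N →
      SolvesAPSP p (κ * (Nat.log 2 N + 1)) N (N ^ c) ⌊K * (N : ℝ) ^ e⌋₊ := by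
  obtain ⟨p, κ, K, h⟩ := h
  refine ⟨p, κ, K, fun N hN G wt hwt => ?_⟩
  obtain ⟨s, t, h1, h2, h3⟩ := h N hN (G, ⟨wt, fun v => by exact_mod_cast hwt v⟩)
  exact ⟨s, t, h1, h2, Nat.le_floor h3⟩

/-- An undirected graph is passed on as the directed graph with the same adjacency relation. -/
theorem exists_solvesAPSP_of_directed {c : ℕ} {e : ℝ}
    (h : (directedNodeWeightedAPSP c).SolvableInTime fun n => (n : ℝ) ^ e) :
    ∃ (p : Prog) (κ : ℕ) (K : ℝ), ∀ N : ℕ, 1 ≤ N →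
      SolvesAPSP p (κ * (Nat.log 2 N + 1)) N (N ^ c) ⌊K * (N : ℝ) ^ e⌋₊ := by
  obtain ⟨p, κ, K, h⟩ := h
  refine ⟨p, κ, K, fun N hN G wt hwt => ?_⟩
  obtain ⟨s, t, h1, h2, h3⟩ := h N hN (⟨G.Adj⟩, ⟨wt, fun v => by exact_mod_cast hwt v⟩)
  exact ⟨s, t, h1, h2, Nat.le_floor h3⟩

namespace RowWeight

theorem log_graph_size {n : ℕ} (hn : n ≠ 0) : Nat.log 2 (4 * (8 * n)) = Nat.log 2 n + 5 := by
  have h : ∀ m : ℕ, m ≠ 0 → Nat.log 2 (2 * m) = Nat.log 2 m + 1 := fun m hm => by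
    rw [mul_comm]
    exact Nat.log_mul_base (by norm_num) hm
  rw [show 4 * (8 * n) = 2 * (2 * (2 * (2 * (2 * n)))) by ring, h _ (by omega), h _ (by omega),
    h _ (by omega), h _ (by omega), h _ (by omega)]

/-- The machine for the instances of size `n`.  The factor of `log n` in `l` is large enough for the
words of the subroutine (`6 κ₀`), for the squares of the indices and the entries (`2 c + 19`), and for
the constant `a` to be a word. -/
def machine (p : Prog) (n c κ₀ a : ℕ) : Cfg where
  w := 5 * (2 * c + 19 + 6 * κ₀ + a) * (Nat.log 2 n + 1)
  l := (2 * c + 19 + 6 * κ₀ + a) * (Nat.log 2 n + 1)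
  w₀ := κ₀ * (Nat.log 2 n + 1 + 5)
  prog := p
  l_ge := by nlinarith
  w₀_le := by
    have h := Nat.zero_le (Nat.log 2 n)
    nlinarith [Nat.zero_le (κ₀ * Nat.log 2 n), Nat.zero_le ((2 * c + 19 + a) * (Nat.log 2 n + 1))]
  l_le := le_of_eq (by ring)

theorem machine_sizes (p : Prog) (n c κ₀ a : ℕ) :
    Sizes (machine p n c κ₀ a) n c κ₀ (2 * c + 19 + 6 * κ₀ + a) a :=
  ⟨rfl, rfl, rfl, by omega⟩

theorem machine_radix (p : Prog) {n c κ₀ a : ℕ} :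
    4096 * (n * n) + 4096 * n ^ c + 16 * ((c + 2) * (Nat.log 2 n + 1)) + 4096 ≤
      2 ^ (machine p n c κ₀ a).l := by
  set L := Nat.log 2 n + 1 with hL
  have hn : n ≤ 2 ^ L := (Nat.lt_pow_succ_log_self (by norm_num) n).le
  have hone : 1 ≤ 2 ^ L := Nat.one_le_two_pow
  set B := 2 ^ ((c + 2) * L) with hB
  have hpow : ∀ k ≤ c + 2, n ^ k ≤ B := fun k hk => by
    rw [hB, mul_comm, pow_mul]
    exact (Nat.pow_le_pow_left hn k).trans (Nat.pow_le_pow_right hone hk)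
  have h1 := hpow 2 (by omega)
  have h2 := hpow c (by omega)
  have h3 : (c + 2) * L ≤ B := Nat.lt_two_pow_self.le
  have h4 : 1 ≤ B := Nat.one_le_two_pow
  have h5 : 2 ^ 14 * B ≤ 2 ^ (machine p n c κ₀ a).l := by
    rw [hB, ← pow_add]
    refine Nat.pow_le_pow_right two_pos ?_
    change 14 + (c + 2) * L ≤ (2 * c + 19 + 6 * κ₀ + a) * L
    have : 1 ≤ L := by omega
    nlinarith [Nat.zero_le ((c + 6 * κ₀ + a) * L)]
  rw [pow_two] at h1
  omega

theorem pars_fits (p : Prog) {n c κ₀ a d D : ℕ} (hn : 1 ≤ n) (hD : 1 ≤ D) (hDn : D ≤ n)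
    (hd : (d + 1) * D ≤ 8 * n) : (pars n D c a).Fits (machine p n c κ₀ a) (d + 1) where
  n_pos := hn
  D_pos := hD
  D_le := hDn
  nc_pos := Nat.one_le_pow _ _ hn
  g_pos := by simp [pars]
  g_le := by
    change 2 ^ ((Nat.log 2 n + 1) / a) ≤ 2 * n
    refine (Nat.pow_le_pow_right two_pos (Nat.div_le_self _ _)).trans ?_
    rw [pow_succ, mul_comm]
    exact Nat.mul_le_mul_left _ (Nat.pow_log_le_self 2 (by omega))
  dd_le := hd
  radix := machine_radix p

theorem roundTime_le {π : Pars} {dd T : ℕ} (hn : 1 ≤ π.n) (hdd : 1 ≤ dd) (hg : 1 ≤ π.g) :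
    roundTime π dd T ≤ 130 * (π.n ^ 2 * dd) + 22 * (π.n * (2 * π.n * π.D / π.g)) +
      21750 * (π.g ^ 2 * π.n ^ 2) + π.g ^ 2 * T := by
  unfold roundTime pairTime
  generalize 2 * π.n * π.D / π.g = q
  generalize π.n = n at *
  generalize π.g = g at *
  have h1 : n ≤ n ^ 2 := Nat.le_self_pow (by norm_num) n
  have h2 : n ^ 2 ≤ n ^ 2 * dd := Nat.le_mul_of_pos_right _ hdd
  have h3 : g ≤ g ^ 2 := Nat.le_self_pow (by norm_num) g
  have h4 : g ^ 2 * n ≤ g ^ 2 * n ^ 2 := Nat.mul_le_mul_left _ h1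
  have h5 : g ^ 2 * 1 ≤ g ^ 2 * n := Nat.mul_le_mul_left _ hn
  nlinarith

theorem productTime_le {π : Pars} {c dd T : ℕ} (hn : 1 ≤ π.n) (hD : π.D ≤ π.n)
    (hSc : 1 ≤ π.Sc) (hc : c ≤ π.Sc) :
    productTime π c dd T ≤ π.Sc * (120 * π.n ^ 2 + 3 * roundTime π dd T) := by
  unfold productTime
  generalize roundTime π dd T = R
  generalize π.n = n at *
  generalize π.D = D at *
  generalize π.Sc = S at *
  have h1 : n ≤ n ^ 2 := Nat.le_self_pow (by norm_num) n
  have h2 : n * D ≤ n ^ 2 := by rw [pow_two]; exact Nat.mul_le_mul_left _ hD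
  have h3 : S * (n * D) ≤ S * n ^ 2 := Nat.mul_le_mul_left _ h2
  have h4 : S * n ≤ S * n ^ 2 := Nat.mul_le_mul_left _ h1
  have h5 : S * 1 ≤ S * n := Nat.mul_le_mul_left _ hn
  have h6 : 1 * n ^ 2 ≤ S * n ^ 2 := Nat.mul_le_mul_right _ hSc
  nlinarith

end RowWeight

end WordRAM

namespace WordRAM

namespace RowWeight

/-! ### The running time as a power of `n` -/

theorem log_succ_le {η : ℝ} (hη : 0 < η) {n : ℕ} (hn : 1 ≤ n) :
    ((Nat.log 2 n + 1 : ℕ) : ℝ) ≤ (2 / η + 1) * (n : ℝ) ^ η := by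
  have hn' : (1 : ℝ) ≤ n := by exact_mod_cast hn
  have h1 : (Nat.log 2 n : ℝ) ≤ Real.logb 2 n := by exact_mod_cast Real.natLog_le_logb n 2
  have h2 := Real.log_le_rpow_div (Nat.cast_nonneg n) hη
  have h3 : (1 : ℝ) ≤ (n : ℝ) ^ η := Real.one_le_rpow hn' hη.le
  have hl2 : (1 / 2 : ℝ) < Real.log 2 := by have := Real.log_two_gt_d9; linarith
  have h4 : Real.logb 2 n ≤ 2 * ((n : ℝ) ^ η / η) := by
    rw [Real.logb, div_le_iff₀ (by linarith)]
    have : 0 ≤ (n : ℝ) ^ η / η := by positivity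
    nlinarith
  push_cast
  calc (Nat.log 2 n : ℝ) + 1 ≤ 2 * ((n : ℝ) ^ η / η) + (n : ℝ) ^ η := by linarith
    _ = _ := by ring

theorem two_pow_log_div_le {n a : ℕ} (hn : 1 ≤ n) (ha : 0 < a) :
    ((2 ^ ((Nat.log 2 n + 1) / a) : ℕ) : ℝ) ≤ 2 * (n : ℝ) ^ (1 / a : ℝ) := by
  have ha' : (0 : ℝ) < a := by exact_mod_cast ha
  have ha1 : (1 : ℝ) ≤ a := by exact_mod_cast ha
  set g := 2 ^ ((Nat.log 2 n + 1) / a)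
  have h1 : g ^ a ≤ 2 * n := by
    rw [← pow_mul]
    refine (Nat.pow_le_pow_right two_pos (Nat.div_mul_le_self _ _)).trans ?_
    rw [pow_succ, mul_comm]
    exact Nat.mul_le_mul_left _ (Nat.pow_log_le_self 2 (by omega))
  have h2 : (g : ℝ) ^ a ≤ 2 * n := by exact_mod_cast h1
  have h3 : (2 : ℝ) ^ (1 / a : ℝ) ≤ 2 := by
    conv_rhs => rw [← Real.rpow_one 2]
    refine Real.rpow_le_rpow_of_exponent_le (by norm_num) ?_
    rw [div_le_one ha']
    exact ha1
  calc (g : ℝ) = ((g : ℝ) ^ a) ^ (1 / a : ℝ) := by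
        rw [one_div, Real.pow_rpow_inv_natCast (Nat.cast_nonneg _) ha.ne']
    _ ≤ (2 * n : ℝ) ^ (1 / a : ℝ) := Real.rpow_le_rpow (by positivity) h2 (by positivity)
    _ = 2 ^ (1 / a : ℝ) * (n : ℝ) ^ (1 / a : ℝ) := Real.mul_rpow (by norm_num) (by positivity)
    _ ≤ _ := mul_le_mul_of_nonneg_right h3 (by positivity)

theorem le_two_pow_log_div {n a : ℕ} (ha : 0 < a) :
    (n : ℝ) ^ (1 / a : ℝ) ≤ 2 * ((2 ^ ((Nat.log 2 n + 1) / a) : ℕ) : ℝ) := by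
  set g := 2 ^ ((Nat.log 2 n + 1) / a) with hg
  have h1 : n ≤ (2 * g) ^ a := by
    refine (Nat.lt_pow_succ_log_self (b := 2) (by norm_num) n).le.trans ?_
    rw [hg, ← pow_succ', ← pow_mul]
    refine Nat.pow_le_pow_right two_pos ?_
    rw [mul_comm]
    exact (Nat.lt_mul_div_succ _ ha).le
  have h2 : (n : ℝ) ≤ (2 * g : ℝ) ^ a := by exact_mod_cast h1
  calc (n : ℝ) ^ (1 / a : ℝ) ≤ ((2 * g : ℝ) ^ a) ^ (1 / a : ℝ) :=
        Real.rpow_le_rpow (by positivity) h2 (by positivity)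
    _ = _ := by rw [one_div, Real.pow_rpow_inv_natCast (by positivity) ha.ne']

theorem ceil_rpow_le {n : ℕ} (hn : 1 ≤ n) {y : ℝ} (hy : 0 ≤ y) :
    (⌈(n : ℝ) ^ y⌉₊ : ℝ) ≤ 2 * (n : ℝ) ^ y := by
  have h1 : (1 : ℝ) ≤ (n : ℝ) ^ y := Real.one_le_rpow (by exact_mod_cast hn) hy
  have := Nat.ceil_lt_add_one (a := (n : ℝ) ^ y) (by linarith)
  linarith

theorem one_le_ceil_rpow {n : ℕ} (hn : 1 ≤ n) (y : ℝ) : 1 ≤ ⌈(n : ℝ) ^ y⌉₊ :=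
  Nat.one_le_ceil_iff.2 (Real.rpow_pos_of_pos (by exact_mod_cast hn) y)

theorem ceil_rpow_le_self {n : ℕ} (hn : 1 ≤ n) {y : ℝ} (hy : y ≤ 1) : ⌈(n : ℝ) ^ y⌉₊ ≤ n := by
  refine Nat.ceil_le.2 ?_
  conv_rhs => rw [← Real.rpow_one (n : ℝ)]
  exact Real.rpow_le_rpow_of_exponent_le (by exact_mod_cast hn) hy

theorem ceil_succ_mul_ceil_le {n : ℕ} (hn : 1 ≤ n) {x : ℝ} (hx₀ : 0 ≤ x) (hx₁ : x ≤ 1) :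
    (⌈(n : ℝ) ^ (1 - x)⌉₊ + 1) * ⌈(n : ℝ) ^ x⌉₊ ≤ 8 * n := by
  have hn' : (1 : ℝ) ≤ n := by exact_mod_cast hn
  have h1 := ceil_rpow_le hn (y := 1 - x) (by linarith)
  have h2 := ceil_rpow_le hn hx₀
  have h3 : (1 : ℝ) ≤ (n : ℝ) ^ (1 - x) := Real.one_le_rpow hn' (by linarith)
  have h4 : (n : ℝ) ^ (1 - x) * (n : ℝ) ^ x = n := by
    rw [← Real.rpow_add (by linarith)]
    simp
  have : ((⌈(n : ℝ) ^ (1 - x)⌉₊ : ℝ) + 1) * ⌈(n : ℝ) ^ x⌉₊ ≤ 8 * n := by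
    calc _ ≤ (3 * (n : ℝ) ^ (1 - x)) * (2 * (n : ℝ) ^ x) := by gcongr; linarith
      _ = 6 * n := by linear_combination 6 * h4
      _ ≤ _ := by linarith
  exact_mod_cast this

/-- The running time in terms of `n`.  With `δ = 1 / a`, the four terms `n² d`, `n² D / g`, `g² n²` and
`g² T` are `O(n ^ (2 + x - δ))`: the first because `δ ≤ 2 x - 1`, the second because `g` is at least
`n ^ δ / 2`, and the others because `g` is at most `2 n ^ δ` and `3 δ` is at most `ε` and at most
`2 x - 1`.  The factor `log n` costs another `n ^ (δ / 2)`. -/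
theorem exists_productTime_le {x ε : ℝ} (hx₁ : x < 1) {a : ℕ} (ha : 0 < a)
    (ha₁ : 3 / (a : ℝ) ≤ ε) (ha₂ : 3 / (a : ℝ) ≤ 2 * x - 1) (c : ℕ) {K : ℝ} (hK : 0 ≤ K) {T : ℕ → ℕ}
    (hT : ∀ n : ℕ, 1 ≤ n → (T n : ℝ) ≤ K * (n : ℝ) ^ (2 + x - ε)) :
    ∃ C : ℝ, ∀ n : ℕ, 1 ≤ n → (productTime (pars n ⌈(n : ℝ) ^ x⌉₊ c a) c
      (⌈(n : ℝ) ^ (1 - x)⌉₊ + 1) (T n) : ℝ) ≤ C * (n : ℝ) ^ (2 + x - 1 / (2 * a)) := by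
  have ha' : (0 : ℝ) < a := by exact_mod_cast ha
  set δ : ℝ := 1 / a with hδ
  have hδ0 : 0 < δ := by positivity
  have h3δ : 3 / (a : ℝ) = 3 * δ := by rw [hδ]; ring
  rw [h3δ] at ha₁ ha₂
  have hη : 1 / (2 * (a : ℝ)) = δ / 2 := by rw [hδ]; field_simp
  rw [hη]
  refine ⟨((c + 2 : ℕ) : ℝ) * (2 / (δ / 2) + 1) * (120 + 3 * (390 + 176 + 87000 + 4 * K)),
    fun n hn => ?_⟩
  have hn' : (1 : ℝ) ≤ n := by exact_mod_cast hn
  have hn0 : (0 : ℝ) < n := by linarith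
  set D := ⌈(n : ℝ) ^ x⌉₊ with hD
  set d := ⌈(n : ℝ) ^ (1 - x)⌉₊ with hd
  set π := pars n D c a with hπ
  have hg1 : 1 ≤ π.g := Nat.one_le_two_pow
  have hSc : c + 2 ≤ π.Sc := Nat.le_mul_of_pos_right _ (Nat.succ_pos _)
  have hDn : D ≤ n := ceil_rpow_le_self hn hx₁.le
  have t1 := productTime_le (π := π) (c := c) (dd := d + 1) (T := T n) hn hDn (by omega) (by omega)
  have t2 := roundTime_le (π := π) (dd := d + 1) (T := T n) hn (by omega) hg1
  have t1' : (productTime π c (d + 1) (T n) : ℝ) ≤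
      π.Sc * (120 * (n : ℝ) ^ 2 + 3 * roundTime π (d + 1) (T n)) := by exact_mod_cast t1
  have t2' : (roundTime π (d + 1) (T n) : ℝ) ≤ 130 * ((n : ℝ) ^ 2 * (d + 1 : ℕ)) +
      22 * (n * (2 * n * D / π.g : ℕ)) + 21750 * ((π.g : ℝ) ^ 2 * (n : ℝ) ^ 2) +
      (π.g : ℝ) ^ 2 * T n := by exact_mod_cast t2
  -- all four terms are at most a constant times `W`
  set W := (n : ℝ) ^ (2 + x - δ) with hW
  have hle : ∀ {y : ℝ}, y ≤ 2 + x - δ → (n : ℝ) ^ y ≤ W := fun hy =>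
    Real.rpow_le_rpow_of_exponent_le hn' hy
  have hsq : (n : ℝ) ^ 2 = (n : ℝ) ^ (2 : ℝ) := by norm_cast
  have hgle : (π.g : ℝ) ≤ 2 * (n : ℝ) ^ δ := two_pow_log_div_le hn ha
  have hgge : (n : ℝ) ^ δ ≤ 2 * (π.g : ℝ) := le_two_pow_log_div ha
  have hg0 : (0 : ℝ) < π.g := by exact_mod_cast hg1
  have hg2 : (π.g : ℝ) ^ 2 ≤ 4 * (n : ℝ) ^ (2 * δ) := by
    calc (π.g : ℝ) ^ 2 ≤ (2 * (n : ℝ) ^ δ) ^ 2 := by gcongr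
      _ = 4 * ((n : ℝ) ^ δ * (n : ℝ) ^ δ) := by ring
      _ = _ := by rw [← Real.rpow_add hn0, two_mul]
  have b0 : (n : ℝ) ^ 2 ≤ W := by rw [hsq]; exact hle (by linarith)
  have b1 : (n : ℝ) ^ 2 * (d + 1 : ℕ) ≤ 3 * W := by
    have h1 := ceil_rpow_le hn (y := 1 - x) (by linarith)
    have h3 : (1 : ℝ) ≤ (n : ℝ) ^ (1 - x) := Real.one_le_rpow hn' (by linarith)
    calc (n : ℝ) ^ 2 * (d + 1 : ℕ) ≤ (n : ℝ) ^ (2 : ℝ) * (3 * (n : ℝ) ^ (1 - x)) := by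
          rw [hsq]; push_cast; gcongr; linarith
      _ = 3 * (n : ℝ) ^ (2 + (1 - x)) := by rw [Real.rpow_add hn0]; ring
      _ ≤ 3 * W := by gcongr; exact hle (by linarith)
  have b2 : (n : ℝ) * (2 * n * D / π.g : ℕ) ≤ 8 * W := by
    have h1 : ((2 * n * D / π.g : ℕ) : ℝ) ≤ 2 * n * D / π.g := by
      exact_mod_cast Nat.cast_div_le (α := ℝ) (m := 2 * n * D) (n := π.g)
    have h2 : (D : ℝ) ≤ 2 * (n : ℝ) ^ x := ceil_rpow_le hn (by linarith)
    have h3 : (n : ℝ) ^ (2 + x) = W * (n : ℝ) ^ δ := by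
      rw [hW, ← Real.rpow_add hn0]; congr 1; ring
    calc (n : ℝ) * (2 * n * D / π.g : ℕ) ≤ n * (2 * n * D / π.g) := by gcongr
      _ = 2 * ((n : ℝ) ^ 2 * D) / π.g := by ring
      _ ≤ 2 * ((n : ℝ) ^ (2 : ℝ) * (2 * (n : ℝ) ^ x)) / π.g := by rw [hsq]; gcongr
      _ = 4 * (n : ℝ) ^ (2 + x) / π.g := by rw [Real.rpow_add hn0]; ring
      _ ≤ 4 * (W * (2 * π.g)) / π.g := by rw [h3]; gcongr
      _ = 8 * W := by field_simp; ring
  have b3 : (π.g : ℝ) ^ 2 * (n : ℝ) ^ 2 ≤ 4 * W := by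
    calc (π.g : ℝ) ^ 2 * (n : ℝ) ^ 2 ≤ 4 * (n : ℝ) ^ (2 * δ) * (n : ℝ) ^ (2 : ℝ) := by
          rw [← hsq]; gcongr
      _ = 4 * (n : ℝ) ^ (2 * δ + 2) := by rw [Real.rpow_add hn0]; ring
      _ ≤ 4 * W := by gcongr; exact hle (by linarith)
  have b4 : (π.g : ℝ) ^ 2 * T n ≤ 4 * K * W := by
    calc (π.g : ℝ) ^ 2 * T n ≤ 4 * (n : ℝ) ^ (2 * δ) * (K * (n : ℝ) ^ (2 + x - ε)) := by
          gcongr; exact hT n hn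
      _ = 4 * K * (n : ℝ) ^ (2 * δ + (2 + x - ε)) := by rw [Real.rpow_add hn0]; ring
      _ ≤ 4 * K * W := by gcongr; exact hle (by linarith)
  have hS : (π.Sc : ℝ) ≤ ((c + 2 : ℕ) : ℝ) * ((2 / (δ / 2) + 1) * (n : ℝ) ^ (δ / 2)) := by
    have : (π.Sc : ℝ) = ((c + 2 : ℕ) : ℝ) * ((Nat.log 2 n + 1 : ℕ) : ℝ) := by
      rw [← Nat.cast_mul]; rfl
    rw [this]
    gcongr
    exact log_succ_le (by linarith) hn
  have hfin : (n : ℝ) ^ (2 + x - δ / 2) = (n : ℝ) ^ (δ / 2) * W := by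
    rw [hW, ← Real.rpow_add hn0]; congr 1; ring
  have hR : 120 * (n : ℝ) ^ 2 + 3 * roundTime π (d + 1) (T n) ≤
      (120 + 3 * (390 + 176 + 87000 + 4 * K)) * W := by linarith
  calc (productTime π c (d + 1) (T n) : ℝ) ≤
        π.Sc * (120 * (n : ℝ) ^ 2 + 3 * roundTime π (d + 1) (T n)) := t1'
    _ ≤ (((c + 2 : ℕ) : ℝ) * ((2 / (δ / 2) + 1) * (n : ℝ) ^ (δ / 2))) *
        ((120 + 3 * (390 + 176 + 87000 + 4 * K)) * W) := by gcongr
    _ = _ := by rw [hfin]; ring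

/-- The reduction, from an algorithm for undirected graphs. -/
theorem solvableInTime_of_solvesAPSP {x ε : ℝ} (hx₀ : 1 / 2 < x) (hx₁ : x < 1) (hε : 0 < ε)
    (h : ∀ c : ℕ, ∃ (p : Prog) (κ : ℕ) (K : ℝ), ∀ N : ℕ, 1 ≤ N →
      SolvesAPSP p (κ * (Nat.log 2 N + 1)) N (N ^ c) ⌊K * (N : ℝ) ^ (2 + x - ε)⌋₊) :
    ∃ ε' : ℝ, 0 < ε' ∧ ∀ c : ℕ,
      (rowWeightMinPlus c (fun n => ⌈(n : ℝ) ^ (1 - x)⌉₊)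
        (fun n => ⌈(n : ℝ) ^ x⌉₊)).SolvableInTime fun n => (n : ℝ) ^ (2 + x - ε') := by
  obtain ⟨a, ha⟩ := exists_nat_gt (3 / min ε (2 * x - 1))
  have hmin : 0 < min ε (2 * x - 1) :=
    lt_min hε (by linarith)
  have ha' : (0 : ℝ) < a := lt_trans (by positivity) ha
  have ha0 : 0 < a := by exact_mod_cast ha'
  have hle : 3 / (a : ℝ) ≤ min ε (2 * x - 1) := by
    rw [div_lt_iff₀ hmin] at ha
    rw [div_le_iff₀ ha']
    linarith
  simp only [le_min_iff] at hle
  refine ⟨1 / (2 * a), by positivity, fun c => ?_⟩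
  -- the weights are at most `16 n ^ c`, which is at most `(32 n) ^ (c + 1)`
  obtain ⟨p, κ₀, K, hp⟩ := h (c + 1)
  have hT : ∀ n : ℕ, 1 ≤ n → ((⌊K * ((4 * (8 * n) : ℕ) : ℝ) ^ (2 + x - ε)⌋₊ : ℕ) : ℝ) ≤
      |K| * 32 ^ (2 + x - ε) * (n : ℝ) ^ (2 + x - ε) := by
    intro n hn
    have hnn : (0 : ℝ) ≤ ((4 * (8 * n) : ℕ) : ℝ) ^ (2 + x - ε) := by positivity
    calc _ ≤ ((⌊|K| * ((4 * (8 * n) : ℕ) : ℝ) ^ (2 + x - ε)⌋₊ : ℕ) : ℝ) := by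
          exact_mod_cast Nat.floor_mono (mul_le_mul_of_nonneg_right (le_abs_self K) hnn)
      _ ≤ |K| * ((4 * (8 * n) : ℕ) : ℝ) ^ (2 + x - ε) := Nat.floor_le (by positivity)
      _ = _ := by
        rw [mul_assoc, ← Real.mul_rpow (by norm_num) (by positivity)]
        congr 2
        push_cast
        ring
  obtain ⟨C, hC⟩ := exists_productTime_le hx₁ ha0 hle.1 hle.2 c
    (K := |K| * 32 ^ (2 + x - ε)) (by positivity)
    (T := fun n => ⌊K * ((4 * (8 * n) : ℕ) : ℝ) ^ (2 + x - ε)⌋₊) hT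
  set κ₁ := 2 * c + 19 + 6 * κ₀ + a with hκ₁
  refine ⟨(product c κ₀ κ₁ a).code p 0, 5 * κ₁, (product c κ₀ κ₁ a).size p * C,
    fun n hn I => ?_⟩
  have hA : SolvesAPSP p (κ₀ * (Nat.log 2 n + 1 + 5)) (4 * (8 * n)) (16 * n ^ c)
      ⌊K * ((4 * (8 * n) : ℕ) : ℝ) ^ (2 + x - ε)⌋₊ := by
    have := hp (4 * (8 * n)) (by omega)
    rw [log_graph_size (by omega), show Nat.log 2 n + 5 + 1 = Nat.log 2 n + 1 + 5 by ring] at this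
    refine this.mono ?_ le_rfl
    rw [pow_succ, mul_comm]
    exact Nat.mul_le_mul (Nat.pow_le_pow_left (by omega) c) (by omega)
  obtain ⟨s, t, h1, h2, h3⟩ := exec_product (machine_sizes p n c κ₀ a)
    (pars_fits p hn (one_le_ceil_rpow hn x) (ceil_rpow_le_self hn hx₁.le)
      (ceil_succ_mul_ceil_le hn (by linarith) hx₁.le)) hA I
  refine ⟨s, t, h1, h2, ?_⟩
  calc (t : ℝ) ≤ ((product c κ₀ κ₁ a).size p * productTime (pars n ⌈(n : ℝ) ^ x⌉₊ c a) c
          (⌈(n : ℝ) ^ (1 - x)⌉₊ + 1) ⌊K * ((4 * (8 * n) : ℕ) : ℝ) ^ (2 + x - ε)⌋₊ : ℕ) := by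
        exact_mod_cast h3
    _ ≤ (product c κ₀ κ₁ a).size p * (C * (n : ℝ) ^ (2 + x - 1 / (2 * a))) := by
        rw [Nat.cast_mul]
        exact mul_le_mul_of_nonneg_left (hC n hn) (Nat.cast_nonneg _)
    _ = _ := by ring

end RowWeight

end WordRAM

theorem mainTheorem6 (x : ℝ) (hx₀ : 1 / 2 < x) (hx₁ : x < 1)
    (h : (∃ ε : ℝ, 0 < ε ∧ ∀ c : ℕ,
          (directedNodeWeightedAPSP c).SolvableInTime fun n => (n : ℝ) ^ (2 + x - ε)) ∨
        (∃ ε : ℝ, 0 < ε ∧ ∀ c : ℕ,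
          (undirectedNodeWeightedAPSP c).SolvableInTime fun n => (n : ℝ) ^ (2 + x - ε))) :
    ∃ ε' : ℝ, 0 < ε' ∧ ∀ c : ℕ,
      (rowWeightMinPlus c (fun n => ⌈(n : ℝ) ^ (1 - x)⌉₊)
        (fun n => ⌈(n : ℝ) ^ x⌉₊)).SolvableInTime fun n => (n : ℝ) ^ (2 + x - ε') := by
  rcases h with ⟨ε, hε, h⟩ | ⟨ε, hε, h⟩
  · exact WordRAM.RowWeight.solvableInTime_of_solvesAPSP hx₀ hx₁ hε fun c =>
      WordRAM.exists_solvesAPSP_of_directed (h c)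
  · exact WordRAM.RowWeight.solvableInTime_of_solvesAPSP hx₀ hx₁ hε fun c =>
      WordRAM.exists_solvesAPSP_of_undirected (h c)
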